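/- Let $d\ge 1$, and let $\mathbb H^d$ be hyperbolic space of dimension $d$ (the half-space $\{x\in\mathbb R^d : x_1>0\}$ with the metric $dx^2/x_1^2$), with hyperbolic distance $\operatorname{dist}$, Riemannian volume $\mu$ and (non-positive) Laplace–Beltrami operator $\Delta$. The heat kernel of $\mathbb H^d$ is the smallest nonnegative fundamental solution $K(x,y,t)$ of the heat equation: the smallest among the nonnegative continuous functions $K$ on $\mathbb H^d\times\mathbb H^d\times(0,\infty)$ that are $C^2$ in $x$ and $C^1$ in $t$, satisfy $\partial_t K=\Delta_x K$, and satisfy $\lim_{t\downarrow 0}\int K(x,y,t)f(x)\,d\mu(x)=f(y)$ for every $y\in\mathbb H^d$ and every continuous compactly supported $f$ on $\mathbb H^d$. **Lemma.** The heat kernel of $\mathbb H^d$ exists, is unique, and depends only on the hyperbolic distance and the time: it equals $p_d(\rho,t)$ with $\rho=\operatorname{dist}(x,y)$. For each $t>0$, the function $\rho\mapsto p_d(\rho,t)$ is (strictly) decreasing on $[0,\infty)$. -/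

import Mathlib

open MeasureTheory Set Filter Topology

noncomputable section

namespace HypHeat

/-- Coordinate space of dimension `d`, with its Euclidean norm. -/
abbrev Coord (d : ℕ) : Type := EuclideanSpace ℝ (Fin d)

/-- The `i`-th partial derivative of `u` at `x`. -/
def partialDeriv {d : ℕ} (i : Fin d) (u : Coord d → ℝ) (x : Coord d) : ℝ :=
  fderiv ℝ u x (EuclideanSpace.single i 1)

/-- The Riemannian volume density `√(det g)` of a metric `g` given in coordinates. -/
def volumeDensity {d : ℕ} (g : Coord d → Matrix (Fin d) (Fin d) ℝ) (x : Coord d) : ℝ :=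
  Real.sqrt (g x).det

/-- The (non-positive) Laplace-Beltrami operator of a metric `g` given in coordinates:
`Δ u = (1 / √det g) ∑ i, ∂_i (∑ j, √det g * g^{ij} * ∂_j u)`. -/
def laplaceBeltrami {d : ℕ} (g : Coord d → Matrix (Fin d) (Fin d) ℝ)
    (u : Coord d → ℝ) (x : Coord d) : ℝ :=
  (volumeDensity g x)⁻¹ *
    ∑ i, partialDeriv i
      (fun z => ∑ j, volumeDensity g z * (g z)⁻¹ i j * partialDeriv j u z) x

variable (d : ℕ) [NeZero d]

/-- Hyperbolic space `ℍ^d` in the upper half-space model: the points whose first coordinate is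
positive. -/
def hypSpace : Set (Coord d) := {x | 0 < x 0}

/-- The hyperbolic metric `ds² = dx² / x_1²`, where `x_1` is the first coordinate. -/
def hypMetric (x : Coord d) : Matrix (Fin d) (Fin d) ℝ :=
  Matrix.diagonal (fun _ => 1 / (x 0) ^ 2)

/-- The hyperbolic distance; for `d = 2` this is the formula by which Mathlib defines the distance
on `UpperHalfPlane`. Equivalently `cosh (hypDist x y) = 1 + ‖x - y‖² / (2 x_1 y_1)`. -/
def hypDist (x y : Coord d) : ℝ :=
  2 * Real.arsinh (dist x y / (2 * Real.sqrt (x 0 * y 0)))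

/-- The Riemannian volume measure of hyperbolic space. -/
def hypVolume : Measure (Coord d) :=
  (volume.restrict (hypSpace d)).withDensity
    (fun x => ENNReal.ofReal (volumeDensity (hypMetric d) x))

/-- `K x y t` is a nonnegative fundamental solution of the heat equation `∂_t K = Δ_x K` on
`ℍ^d`: it is continuous in `(x, y, t)`, of class `C²` in `x` and `C¹` in `t`, nonnegative,
solves the equation for `t > 0`, and `K (·, y, t)` tends to the Dirac mass at `y` as `t ↓ 0`.
Only the values at `x, y ∈ ℍ^d` and `t > 0` matter. -/
structure IsFundamentalSolution (K : Coord d → Coord d → ℝ → ℝ) : Prop where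
  continuousOn : ContinuousOn (fun q : Coord d × Coord d × ℝ => K q.1 q.2.1 q.2.2)
    (hypSpace d ×ˢ hypSpace d ×ˢ Ioi (0 : ℝ))
  contDiffOn_space : ∀ y ∈ hypSpace d, ∀ t : ℝ, 0 < t →
    ContDiffOn ℝ 2 (fun x => K x y t) (hypSpace d)
  contDiffOn_time : ∀ x ∈ hypSpace d, ∀ y ∈ hypSpace d,
    ContDiffOn ℝ 1 (fun t => K x y t) (Ioi (0 : ℝ))
  nonneg : ∀ x ∈ hypSpace d, ∀ y ∈ hypSpace d, ∀ t : ℝ, 0 < t → 0 ≤ K x y t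
  heat_eq : ∀ x ∈ hypSpace d, ∀ y ∈ hypSpace d, ∀ t : ℝ, 0 < t →
    deriv (fun s => K x y s) t = laplaceBeltrami (hypMetric d) (fun z => K z y t) x
  tendsto_dirac : ∀ y ∈ hypSpace d, ∀ f : Coord d → ℝ, Continuous f → HasCompactSupport f →
    tsupport f ⊆ hypSpace d →
    Tendsto (fun t : ℝ => ∫ x, K x y t * f x ∂(hypVolume d)) (𝓝[>] 0) (𝓝 (f y))

/-- `K` is the heat kernel of `ℍ^d`: the smallest nonnegative fundamental solution of the heat
equation. -/
structure IsHeatKernel (K : Coord d → Coord d → ℝ → ℝ) : Prop where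
  isFundamentalSolution : IsFundamentalSolution d K
  minimal : ∀ K' : Coord d → Coord d → ℝ → ℝ, IsFundamentalSolution d K' →
    ∀ x ∈ hypSpace d, ∀ y ∈ hypSpace d, ∀ t : ℝ, 0 < t → K x y t ≤ K' x y t

end HypHeat

end

noncomputable section

namespace HypHeat

/-! The kernel is written down explicitly and shown to be the smallest nonnegative fundamental
solution. Put $u=\cosh\rho$, and let $P_j(u,t)=(-\partial_u)^{j/2}\big[(4\pi
t)^{-1/2}e^{-\operatorname{arcosh}(u)^2/4t}\big]$ (`profile`). In dimension $n+1$ the kernel is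
$(2\pi)^{-n/2}e^{-n^2t/4}P_n(\cosh\rho,t)$ (`hypKernel`). For odd $j$ the half derivative is an
ordinary derivative followed by the Weyl half integral $g\mapsto(2\pi)^{-1/2}\int_{\mathbb
R}g(u+w^2/2)\,dw$.

Monotonicity is positivity in disguise: $\partial_uP_j=-P_{j+2}$. The function
$A(u)=\operatorname{arcosh}u/\sqrt{u^2-1}=\int_0^1 2\,dx/(x^2+2xu+1)$ satisfies $(-1)^kA^{(k)}>0$ on
$(0,\infty)$, and $-\partial_uP_0=(2t)^{-1}AP_0$. The Leibniz rule therefore expresses every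
integer-order derivative as a sum of positive terms, and half integration preserves positivity
(`oddProfile_pos`, `profile_pos`, `profile_antitoneOn`). The integral formula also makes everything
smooth across $u=1$, that is, at $\rho=0$.

Heat equation: a function of $u$ has Laplacian $(u^2-1)\partial_u^2+(n+1)u\partial_u$
(`hypCosh_gradient`, `hypCosh_laplacian`). For $n=0$ the equation is that of the Gaussian in $\rho$.
Each $u$-derivative raises the dimension by two, and a half integral lowers it by one
(`oddProfile_heat_eq`, `profile_heat_eq`); the factor $e^{-n^2t/4}$ removes the zero-order term.

Initial condition: in the half-space, $u=(a/b+b/a)/2+|w|^2/2ab$, where $a,b$ are the first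
coordinates and $w$ is the difference of the others. Integrating over $w$ lowers the index from $n$
to $0$ and leaves a Gaussian integral in $\log(a/b)$. This gives total mass one
(`lintegral_hypKernel`) and a uniformly vanishing tail (`lintegral_hypKernel_far_le`).

Minimality: for a nonnegative fundamental solution $K$, cut $K(\cdot,y,s)$ off to compact support
and let it flow by the explicit kernel. The minimum principle bounds the result by $K(x,y,t+s)$
(`heatFlow_le_of_le`), and $s\downarrow0$ gives `hypKernel_le`. Two smallest elements coincide, so
the heat kernel is unique. -/

/-! ### Calculus: parameter integrals and mixed partial derivatives. -/

/-- Differentiation under the integral sign over a compact set. -/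
lemma hasDerivAt_setIntegral_of_continuousOn {α : Type*} [TopologicalSpace α] [T2Space α]
    [SecondCountableTopology α] [MeasurableSpace α] [BorelSpace α] {μ : Measure α} {V : Set ℝ}
    {K : Set α} {f f' : ℝ → α → ℝ} {s₀ : ℝ} (hV : IsOpen V) (hs₀ : s₀ ∈ V) (hK : IsCompact K)
    (hμ : μ K ≠ ⊤)
    (hf : ContinuousOn (fun q : ℝ × α => f q.1 q.2) (V ×ˢ K))
    (hf' : ContinuousOn (fun q : ℝ × α => f' q.1 q.2) (V ×ˢ K))
    (hd : ∀ s ∈ V, ∀ z ∈ K, HasDerivAt (fun s => f s z) (f' s z) s) :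
    HasDerivAt (fun s => ∫ z in K, f s z ∂μ) (∫ z in K, f' s₀ z ∂μ) s₀ := by
  obtain ⟨r, hr, hrV⟩ := Metric.nhds_basis_closedBall.mem_iff.1 (hV.mem_nhds hs₀)
  have hsl : ∀ {h : ℝ → α → ℝ}, ContinuousOn (fun q : ℝ × α => h q.1 q.2) (V ×ˢ K) →
      ∀ s ∈ V, ContinuousOn (h s) K := fun {h} hh s hs =>
    hh.comp (f := fun z => (s, z)) (by fun_prop) (fun z hz => ⟨hs, hz⟩)
  have hint : ∀ {h : ℝ → α → ℝ}, ContinuousOn (fun q : ℝ × α => h q.1 q.2) (V ×ˢ K) →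
      ∀ s ∈ V, AEStronglyMeasurable (h s) (μ.restrict K) := fun hh s hs =>
    (hsl hh s hs).aestronglyMeasurable_of_isCompact hK hK.measurableSet
  obtain ⟨C, hC⟩ := ((isCompact_closedBall s₀ r).prod hK).exists_bound_of_continuousOn
    (hf'.mono (prod_mono hrV le_rfl))
  refine (hasDerivAt_integral_of_dominated_loc_of_deriv_le (bound := fun _ => C)
    (Metric.closedBall_mem_nhds s₀ hr) ?_ ?_ (hint hf' s₀ hs₀) ?_ ?_ ?_).2
  · filter_upwards [hV.mem_nhds hs₀] with s hs using hint hf s hs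
  · obtain ⟨C', hC'⟩ := hK.exists_bound_of_continuousOn (hsl hf s₀ hs₀)
    exact Integrable.mono' (integrableOn_const (C := C') hμ) (hint hf s₀ hs₀)
      ((ae_restrict_iff' hK.measurableSet).2 (ae_of_all _ hC'))
  · refine (ae_restrict_iff' hK.measurableSet).2 (ae_of_all _ fun z hz s hs => ?_)
    exact hC (s, z) ⟨hs, hz⟩
  · exact integrableOn_const hμ
  · exact (ae_restrict_iff' hK.measurableSet).2 (ae_of_all _ fun z hz s hs => hd s (hrV hs) z hz)

/-- If `g = ∂ₓ f`, `R = ∂ₜ f` and `S = ∂ₓ R` on an open rectangle, then `S = ∂ₜ g`. -/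
lemma hasDerivAt_partial_comm {f g R S : ℝ → ℝ → ℝ} {a b : ℝ}
    (hf : ∀ x, a < x → ∀ t, b < t → HasDerivAt (fun x => f x t) (g x t) x)
    (hR : ∀ x, a < x → ∀ t, b < t → HasDerivAt (fun t => f x t) (R x t) t)
    (hS : ∀ x, a < x → ∀ t, b < t → HasDerivAt (fun x => R x t) (S x t) x)
    (hRc : ContinuousOn (fun q : ℝ × ℝ => R q.1 q.2) (Ioi a ×ˢ Ioi b))
    (hSc : ContinuousOn (fun q : ℝ × ℝ => S q.1 q.2) (Ioi a ×ˢ Ioi b))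
    {x t : ℝ} (hx : a < x) (ht : b < t) : HasDerivAt (fun t => g x t) (S x t) t := by
  obtain ⟨s, hbs, hst⟩ := exists_between ht
  have hslice : ∀ {h : ℝ → ℝ → ℝ}, ContinuousOn (fun q : ℝ × ℝ => h q.1 q.2) (Ioi a ×ˢ Ioi b) →
      ∀ x, a < x → ContinuousOn (h x) (Ioi b) := fun {h} hh x hx =>
    hh.comp (f := fun t => (x, t)) (by fun_prop) (fun z hz => ⟨hx, hz⟩)
  -- Differentiating $f(y,\tau)-f(y,s)=\int_s^\tau R(y,r)\,dr$ in $y$ under the integral sign yields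
  -- this formula. The fundamental theorem of calculus then differentiates it in $\tau$, without any
  -- prior regularity of $g$ in time.
  have key : ∀ τ, s < τ → g x τ = g x s + ∫ r in s..τ, S x r := by
    intro τ hτ
    have hsub : Icc s τ ⊆ Ioi b := fun r hr => hbs.trans_le hr.1
    have h1 : HasDerivAt (fun y => ∫ r in Icc s τ, R y r) (∫ r in Icc s τ, S x r) x :=
      hasDerivAt_setIntegral_of_continuousOn isOpen_Ioi hx isCompact_Icc (by simp)
        (hRc.mono (prod_mono le_rfl hsub)) (hSc.mono (prod_mono le_rfl hsub))
        (fun y hy r hr => hS y hy r (hsub hr))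
    have h2 : HasDerivAt (fun y => f y τ - f y s) (g x τ - g x s) x :=
      (hf x hx τ (hbs.trans hτ)).sub (hf x hx s hbs)
    have h3 : (fun y => f y τ - f y s) =ᶠ[𝓝 x] fun y => ∫ r in Icc s τ, R y r := by
      filter_upwards [Ioi_mem_nhds hx] with y hy
      rw [integral_Icc_eq_integral_Ioc, ← intervalIntegral.integral_of_le hτ.le]
      refine (intervalIntegral.integral_eq_sub_of_hasDerivAt (fun r hr => hR y hy r ?_) ?_).symm
      · rw [uIcc_of_le hτ.le] at hr; exact hsub hr
      · apply ContinuousOn.intervalIntegrable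
        rw [uIcc_of_le hτ.le]; exact (hslice hRc y hy).mono hsub
    have h4 := h2.unique (h1.congr_of_eventuallyEq h3)
    rw [integral_Icc_eq_integral_Ioc, ← intervalIntegral.integral_of_le hτ.le] at h4
    linarith
  have hSx := hslice hSc x hx
  have h5 : HasDerivAt (fun τ => g x s + ∫ r in s..τ, S x r) (S x t) t := by
    refine (intervalIntegral.integral_hasDerivAt_right ?_ ?_ ?_).const_add _
    · apply ContinuousOn.intervalIntegrable
      rw [uIcc_of_le hst.le]
      exact hSx.mono fun r hr => hbs.trans_le hr.1
    · exact hSx.stronglyMeasurableAtFilter isOpen_Ioi t ht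
    · exact hSx.continuousAt (Ioi_mem_nhds ht)
  refine h5.congr_of_eventuallyEq ?_
  filter_upwards [Ioi_mem_nhds hst] with τ hτ using key τ hτ

/-! ### The function $\operatorname{arcosh}u/\sqrt{u^2-1}$ and the continuation of
$\operatorname{arcosh}^2$. -/

/-- `(-1)^k` times the `k`-th derivative of `arcosh u / √(u² - 1)`. -/
def arcoshQuotDeriv (k : ℕ) (u : ℝ) : ℝ :=
  ∫ x in Icc (0 : ℝ) 1, 2 * (k.factorial * (2 * x) ^ k / (x ^ 2 + 2 * x * u + 1) ^ (k + 1))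

lemma one_le_quadratic {x u : ℝ} (hx : 0 ≤ x) (hu : 0 < u) : 1 ≤ x ^ 2 + 2 * x * u + 1 := by
  nlinarith [mul_nonneg hx hu.le, sq_nonneg x]

lemma continuousOn_arcoshQuotDeriv_integrand (k : ℕ) :
    ContinuousOn (fun q : ℝ × ℝ => 2 * ((k.factorial : ℝ) * (2 * q.2) ^ k /
      (q.2 ^ 2 + 2 * q.2 * q.1 + 1) ^ (k + 1))) (Ioi 0 ×ˢ Icc 0 1) := by
  refine continuousOn_const.mul (ContinuousOn.div (by fun_prop) (by fun_prop) ?_)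
  rintro ⟨u, x⟩ ⟨hu, hx⟩
  have := one_le_quadratic hx.1 hu
  exact pow_ne_zero _ (by dsimp only; linarith)

lemma hasDerivAt_arcoshQuotDeriv (k : ℕ) {u : ℝ} (hu : 0 < u) :
    HasDerivAt (arcoshQuotDeriv k) (-arcoshQuotDeriv (k + 1) u) u := by
  have h := hasDerivAt_setIntegral_of_continuousOn (V := Ioi 0) (K := Icc (0 : ℝ) 1)
    (μ := volume) (s₀ := u)
    (f := fun u x => 2 * ((k.factorial : ℝ) * (2 * x) ^ k / (x ^ 2 + 2 * x * u + 1) ^ (k + 1)))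
    (f' := fun u x => -(2 * (((k + 1).factorial : ℝ) * (2 * x) ^ (k + 1) /
      (x ^ 2 + 2 * x * u + 1) ^ (k + 1 + 1)))) isOpen_Ioi hu isCompact_Icc (by simp)
    (continuousOn_arcoshQuotDeriv_integrand k)
    (continuousOn_arcoshQuotDeriv_integrand (k + 1)).neg ?_
  · rw [integral_neg] at h
    exact h
  · intro s hs x hx
    have hD := one_le_quadratic hx.1 hs
    have hD0 : x ^ 2 + 2 * x * s + 1 ≠ 0 := by linarith
    have h1 : HasDerivAt (fun s : ℝ => x ^ 2 + 2 * x * s + 1) (2 * x) s := by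
      simpa using (((hasDerivAt_id s).const_mul (2 * x)).const_add (x ^ 2)).add_const 1
    have h2 := (((h1.pow (k + 1)).inv (pow_ne_zero _ hD0)).const_mul
      ((k.factorial : ℝ) * (2 * x) ^ k)).const_mul 2
    simp only [div_eq_mul_inv]
    refine h2.congr_deriv ?_
    rw [Nat.factorial_succ]
    simp only [Pi.pow_apply, Nat.add_sub_cancel]
    generalize x ^ 2 + 2 * x * s + 1 = D at hD0
    push_cast
    field_simp
    ring

lemma continuousOn_arcoshQuotDeriv (k : ℕ) : ContinuousOn (arcoshQuotDeriv k) (Ioi 0) :=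
  fun _ hu => (hasDerivAt_arcoshQuotDeriv k hu).continuousAt.continuousWithinAt

lemma integrableOn_arcoshQuotDeriv_integrand (k : ℕ) {u : ℝ} (hu : 0 < u) :
    IntegrableOn (fun x : ℝ => 2 * ((k.factorial : ℝ) * (2 * x) ^ k /
      (x ^ 2 + 2 * x * u + 1) ^ (k + 1))) (Icc 0 1) :=
  ContinuousOn.integrableOn_Icc <| (continuousOn_arcoshQuotDeriv_integrand k).comp
    (f := fun x => (u, x)) (by fun_prop) (fun _ hz => ⟨hu, hz⟩)

lemma arcoshQuotDeriv_pos (k : ℕ) {u : ℝ} (hu : 0 < u) : 0 < arcoshQuotDeriv k u := by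
  rw [arcoshQuotDeriv, integral_Icc_eq_integral_Ioc,
    ← intervalIntegral.integral_of_le zero_le_one]
  refine intervalIntegral.intervalIntegral_pos_of_pos_on ?_ ?_ one_pos
  · exact (intervalIntegrable_iff_integrableOn_Icc_of_le zero_le_one).2
      (integrableOn_arcoshQuotDeriv_integrand k hu)
  · intro x hx
    have := one_le_quadratic hx.1.le hu
    have := hx.1
    positivity

lemma arcoshQuotDeriv_le (k : ℕ) {u : ℝ} (hu : 0 < u) :
    arcoshQuotDeriv k u ≤ 2 * (k.factorial * 2 ^ k) := by
  have h : arcoshQuotDeriv k u ≤ ∫ x in Icc (0 : ℝ) 1, 2 * ((k.factorial : ℝ) * 2 ^ k) := by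
    refine setIntegral_mono_on (integrableOn_arcoshQuotDeriv_integrand k hu)
      (integrableOn_const (by simp)) measurableSet_Icc fun x hx => ?_
    have hD := one_le_quadratic hx.1 hu
    refine mul_le_mul_of_nonneg_left ((div_le_self (by have := hx.1; positivity)
      (one_le_pow₀ hD)).trans ?_) zero_le_two
    have := hx.1
    gcongr
    linarith [hx.2]
  simpa using h

/-- The first-order differential equation of `arcosh u / √(u² - 1)`. -/
lemma arcoshQuotDeriv_ode {u : ℝ} (hu : 0 < u) :
    u * arcoshQuotDeriv 0 u - (u ^ 2 - 1) * arcoshQuotDeriv 1 u = 1 := by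
  have hi := fun k => integrableOn_arcoshQuotDeriv_integrand k hu
  have h0 : u * arcoshQuotDeriv 0 u - (u ^ 2 - 1) * arcoshQuotDeriv 1 u =
      ∫ x in (0 : ℝ)..1, (u * (2 * (((0 : ℕ).factorial : ℝ) * (2 * x) ^ 0 /
      (x ^ 2 + 2 * x * u + 1) ^ (0 + 1))) - (u ^ 2 - 1) * (2 * (((1 : ℕ).factorial : ℝ) *
        (2 * x) ^ 1 / (x ^ 2 + 2 * x * u + 1) ^ (1 + 1)))) := by
    rw [intervalIntegral.integral_of_le zero_le_one, ← integral_Icc_eq_integral_Ioc,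
      integral_sub ((hi 0).const_mul _) ((hi 1).const_mul _)]
    exact congrArg₂ _ (integral_const_mul _ _).symm (integral_const_mul _ _).symm
  -- The combined integrand is an exact $x$-derivative; its primitive is $0$ at $x=1$ and $-1$ at
  -- $x=0$.
  rw [h0, intervalIntegral.integral_eq_sub_of_hasDerivAt
    (f := fun x => (x ^ 2 - 1) / (x ^ 2 + 2 * x * u + 1))]
  · norm_num
  · intro x hx
    rw [uIcc_of_le zero_le_one] at hx
    have hD := one_le_quadratic hx.1 hu
    have hD0 : x ^ 2 + 2 * x * u + 1 ≠ 0 := by linarith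
    have h1 : HasDerivAt (fun x : ℝ => x ^ 2 - 1) (2 * x) x := by
      simpa using (hasDerivAt_pow 2 x).sub_const 1
    have h2 : HasDerivAt (fun x : ℝ => x ^ 2 + 2 * x * u + 1) (2 * x + 2 * u) x := by
      have := (((hasDerivAt_pow 2 x).add (((hasDerivAt_id x).const_mul 2).mul_const u)).add_const
        (1 : ℝ))
      simpa using this
    refine (h1.div h2 hD0).congr_deriv ?_
    simp only [Nat.factorial]
    push_cast
    field_simp
    ring
  · refine (intervalIntegrable_iff_integrableOn_Icc_of_le zero_le_one).2 ?_
    exact ((hi 0).const_mul _).sub ((hi 1).const_mul _)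

/-- The analytic continuation of `arcosh²` to `(0, ∞)`. -/
def arcoshSq (u : ℝ) : ℝ := (u ^ 2 - 1) * arcoshQuotDeriv 0 u ^ 2

/-- The product rule gives $2A\,(uA+(u^2-1)A')$, and the first-order equation says that the bracket
is $1$. -/
lemma hasDerivAt_arcoshSq {u : ℝ} (hu : 0 < u) :
    HasDerivAt arcoshSq (2 * arcoshQuotDeriv 0 u) u := by
  have h1 : HasDerivAt (fun x : ℝ => x ^ 2 - 1) (2 * u) u := by
    simpa using (hasDerivAt_pow 2 u).sub_const 1
  refine (h1.mul ((hasDerivAt_arcoshQuotDeriv 0 hu).pow 2)).congr_deriv ?_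
  have := arcoshQuotDeriv_ode hu
  simp only [zero_add, Pi.pow_apply]
  linear_combination 2 * arcoshQuotDeriv 0 u * this

/-- Identifies the integral with $\rho/\sinh\rho$ without evaluating it: the difference of the two
sides vanishes at $0$ and has zero derivative by the first-order equation. -/
lemma arcoshQuotDeriv_cosh_mul_sinh (ρ : ℝ) :
    arcoshQuotDeriv 0 (Real.cosh ρ) * Real.sinh ρ = ρ := by
  have hd : ∀ r : ℝ, HasDerivAt
      (fun r => arcoshQuotDeriv 0 (Real.cosh r) * Real.sinh r - r) 0 r := by
    intro r
    have h1 := ((hasDerivAt_arcoshQuotDeriv 0 (Real.cosh_pos r)).comp r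
      (Real.hasDerivAt_cosh r)).mul (Real.hasDerivAt_sinh r)
    refine (h1.sub (hasDerivAt_id r)).congr_deriv ?_
    have := arcoshQuotDeriv_ode (Real.cosh_pos r)
    have h2 := Real.cosh_sq r
    simp only [zero_add, Function.comp]
    linear_combination this + arcoshQuotDeriv 1 (Real.cosh r) * h2
  have := is_const_of_deriv_eq_zero (fun r => (hd r).differentiableAt) (fun r => (hd r).deriv) ρ 0
  simp at this
  linarith

lemma arcoshSq_cosh (ρ : ℝ) : arcoshSq (Real.cosh ρ) = ρ ^ 2 := by
  have h := arcoshQuotDeriv_cosh_mul_sinh ρ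
  rw [arcoshSq]
  have h2 := Real.cosh_sq ρ
  linear_combination arcoshQuotDeriv 0 (Real.cosh ρ) ^ 2 * h2 +
    (arcoshQuotDeriv 0 (Real.cosh ρ) * Real.sinh ρ + ρ) * h

/-- From $\cosh r\le e^r$ for $r\ge0$. It makes $e^{-\operatorname{arcosh}^2/4t}$ decay faster than
any power of $u$. -/
lemma log_sq_le_arcoshSq {u : ℝ} (hu : 1 ≤ u) : Real.log u ^ 2 ≤ arcoshSq u := by
  have h1 := Real.cosh_arcosh hu
  have h0 := Real.arcosh_nonneg hu
  rw [← h1, arcoshSq_cosh]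
  have : Real.log (Real.cosh (Real.arcosh u)) ≤ Real.arcosh u := by
    rw [Real.log_le_iff_le_exp (Real.cosh_pos _), Real.cosh_eq]
    have : Real.exp (-Real.arcosh u) ≤ Real.exp (Real.arcosh u) := Real.exp_le_exp.2 (by linarith)
    linarith
  refine pow_le_pow_left₀ (Real.log_nonneg ?_) this 2
  rw [h1]; exact hu

/-- For $u<1$ the continuation is negative, but $|u^2-1|\le1$ and $0<A\le2$ there. -/
lemma neg_four_le_arcoshSq {u : ℝ} (hu : 0 < u) : -4 ≤ arcoshSq u := by
  rcases le_or_gt 1 u with h | h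
  · linarith [log_sq_le_arcoshSq h, sq_nonneg (Real.log u)]
  · have h1 := arcoshQuotDeriv_le 0 hu
    have h2 := arcoshQuotDeriv_pos 0 hu
    norm_num at h1
    rw [arcoshSq]
    nlinarith [mul_pos hu hu, mul_pos h2 h2]

/-! ### Integer-order profiles: positivity, heat equation, decay. -/

/-- The functions `(-∂ᵤ)^m [(4πt)^{-1/2} exp(-arcosh(u)²/4t)]`. -/
def oddProfile : ℕ → ℝ → ℝ → ℝ
  | 0, u, t => (√(4 * Real.pi * t))⁻¹ * Real.exp (-arcoshSq u / (4 * t))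
  | m + 1, u, t => (2 * t)⁻¹ * ∑ i : Fin (m + 1), (m.choose i) *
      (arcoshQuotDeriv i u * oddProfile (m - i) u t)

lemma oddProfile_zero (u t : ℝ) : oddProfile 0 u t =
    (√(4 * Real.pi * t))⁻¹ * Real.exp (-arcoshSq u / (4 * t)) := by
  rw [oddProfile]

lemma oddProfile_succ (m : ℕ) (u t : ℝ) : oddProfile (m + 1) u t =
    (2 * t)⁻¹ * ∑ ij ∈ Finset.HasAntidiagonal.antidiagonal m, (m.choose ij.1) *
      (arcoshQuotDeriv ij.1 u * oddProfile ij.2 u t) := by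
  rw [oddProfile, Finset.Nat.sum_antidiagonal_eq_sum_range_succ
    (fun i j => (m.choose i : ℝ) * (arcoshQuotDeriv i u * oddProfile j u t)), Finset.sum_range]

lemma oddProfile_one (u t : ℝ) :
    oddProfile 1 u t = (2 * t)⁻¹ * (arcoshQuotDeriv 0 u * oddProfile 0 u t) := by
  simp [oddProfile_succ]

lemma oddProfile_two (u t : ℝ) :
    oddProfile 2 u t = (2 * t)⁻¹ * (arcoshQuotDeriv 0 u * oddProfile 1 u t +
      arcoshQuotDeriv 1 u * oddProfile 0 u t) := by
  simp [oddProfile_succ 1, Finset.Nat.antidiagonal_succ]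

/-- Every term of the Leibniz recursion is positive. The monotonicity of the heat kernel ultimately
rests on this. -/
lemma oddProfile_pos (m : ℕ) {u t : ℝ} (hu : 0 < u) (ht : 0 < t) : 0 < oddProfile m u t := by
  induction m using Nat.strong_induction_on with
  | _ m ih =>
    cases m with
    | zero =>
      rw [oddProfile_zero]
      have := Real.pi_pos
      positivity
    | succ m =>
      rw [oddProfile_succ]
      refine mul_pos (by positivity) (Finset.sum_pos (fun ij hij => ?_) ⟨(0, m), by simp⟩)
      rw [Finset.HasAntidiagonal.mem_antidiagonal] at hij
      exact mul_pos (by exact_mod_cast Nat.choose_pos (by omega))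
        (mul_pos (arcoshQuotDeriv_pos _ hu) (ih _ (by omega)))

lemma hasDerivAt_oddProfile (m : ℕ) {u t : ℝ} (hu : 0 < u) (ht : 0 < t) :
    HasDerivAt (fun u => oddProfile m u t) (-oddProfile (m + 1) u t) u := by
  induction m using Nat.strong_induction_on with
  | _ m ih =>
    cases m with
    | zero =>
      simp only [oddProfile_zero, oddProfile_one, zero_add]
      refine ((((hasDerivAt_arcoshSq hu).neg.div_const (4 * t)).exp).const_mul _).congr_deriv ?_
      simp only [Pi.neg_apply]
      field_simp
      ring
    | succ m =>
      have h1 : HasDerivAt (fun u => oddProfile (m + 1) u t) ((2 * t)⁻¹ *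
          ∑ ij ∈ Finset.HasAntidiagonal.antidiagonal m, (m.choose ij.1) *
          (-arcoshQuotDeriv (ij.1 + 1) u * oddProfile ij.2 u t +
            arcoshQuotDeriv ij.1 u * -oddProfile (ij.2 + 1) u t)) u := by
        simp only [oddProfile_succ m]
        refine HasDerivAt.const_mul _ (HasDerivAt.fun_sum fun ij hij => HasDerivAt.const_mul _ ?_)
        rw [Finset.HasAntidiagonal.mem_antidiagonal] at hij
        exact (hasDerivAt_arcoshQuotDeriv _ hu).mul (ih _ (by omega))
      refine h1.congr_deriv ?_
      -- Pascal's rule splits the sum of order `m + 1` into the two halves produced by the product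
      -- rule; symmetry of the binomial coefficients then matches the weights.
      rw [oddProfile_succ (m + 1), Finset.sum_antidiagonal_choose_succ_mul
        (fun i j => arcoshQuotDeriv i u * oddProfile j u t), ← mul_neg]
      have h2 : ∑ ij ∈ Finset.HasAntidiagonal.antidiagonal m, (m.choose ij.2 : ℝ) *
          (arcoshQuotDeriv (ij.1 + 1) u * oddProfile ij.2 u t) =
          ∑ ij ∈ Finset.HasAntidiagonal.antidiagonal m, (m.choose ij.1 : ℝ) *
          (arcoshQuotDeriv (ij.1 + 1) u * oddProfile ij.2 u t) := by
        refine Finset.sum_congr rfl fun ij hij => ?_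
        rw [Nat.choose_symm_of_eq_add (Finset.HasAntidiagonal.mem_antidiagonal.1 hij).symm]
      rw [h2, ← Finset.sum_add_distrib, ← Finset.sum_neg_distrib]
      congr 1
      refine Finset.sum_congr rfl fun ij _ => ?_
      ring

lemma continuousOn_oddProfile (m : ℕ) :
    ContinuousOn (fun q : ℝ × ℝ => oddProfile m q.1 q.2) (Ioi 0 ×ˢ Ioi 0) := by
  have hG : ∀ {g : ℝ → ℝ}, ContinuousOn g (Ioi 0) →
      ContinuousOn (fun q : ℝ × ℝ => g q.1) (Ioi 0 ×ˢ Ioi 0) := fun hg =>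
    hg.comp continuousOn_fst fun q hq => hq.1
  induction m using Nat.strong_induction_on with
  | _ m ih =>
    cases m with
    | zero =>
      simp only [oddProfile_zero]
      refine ContinuousOn.mul (ContinuousOn.inv₀ (by fun_prop) fun q hq => ?_)
        (ContinuousOn.rexp (ContinuousOn.div (hG fun u hu =>
          (hasDerivAt_arcoshSq hu).continuousAt.continuousWithinAt).neg (by fun_prop) fun q hq => ?_))
      · have := Real.pi_pos
        have : 0 < q.2 := hq.2
        positivity
      · have : 0 < q.2 := hq.2
        positivity
    | succ m =>
      simp only [oddProfile_succ m]
      refine ContinuousOn.mul (ContinuousOn.inv₀ (by fun_prop) fun q hq => ?_)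
        (continuousOn_finsetSum _ fun ij hij => continuousOn_const.mul
          ((hG (continuousOn_arcoshQuotDeriv _)).mul (ih _ ?_)))
      · have : 0 < q.2 := hq.2
        positivity
      · rw [Finset.HasAntidiagonal.mem_antidiagonal] at hij
        omega

/-- This is the heat equation of the Gaussian on the line, since
$\partial_\rho^2=(u^2-1)\partial_u^2+u\partial_u$. The first-order equation of $A$ proves it for
$u<1$ as well. -/
lemma hasDerivAt_oddProfile_zero_time {u t : ℝ} (hu : 0 < u) (ht : 0 < t) :
    HasDerivAt (fun t => oddProfile 0 u t)
      ((u ^ 2 - 1) * oddProfile 2 u t - u * oddProfile 1 u t) t := by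
  have h0 : 0 < 4 * Real.pi * t := by have := Real.pi_pos; positivity
  have h1 : HasDerivAt (fun t : ℝ => 4 * Real.pi * t) (4 * Real.pi) t := by
    simpa using (hasDerivAt_id t).const_mul (4 * Real.pi)
  have h2 := (h1.sqrt h0.ne').inv (Real.sqrt_pos.2 h0).ne'
  have h3 : HasDerivAt (fun t : ℝ => -arcoshSq u / (4 * t)) (arcoshSq u / (4 * t ^ 2)) t := by
    have h4 : HasDerivAt (fun t : ℝ => 4 * t) 4 t := by
      simpa using (hasDerivAt_id t).const_mul 4
    refine ((hasDerivAt_const t (-arcoshSq u)).div h4 (by positivity)).congr_deriv ?_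
    field_simp
    simp
  have h5 := h2.mul h3.exp
  have h6 : HasDerivAt (fun t => oddProfile 0 u t)
      (oddProfile 0 u t * (-(2 * t)⁻¹ + arcoshSq u / (4 * t ^ 2))) t := by
    simp only [oddProfile_zero]
    refine h5.congr_deriv ?_
    have hs := Real.sq_sqrt h0.le
    have hs0 := (Real.sqrt_pos.2 h0).ne'
    simp only [Pi.inv_apply]
    rw [hs]
    field_simp
  refine h6.congr_deriv ?_
  rw [oddProfile_two, oddProfile_one]
  have := arcoshQuotDeriv_ode hu
  rw [arcoshSq]
  have ht' := ht.ne'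
  field_simp
  linear_combination 8 * t * oddProfile 0 u t * this

/-- Induction by differentiating the equation in $u$: commuting $\partial_u$ past the operator turns
$2m+1$ into $2m+3$ and $m^2$ into $(m+1)^2$. The mixed partials are exchanged by
`hasDerivAt_partial_comm`. -/
lemma oddProfile_heat_eq (m : ℕ) {u t : ℝ} (hu : 0 < u) (ht : 0 < t) :
    HasDerivAt (fun t => oddProfile m u t) ((u ^ 2 - 1) * oddProfile (m + 2) u t -
      (2 * m + 1) * u * oddProfile (m + 1) u t + m ^ 2 * oddProfile m u t) t := by
  have hc : ∀ m : ℕ, ContinuousOn (fun q : ℝ × ℝ => (q.1 ^ 2 - 1) * oddProfile (m + 2) q.1 q.2 -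
      (2 * m + 1) * q.1 * oddProfile (m + 1) q.1 q.2 + m ^ 2 * oddProfile m q.1 q.2)
      (Ioi 0 ×ˢ Ioi 0) := fun m =>
    (((by fun_prop : ContinuousOn (fun q : ℝ × ℝ => q.1 ^ 2 - 1) _).mul
      (continuousOn_oddProfile (m + 2))).sub
      ((by fun_prop : ContinuousOn (fun q : ℝ × ℝ => (2 * m + 1) * q.1) _).mul
      (continuousOn_oddProfile (m + 1)))).add
      ((continuousOn_oddProfile m).const_smul ((m : ℝ) ^ 2))
  induction m generalizing u t with
  | zero => simpa using hasDerivAt_oddProfile_zero_time hu ht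
  | succ m ih =>
    have hS : ∀ u, 0 < u → ∀ t, 0 < t → HasDerivAt (fun u => (u ^ 2 - 1) * oddProfile (m + 2) u t -
        (2 * m + 1) * u * oddProfile (m + 1) u t + m ^ 2 * oddProfile m u t)
        (-((u ^ 2 - 1) * oddProfile (m + 1 + 2) u t -
          (2 * (m + 1 : ℕ) + 1) * u * oddProfile (m + 1 + 1) u t +
            (m + 1 : ℕ) ^ 2 * oddProfile (m + 1) u t)) u := by
      intro u hu t ht
      have h1 : HasDerivAt (fun x : ℝ => x ^ 2 - 1) (2 * u) u := by
        simpa using (hasDerivAt_pow 2 u).sub_const 1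
      have h2 : HasDerivAt (fun x : ℝ => (2 * m + 1) * x) (2 * m + 1 : ℝ) u := by
        simpa using (hasDerivAt_id u).const_mul (2 * m + 1 : ℝ)
      have h := ((h1.mul (hasDerivAt_oddProfile (m + 2) hu ht)).sub
        (h2.mul (hasDerivAt_oddProfile (m + 1) hu ht))).add
        ((hasDerivAt_oddProfile m hu ht).const_mul ((m : ℝ) ^ 2))
      refine h.congr_deriv ?_
      push_cast
      ring
    have h := hasDerivAt_partial_comm (f := oddProfile m) (g := fun u t => -oddProfile (m + 1) u t)
      (fun u hu t ht => hasDerivAt_oddProfile m hu ht) (fun u hu t ht => ih hu ht) hS (hc m)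
      (hc (m + 1)).neg hu ht
    have h' := h.neg
    rw [neg_neg] at h'
    exact h'.congr_of_eventuallyEq (Eventually.of_forall fun t => by simp)

lemma oddProfile_zero_le (N : ℕ) {t₁ t₂ u t : ℝ} (h₁ : 0 < t₁) (ht₁ : t₁ ≤ t) (ht₂ : t ≤ t₂)
    (hu : 0 < u) : oddProfile 0 u t ≤ (√(4 * Real.pi * t₁))⁻¹ *
      ((Real.exp (t₂ * N ^ 2) + Real.exp (t₁⁻¹)) * 2 ^ N) / (1 + u) ^ N := by
  have hpi := Real.pi_pos
  have ht : 0 < t := h₁.trans_le ht₁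
  rw [oddProfile_zero, mul_div_assoc]
  refine mul_le_mul (inv_anti₀ (by positivity) (Real.sqrt_le_sqrt (by gcongr))) ?_
    (by positivity) (by positivity)
  rw [le_div_iff₀ (by positivity)]
  rcases le_or_gt 1 u with h | h
  · have h2 := log_sq_le_arcoshSq h
    have h3 : Real.exp (-arcoshSq u / (4 * t)) ≤
        Real.exp (t₂ * N ^ 2) * Real.exp (-(N * Real.log u)) := by
      rw [← Real.exp_add]
      refine Real.exp_le_exp.2 ?_
      rw [div_le_iff₀ (by positivity)]
      -- Completing the square: $-(\log u)^2/4t\le tN^2-N\log u$.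
      nlinarith [sq_nonneg (Real.log u - 2 * t * N),
        mul_nonneg (mul_nonneg (sub_nonneg.2 ht₂) (sq_nonneg (N : ℝ))) ht.le]
    have h4 : Real.exp (-(N * Real.log u)) * u ^ N = 1 := by
      rw [Real.exp_neg, Real.exp_nat_mul, Real.exp_log hu]
      field_simp
    calc Real.exp (-arcoshSq u / (4 * t)) * (1 + u) ^ N
        ≤ Real.exp (t₂ * N ^ 2) * Real.exp (-(N * Real.log u)) * (2 * u) ^ N := by
          gcongr
          linarith
      _ = Real.exp (t₂ * N ^ 2) * 2 ^ N := by
          rw [mul_pow]; linear_combination Real.exp (t₂ * N ^ 2) * 2 ^ N * h4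
      _ ≤ _ := by gcongr; linarith [Real.exp_pos t₁⁻¹]
  · have h2 := neg_four_le_arcoshSq hu
    have h3 : Real.exp (-arcoshSq u / (4 * t)) ≤ Real.exp (t₁⁻¹) := by
      refine Real.exp_le_exp.2 ?_
      rw [div_le_iff₀ (by positivity)]
      have : 1 ≤ t₁⁻¹ * t := by rw [inv_mul_eq_div, one_le_div h₁]; exact ht₁
      nlinarith
    refine mul_le_mul (h3.trans ?_) (pow_le_pow_left₀ (by positivity) (by linarith) N)
      (by positivity) (by positivity)
    linarith [Real.exp_pos (t₂ * N ^ 2)]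

/-- The derivatives of $A$ are bounded, so the recursion controls every order by order zero; decay
then needs proof only there. -/
lemma oddProfile_le_zero (m : ℕ) {t₁ : ℝ} (h₁ : 0 < t₁) :
    ∃ C : ℝ, 0 ≤ C ∧ ∀ u t, 0 < u → t₁ ≤ t → oddProfile m u t ≤ C * oddProfile 0 u t := by
  induction m using Nat.strong_induction_on with
  | _ m ih =>
    cases m with
    | zero => exact ⟨1, zero_le_one, fun u t _ _ => by simp⟩
    | succ m =>
      choose! C hC0 hC using ih
      refine ⟨(2 * t₁)⁻¹ * ∑ ij ∈ Finset.HasAntidiagonal.antidiagonal m, (m.choose ij.1 : ℝ) *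
        (2 * (ij.1.factorial * 2 ^ ij.1) * C ij.2), ?_, fun u t hu ht => ?_⟩
      · refine mul_nonneg (by positivity) (Finset.sum_nonneg fun ij hij => ?_)
        have := hC0 ij.2 (by rw [Finset.HasAntidiagonal.mem_antidiagonal] at hij; omega)
        positivity
      · have ht0 : 0 < t := h₁.trans_le ht
        rw [oddProfile_succ, mul_assoc, Finset.sum_mul]
        refine mul_le_mul (by gcongr) (Finset.sum_le_sum fun ij hij => ?_)
          (Finset.sum_nonneg fun ij hij => ?_) (by positivity)
        · rw [mul_assoc, mul_assoc]
          refine mul_le_mul_of_nonneg_left (mul_le_mul (arcoshQuotDeriv_le _ hu)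
            (hC _ ?_ _ _ hu ht) (oddProfile_pos _ hu ht0).le (by positivity)) (by positivity)
          rw [Finset.HasAntidiagonal.mem_antidiagonal] at hij; omega
        · have := oddProfile_pos ij.2 hu ht0
          have := arcoshQuotDeriv_pos ij.1 hu
          positivity

lemma oddProfile_decay (m N : ℕ) {t₁ t₂ : ℝ} (h₁ : 0 < t₁) :
    ∃ C : ℝ, 0 ≤ C ∧ ∀ u t, 0 < u → t₁ ≤ t → t ≤ t₂ → oddProfile m u t ≤ C / (1 + u) ^ N := by
  obtain ⟨C, hC0, hC⟩ := oddProfile_le_zero m h₁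
  refine ⟨C * ((√(4 * Real.pi * t₁))⁻¹ *
      ((Real.exp (t₂ * N ^ 2) + Real.exp (t₁⁻¹)) * 2 ^ N)), ?_, fun u t hu ht₁ ht₂ => ?_⟩
  · have := Real.pi_pos
    positivity
  · rw [mul_div_assoc]
    exact (hC u t hu ht₁).trans (mul_le_mul_of_nonneg_left (oddProfile_zero_le N h₁ ht₁ ht₂ hu) hC0)

/-! ### Profiles of all dimensions: half-integer orders and their heat equation. -/

/-- The radial profile of the heat kernel in dimension `j + 1`, up to a factor depending on `t`:
the `j/2`-th (fractional) derivative `(-∂ᵤ)^(j/2) [(4πt)^{-1/2} exp(-arcosh(u)²/4t)]`. -/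
def profile (j : ℕ) (u t : ℝ) : ℝ :=
  if Even j then oddProfile (j / 2) u t
  else (√(2 * Real.pi))⁻¹ * ∫ w : ℝ, oddProfile ((j + 1) / 2) (u + w ^ 2 / 2) t

lemma profile_even (m : ℕ) (u t : ℝ) : profile (2 * m) u t = oddProfile m u t := by
  simp [profile]

lemma profile_odd (m : ℕ) (u t : ℝ) : profile (2 * m + 1) u t =
    (√(2 * Real.pi))⁻¹ * ∫ w : ℝ, oddProfile (m + 1) (u + w ^ 2 / 2) t := by
  have h : ¬ Even (2 * m + 1) := by simp
  rw [profile, if_neg h, show (2 * m + 1 + 1) / 2 = m + 1 by omega]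

lemma continuous_oddProfile_comp {X : Type*} [TopologicalSpace X] (m : ℕ) {f : X → ℝ}
    (hf : Continuous f) (hf0 : ∀ x, 0 < f x) {t : ℝ} (ht : 0 < t) :
    Continuous fun x => oddProfile m (f x) t :=
  (continuousOn_oddProfile m).comp_continuous (f := fun x => (f x, t)) (by fun_prop)
    fun x => ⟨hf0 x, ht⟩

lemma add_half_sq_pos {u : ℝ} (hu : 0 < u) (w : ℝ) : 0 < u + w ^ 2 / 2 := by positivity

lemma inv_one_add_le {u : ℝ} (hu : 0 < u) (w : ℝ) :
    (1 + (u + w ^ 2 / 2))⁻¹ ≤ 2 * (1 + w ^ 2)⁻¹ := by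
  rw [← div_eq_mul_inv, ← one_div, div_le_div_iff₀ (by positivity) (by positivity)]
  nlinarith

lemma oddProfile_shift_decay (m N : ℕ) {t₁ t₂ : ℝ} (h₁ : 0 < t₁) :
    ∃ C : ℝ, 0 ≤ C ∧ ∀ u t w, 0 < u → t₁ ≤ t → t ≤ t₂ →
      oddProfile m (u + w ^ 2 / 2) t ≤ C * ((1 + w ^ 2)⁻¹) ^ N := by
  obtain ⟨C, hC0, hC⟩ := oddProfile_decay m N h₁ (t₂ := t₂)
  refine ⟨C * 2 ^ N, by positivity, fun u t w hu ht₁ ht₂ => ?_⟩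
  refine (hC _ t (add_half_sq_pos hu w) ht₁ ht₂).trans ?_
  rw [div_eq_mul_inv, mul_assoc, ← mul_pow, ← inv_pow]
  have := inv_one_add_le hu w
  gcongr

/-- The powers of $w$ arise as boundary and remainder terms when the heat equation is integrated by
parts in $w$. -/
lemma integrable_pow_mul_oddProfile (k m : ℕ) {u t : ℝ} (hu : 0 < u) (ht : 0 < t) :
    Integrable fun w : ℝ => w ^ k * oddProfile m (u + w ^ 2 / 2) t := by
  obtain ⟨C, hC0, hC⟩ := oddProfile_shift_decay m (k + 1) ht (t₂ := t)
  refine Integrable.mono' (integrable_inv_one_add_sq.const_mul C)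
    (Continuous.aestronglyMeasurable (by
      have := continuous_oddProfile_comp m (f := fun w : ℝ => u + w ^ 2 / 2) (by fun_prop)
        (add_half_sq_pos hu) ht
      fun_prop)) (ae_of_all _ fun w => ?_)
  have h1 : |w| ≤ 1 + w ^ 2 := by
    rw [abs_le]; constructor <;> nlinarith [sq_nonneg (w + 1), sq_nonneg (w - 1)]
  have h2 := oddProfile_pos m (add_half_sq_pos hu w) ht
  rw [norm_mul, norm_pow, Real.norm_eq_abs, Real.norm_eq_abs, abs_of_pos h2]
  calc |w| ^ k * oddProfile m (u + w ^ 2 / 2) t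
      ≤ (1 + w ^ 2) ^ k * (C * ((1 + w ^ 2)⁻¹) ^ (k + 1)) := by
        gcongr
        exact hC u t w hu le_rfl le_rfl
    _ = C * (1 + w ^ 2)⁻¹ := by
        have : (1 + w ^ 2) * (1 + w ^ 2)⁻¹ = 1 := mul_inv_cancel₀ (by positivity)
        rw [pow_succ ((1 + w ^ 2)⁻¹)]
        calc _ = C * ((1 + w ^ 2) * (1 + w ^ 2)⁻¹) ^ k * (1 + w ^ 2)⁻¹ := by rw [mul_pow]; ring
          _ = _ := by rw [this]; simp

lemma integrable_oddProfile (m : ℕ) {u t : ℝ} (hu : 0 < u) (ht : 0 < t) :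
    Integrable fun w : ℝ => oddProfile m (u + w ^ 2 / 2) t := by
  simpa using integrable_pow_mul_oddProfile 0 m hu ht

lemma profile_pos (j : ℕ) {u t : ℝ} (hu : 0 < u) (ht : 0 < t) : 0 < profile j u t := by
  rcases Nat.even_or_odd' j with ⟨m, rfl | rfl⟩
  · rw [profile_even]; exact oddProfile_pos m hu ht
  · rw [profile_odd]
    have hp : ∀ w : ℝ, 0 < oddProfile (m + 1) (u + w ^ 2 / 2) t := fun w =>
      oddProfile_pos _ (add_half_sq_pos hu w) ht
    refine mul_pos (inv_pos.2 (Real.sqrt_pos.2 (by positivity))) ?_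
    rw [integral_pos_iff_support_of_nonneg (fun w => (hp w).le) (integrable_oddProfile _ hu ht)]
    have : Function.support (fun w : ℝ => oddProfile (m + 1) (u + w ^ 2 / 2) t) = univ :=
      eq_univ_of_forall fun w => (hp w).ne'
    rw [this]
    simp

lemma hasDerivAt_profile (j : ℕ) {u t : ℝ} (hu : 0 < u) (ht : 0 < t) :
    HasDerivAt (fun u => profile j u t) (-profile (j + 2) u t) u := by
  rcases Nat.even_or_odd' j with ⟨m, rfl | rfl⟩
  · rw [show 2 * m + 2 = 2 * (m + 1) by ring, profile_even]
    simp only [profile_even]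
    exact hasDerivAt_oddProfile m hu ht
  · rw [show 2 * m + 1 + 2 = 2 * (m + 1) + 1 by ring, profile_odd, ← mul_neg, ← integral_neg]
    simp only [profile_odd]
    obtain ⟨C, hC0, hC⟩ := oddProfile_shift_decay (m + 1 + 1) 1 ht (t₂ := t)
    refine HasDerivAt.const_mul _ (hasDerivAt_integral_of_dominated_loc_of_deriv_le
      (F := fun u w => oddProfile (m + 1) (u + w ^ 2 / 2) t)
      (F' := fun u w => -oddProfile (m + 1 + 1) (u + w ^ 2 / 2) t)
      (bound := fun w => C * ((1 + w ^ 2)⁻¹) ^ 1)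
      (Ioi_mem_nhds hu) ?_ (integrable_oddProfile _ hu ht) ?_ ?_ ?_ ?_).2
    · filter_upwards [Ioi_mem_nhds hu] with v hv
        using (integrable_oddProfile (m + 1) hv ht).aestronglyMeasurable
    · exact (integrable_oddProfile (m + 1 + 1) hu ht).aestronglyMeasurable.neg
    · refine ae_of_all _ fun w v hv => ?_
      rw [norm_neg, Real.norm_eq_abs, abs_of_pos (oddProfile_pos _ (add_half_sq_pos hv w) ht)]
      exact hC v t w hv le_rfl le_rfl
    · simp only [pow_one]
      exact integrable_inv_one_add_sq.const_mul C
    · refine ae_of_all _ fun w v hv => ?_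
      exact HasDerivAt.comp_add_const v (w ^ 2 / 2)
        (hasDerivAt_oddProfile (m + 1) (add_half_sq_pos hv w) ht)

lemma continuousOn_profile (j : ℕ) :
    ContinuousOn (fun q : ℝ × ℝ => profile j q.1 q.2) (Ioi 0 ×ˢ Ioi 0) := by
  rcases Nat.even_or_odd' j with ⟨m, rfl | rfl⟩
  · simp only [profile_even]
    exact continuousOn_oddProfile m
  · simp only [profile_odd]
    refine continuousOn_const.mul fun q hq => ContinuousAt.continuousWithinAt ?_
    have hq2 : 0 < q.2 := hq.2
    obtain ⟨C, hC0, hC⟩ := oddProfile_shift_decay (m + 1) 1 (half_pos hq2) (t₂ := 2 * q.2)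
    have hmem : ∀ᶠ p : ℝ × ℝ in 𝓝 q, 0 < p.1 ∧ q.2 / 2 < p.2 ∧ p.2 < 2 * q.2 :=
      (continuous_fst.continuousAt.eventually (Ioi_mem_nhds hq.1)).and
        (continuous_snd.continuousAt.eventually
          (Ioo_mem_nhds (by linarith) (by linarith)))
    refine continuousAt_of_dominated (bound := fun w => C * ((1 + w ^ 2)⁻¹) ^ 1) ?_ ?_ ?_ ?_
    · filter_upwards [hmem] with p hp
      exact (integrable_oddProfile (m + 1) hp.1
        ((half_pos hq2).trans hp.2.1)).aestronglyMeasurable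
    · filter_upwards [hmem] with p hp
      refine ae_of_all _ fun w => ?_
      rw [Real.norm_eq_abs, abs_of_pos (oddProfile_pos _ (add_half_sq_pos hp.1 w)
        ((half_pos hq2).trans hp.2.1))]
      exact hC p.1 p.2 w hp.1 hp.2.1.le hp.2.2.le
    · simp only [pow_one]
      exact integrable_inv_one_add_sq.const_mul C
    · refine ae_of_all _ fun w => ?_
      have h1 : ContinuousAt (fun q : ℝ × ℝ => oddProfile (m + 1) q.1 q.2)
          (q.1 + w ^ 2 / 2, q.2) := (continuousOn_oddProfile (m + 1)).continuousAt
        (prod_mem_nhds (Ioi_mem_nhds (add_half_sq_pos hq.1 w)) (Ioi_mem_nhds hq.2))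
      exact ContinuousAt.comp (f := fun p : ℝ × ℝ => (p.1 + w ^ 2 / 2, p.2)) h1 (by fun_prop)

lemma profile_decay (j : ℕ) {t₁ t₂ : ℝ} (h₁ : 0 < t₁) :
    ∃ C : ℝ, 0 ≤ C ∧ ∀ u t, 0 < u → t₁ ≤ t → t ≤ t₂ → profile j u t ≤ C / (1 + u) := by
  rcases Nat.even_or_odd' j with ⟨m, rfl | rfl⟩
  · simp only [profile_even]
    simpa using oddProfile_decay m 1 h₁ (t₂ := t₂)
  · simp only [profile_odd]
    -- Of the two powers of decay, one pays for integrability in $w$ and the other is kept for $u$.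
    obtain ⟨C, hC0, hC⟩ := oddProfile_decay (m + 1) 2 h₁ (t₂ := t₂)
    refine ⟨(√(2 * Real.pi))⁻¹ * ∫ w : ℝ, C * (2 * (1 + w ^ 2)⁻¹), ?_, fun u t hu ht₁ ht₂ => ?_⟩
    · exact mul_nonneg (by positivity) (integral_nonneg fun w => by positivity)
    · rw [mul_div_assoc, ← integral_div]
      refine mul_le_mul_of_nonneg_left (integral_mono
        (integrable_oddProfile _ hu (h₁.trans_le ht₁))
        (((integrable_inv_one_add_sq.const_mul 2).const_mul C).div_const _) fun w => ?_)
        (by positivity)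
      refine (hC _ t (add_half_sq_pos hu w) ht₁ ht₂).trans ?_
      have h2 := inv_one_add_le hu w
      have h3 : (1 + (u + w ^ 2 / 2))⁻¹ ≤ (1 + u)⁻¹ := by
        gcongr
        nlinarith [sq_nonneg w]
      have h4 : 0 ≤ (1 + (u + w ^ 2 / 2))⁻¹ := by positivity
      calc C / (1 + (u + w ^ 2 / 2)) ^ 2
          = C * ((1 + (u + w ^ 2 / 2))⁻¹ * (1 + (u + w ^ 2 / 2))⁻¹) := by
            rw [div_eq_mul_inv, ← inv_pow, sq]
        _ ≤ C * ((2 * (1 + w ^ 2)⁻¹) * (1 + u)⁻¹) := by gcongr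
        _ = _ := by rw [div_eq_mul_inv]; ring

lemma oddProfile_time_deriv_bound (m : ℕ) {t₁ t₂ : ℝ} (h₁ : 0 < t₁) :
    ∃ C : ℝ, ∀ u t, 0 < u → t₁ ≤ t → t ≤ t₂ →
      |(u ^ 2 - 1) * oddProfile (m + 2) u t -
      (2 * m + 1) * u * oddProfile (m + 1) u t + m ^ 2 * oddProfile m u t| ≤ C * (1 + u)⁻¹ := by
  -- The coefficient $u^2-1$ costs two powers; the third leaves $(1+u)^{-1}$.
  have hdec := fun m => oddProfile_decay m 3 h₁ (t₂ := t₂)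
  choose C hC0 hC using hdec
  refine ⟨C (m + 2) + (2 * m + 1) * C (m + 1) + m ^ 2 * C m, fun u t hu ht₁ ht₂ => ?_⟩
  have key : ∀ k, (1 + u) ^ 2 * oddProfile k u t ≤ C k * (1 + u)⁻¹ := fun k => by
    refine (mul_le_mul_of_nonneg_left (hC k u t hu ht₁ ht₂) (by positivity)).trans_eq ?_
    field_simp
  have hp : ∀ k, 0 < oddProfile k u t := fun k => oddProfile_pos k hu (h₁.trans_le ht₁)
  have e1 : |(u ^ 2 - 1) * oddProfile (m + 2) u t| ≤ (1 + u) ^ 2 * oddProfile (m + 2) u t := by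
    rw [abs_mul, abs_of_pos (hp (m + 2))]
    refine mul_le_mul_of_nonneg_right ?_ (hp _).le
    rw [abs_le]; constructor <;> nlinarith
  have e2 : |(2 * m + 1) * u * oddProfile (m + 1) u t| ≤
      (2 * m + 1) * ((1 + u) ^ 2 * oddProfile (m + 1) u t) := by
    rw [abs_of_pos (by have := hp (m + 1); positivity), mul_assoc]
    refine mul_le_mul_of_nonneg_left (mul_le_mul_of_nonneg_right ?_ (hp _).le) (by positivity)
    nlinarith
  have e3 : |(m : ℝ) ^ 2 * oddProfile m u t| ≤ m ^ 2 * ((1 + u) ^ 2 * oddProfile m u t) := by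
    rw [abs_of_nonneg (by have := hp m; positivity)]
    refine mul_le_mul_of_nonneg_left ?_ (by positivity)
    nlinarith [hp m, mul_pos (hp m) hu, mul_pos (mul_pos (hp m) hu) hu]
  have f2 := mul_le_mul_of_nonneg_left (key (m + 1)) (by positivity : (0 : ℝ) ≤ 2 * m + 1)
  have f3 := mul_le_mul_of_nonneg_left (key m) (by positivity : (0 : ℝ) ≤ (m : ℝ) ^ 2)
  have := key (m + 2)
  refine (abs_add_le _ _).trans ((add_le_add (abs_sub _ _) le_rfl).trans ?_)
  linarith

lemma integral_lin_comb_sub {α : Type*} [MeasurableSpace α] {μ : Measure α}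
    {p q r f g : α → ℝ} (hp : Integrable p μ) (hq : Integrable q μ) (hr : Integrable r μ)
    (hf : Integrable f μ) (hg : Integrable g μ) (hf0 : ∫ w, f w ∂μ = 0) (hg0 : ∫ w, g w ∂μ = 0)
    (a b c k : ℝ) : ∫ w, (a * p w - b * q w + c * r w - f w - k * g w) ∂μ =
      a * ∫ w, p w ∂μ - b * ∫ w, q w ∂μ + c * ∫ w, r w ∂μ := by
  have h1 := (hp.const_mul a).sub (hq.const_mul b)
  have h2 := h1.add (hr.const_mul c)
  rw [integral_sub (f := fun w => a * p w - b * q w + c * r w - f w) (h2.sub hf) (hg.const_mul k),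
    integral_sub (f := fun w => a * p w - b * q w + c * r w) h2 hf,
    integral_add (f := fun w => a * p w - b * q w) h1 (hr.const_mul c),
    integral_sub (hp.const_mul a) (hq.const_mul b)]
  simp only [integral_const_mul, hf0, hg0]
  ring

/-- Integrating the heat equation in dimension `2m + 1` over a horocycle. -/
lemma integral_oddProfile_time_deriv (m : ℕ) {u t : ℝ} (hu : 0 < u) (ht : 0 < t) :
    ∫ w : ℝ, (((u + w ^ 2 / 2) ^ 2 - 1) * oddProfile (m + 2) (u + w ^ 2 / 2) t -
      (2 * m + 1) * (u + w ^ 2 / 2) * oddProfile (m + 1) (u + w ^ 2 / 2) t +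
        m ^ 2 * oddProfile m (u + w ^ 2 / 2) t) =
    (u ^ 2 - 1) * (∫ w : ℝ, oddProfile (m + 2) (u + w ^ 2 / 2) t) -
      2 * m * u * (∫ w : ℝ, oddProfile (m + 1) (u + w ^ 2 / 2) t) +
        (m - 1 / 2) ^ 2 * ∫ w : ℝ, oddProfile m (u + w ^ 2 / 2) t := by
  have hi := fun k m => integrable_pow_mul_oddProfile k m hu ht
  have hi0 := fun m => integrable_oddProfile m hu ht
  have hd : ∀ m w, HasDerivAt (fun w => oddProfile m (u + w ^ 2 / 2) t)
      (-w * oddProfile (m + 1) (u + w ^ 2 / 2) t) w := by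
    intro m w
    have h1 : HasDerivAt (fun w : ℝ => u + w ^ 2 / 2) w w := by
      simpa using ((hasDerivAt_pow 2 w).div_const 2).const_add u
    refine ((hasDerivAt_oddProfile m (add_half_sq_pos hu w) ht).comp w h1).congr_deriv ?_
    ring
  -- Replacing $u$ by $u+w^2/2$ leaves surplus terms with $w^2$ and $w^4$. They are absorbed by the
  -- total derivatives of $wP_m$ (here) and of $(uw+w^3/4)P_{m+1}$ (`hz2`), where $P_k$ stands for
  -- `oddProfile k` at $u+w^2/2$.
  have hz1 : ∫ w : ℝ, (oddProfile m (u + w ^ 2 / 2) t -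
      w ^ 2 * oddProfile (m + 1) (u + w ^ 2 / 2) t) = 0 := by
    refine integral_eq_zero_of_hasDerivAt_of_integrable
      (f := fun w => w * oddProfile m (u + w ^ 2 / 2) t) (fun w => ?_)
      ((hi0 m).sub (hi 2 (m + 1))) (by simpa using hi 1 m)
    refine ((hasDerivAt_id w).mul (hd m w)).congr_deriv ?_
    simp only [id]
    ring
  have hz2 : ∫ w : ℝ, ((u * oddProfile (m + 1) (u + w ^ 2 / 2) t +
      3 / 4 * (w ^ 2 * oddProfile (m + 1) (u + w ^ 2 / 2) t)) -
      (u * (w ^ 2 * oddProfile (m + 2) (u + w ^ 2 / 2) t) +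
      1 / 4 * (w ^ 4 * oddProfile (m + 2) (u + w ^ 2 / 2) t))) = 0 := by
    refine integral_eq_zero_of_hasDerivAt_of_integrable
      (f := fun w => u * (w ^ 1 * oddProfile (m + 1) (u + w ^ 2 / 2) t) +
        1 / 4 * (w ^ 3 * oddProfile (m + 1) (u + w ^ 2 / 2) t)) (fun w => ?_)
      ((((hi0 (m + 1)).const_mul u).add ((hi 2 (m + 1)).const_mul _)).sub
        (((hi 2 (m + 2)).const_mul u).add ((hi 4 (m + 2)).const_mul _)))
      (((hi 1 (m + 1)).const_mul u).add ((hi 3 (m + 1)).const_mul _))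
    refine ((((hasDerivAt_pow 1 w).mul (hd (m + 1) w)).const_mul u).add
      (((hasDerivAt_pow 3 w).mul (hd (m + 1) w)).const_mul (1 / 4))).congr_deriv ?_
    push_cast
    ring
  have e : ∀ w : ℝ, (((u + w ^ 2 / 2) ^ 2 - 1) * oddProfile (m + 2) (u + w ^ 2 / 2) t -
      (2 * m + 1) * (u + w ^ 2 / 2) * oddProfile (m + 1) (u + w ^ 2 / 2) t +
        m ^ 2 * oddProfile m (u + w ^ 2 / 2) t) =
      ((((u ^ 2 - 1) * oddProfile (m + 2) (u + w ^ 2 / 2) t -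
        2 * m * u * oddProfile (m + 1) (u + w ^ 2 / 2) t) +
        (m - 1 / 2) ^ 2 * oddProfile m (u + w ^ 2 / 2) t) -
      ((u * oddProfile (m + 1) (u + w ^ 2 / 2) t +
      3 / 4 * (w ^ 2 * oddProfile (m + 1) (u + w ^ 2 / 2) t)) -
      (u * (w ^ 2 * oddProfile (m + 2) (u + w ^ 2 / 2) t) +
      1 / 4 * (w ^ 4 * oddProfile (m + 2) (u + w ^ 2 / 2) t)))) -
      (1 / 4 - m) * (oddProfile m (u + w ^ 2 / 2) t -
        w ^ 2 * oddProfile (m + 1) (u + w ^ 2 / 2) t) := by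
    intro w; ring
  simp_rw [e]
  exact integral_lin_comb_sub (hi0 (m + 2)) (hi0 (m + 1)) (hi0 m)
    ((((hi0 (m + 1)).const_mul u).add ((hi 2 (m + 1)).const_mul _)).sub
      (((hi 2 (m + 2)).const_mul u).add ((hi 4 (m + 2)).const_mul _)))
    ((hi0 m).sub (hi 2 (m + 1))) hz2 hz1 _ _ _ _

lemma profile_heat_eq (j : ℕ) {u t : ℝ} (hu : 0 < u) (ht : 0 < t) :
    HasDerivAt (fun t => profile j u t) ((u ^ 2 - 1) * profile (j + 4) u t -
      (j + 1) * u * profile (j + 2) u t + (j / 2) ^ 2 * profile j u t) t := by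
  rcases Nat.even_or_odd' j with ⟨m, rfl | rfl⟩
  · rw [show 2 * m + 4 = 2 * (m + 2) by ring, show 2 * m + 2 = 2 * (m + 1) by ring]
    simp only [profile_even]
    refine (oddProfile_heat_eq m hu ht).congr_deriv ?_
    push_cast
    ring
  · rw [show 2 * m + 1 + 4 = 2 * (m + 2) + 1 by ring, show 2 * m + 1 + 2 = 2 * (m + 1) + 1 by ring]
    simp only [profile_odd]
    obtain ⟨C, hC⟩ := oddProfile_time_deriv_bound (m + 1) (half_pos ht) (t₂ := 2 * t)
    have hc : ∀ k, Continuous fun w : ℝ => oddProfile k (u + w ^ 2 / 2) t := fun k =>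
      continuous_oddProfile_comp k (by fun_prop) (add_half_sq_pos hu) ht
    have h := (hasDerivAt_integral_of_dominated_loc_of_deriv_le
      (F := fun t w => oddProfile (m + 1) (u + w ^ 2 / 2) t)
      (bound := fun w => |C| * (2 * (1 + w ^ 2)⁻¹)) (μ := volume)
      (Ioo_mem_nhds (by linarith : t / 2 < t) (by linarith : t < 2 * t)) ?_
      (integrable_oddProfile _ hu ht) ?_ ?_ ?_
      (ae_of_all _ fun w τ hτ => oddProfile_heat_eq (m + 1) (add_half_sq_pos hu w)
        ((half_pos ht).trans hτ.1))).2
    · rw [integral_oddProfile_time_deriv (m + 1) hu ht] at h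
      refine (h.const_mul _).congr_deriv ?_
      push_cast
      ring
    · filter_upwards [Ioi_mem_nhds ht] with τ hτ
        using (integrable_oddProfile (m + 1) hu hτ).aestronglyMeasurable
    · refine Continuous.aestronglyMeasurable ?_
      exact (((by fun_prop : Continuous fun w : ℝ => (u + w ^ 2 / 2) ^ 2 - 1).mul (hc _)).sub
        ((by fun_prop : Continuous fun w : ℝ => (2 * (m + 1 : ℕ) + 1) * (u + w ^ 2 / 2)).mul
          (hc _))).add (continuous_const.mul (hc _))
    · refine ae_of_all _ fun w τ hτ => ?_
      refine (hC _ τ (add_half_sq_pos hu w) hτ.1.le hτ.2.le).trans ?_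
      have := inv_one_add_le hu w
      have := add_half_sq_pos hu w
      refine mul_le_mul (le_abs_self C) (by assumption) (by positivity) (by positivity)
    · exact (integrable_inv_one_add_sq.const_mul 2).const_mul _

/-! ### Horospherical integration and monotonicity of the profiles. -/

lemma tendsto_oddProfile_atTop (m : ℕ) {t : ℝ} (ht : 0 < t) :
    Tendsto (fun u => oddProfile m u t) atTop (𝓝 0) := by
  obtain ⟨C, hC0, hC⟩ := oddProfile_decay m 1 ht (t₂ := t)
  refine squeeze_zero' (g := fun u => C / (1 + u)) ?_ ?_ ?_
  · filter_upwards [eventually_gt_atTop 0] with u hu using (oddProfile_pos m hu ht).le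
  · filter_upwards [eventually_gt_atTop 0] with u hu
    simpa using hC u t hu le_rfl le_rfl
  · exact (tendsto_const_nhds (x := C)).div_atTop (tendsto_atTop_add_const_left _ _ tendsto_id)

/-- The integrand is the $r$-derivative of minus the profile of order `m` at $c+r^2/2$, which
vanishes at infinity. -/
lemma lintegral_oddProfile_radial (m : ℕ) {c t : ℝ} (hc : 0 < c) (ht : 0 < t) :
    ∫⁻ r in Ioi (0 : ℝ), ENNReal.ofReal (r * oddProfile (m + 1) (c + r ^ 2 / 2) t) =
      ENNReal.ofReal (oddProfile m c t) := by
  have hd : ∀ w ∈ Ici (0 : ℝ), HasDerivAt (fun w => -oddProfile m (c + w ^ 2 / 2) t)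
      (w * oddProfile (m + 1) (c + w ^ 2 / 2) t) w := by
    intro w _
    have h1 : HasDerivAt (fun w : ℝ => c + w ^ 2 / 2) w w := by
      simpa using ((hasDerivAt_pow 2 w).div_const 2).const_add c
    refine ((hasDerivAt_oddProfile m (add_half_sq_pos hc w) ht).comp w h1).neg.congr_deriv ?_
    ring
  have hpos : ∀ r ∈ Ioi (0 : ℝ), 0 ≤ r * oddProfile (m + 1) (c + r ^ 2 / 2) t := fun r hr =>
    mul_nonneg (le_of_lt hr) (oddProfile_pos _ (add_half_sq_pos hc r) ht).le
  have hlim : Tendsto (fun w : ℝ => -oddProfile m (c + w ^ 2 / 2) t) atTop (𝓝 0) := by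
    rw [← neg_zero]
    refine ((tendsto_oddProfile_atTop m ht).comp ?_).neg
    exact tendsto_atTop_add_const_left _ _
      ((tendsto_pow_atTop (by norm_num : (2 : ℕ) ≠ 0)).atTop_div_const (by norm_num))
  rw [← ofReal_integral_eq_lintegral_ofReal (integrableOn_Ioi_deriv_of_nonneg' hd hpos hlim)
    ((ae_restrict_iff' measurableSet_Ioi).2 (ae_of_all _ hpos)),
    integral_Ioi_of_hasDerivAt_of_nonneg' hd hpos hlim]
  simp

/-- Integrating the profile over a horocycle lowers its index. -/
lemma lintegral_profile (j : ℕ) {c t : ℝ} (hc : 0 < c) (ht : 0 < t) :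
    ∫⁻ w : ℝ, ENNReal.ofReal (profile (j + 1) (c + w ^ 2 / 2) t) =
      ENNReal.ofReal (√(2 * Real.pi) * profile j c t) := by
  have hpi := Real.pi_pos
  have hs : 0 < √(2 * Real.pi) := by positivity
  have hl : ∀ m {c : ℝ}, 0 < c → ENNReal.ofReal (∫ w : ℝ, oddProfile m (c + w ^ 2 / 2) t) =
      ∫⁻ w : ℝ, ENNReal.ofReal (oddProfile m (c + w ^ 2 / 2) t) := fun m c hc =>
    ofReal_integral_eq_lintegral_ofReal (integrable_oddProfile m hc ht)
      (ae_of_all _ fun w => (oddProfile_pos m (add_half_sq_pos hc w) ht).le)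
  rcases Nat.even_or_odd' j with ⟨m, rfl | rfl⟩
  · simp only [profile_odd, profile_even]
    have hf : Measurable fun p : ℝ × ℝ =>
        ENNReal.ofReal (oddProfile (m + 1) (c + p.1 ^ 2 / 2 + p.2 ^ 2 / 2) t) :=
      (continuous_oddProfile_comp (m + 1) (by fun_prop) (fun p => by positivity)
        ht).measurable.ennreal_ofReal
    calc ∫⁻ w : ℝ, ENNReal.ofReal ((√(2 * Real.pi))⁻¹ *
          ∫ v : ℝ, oddProfile (m + 1) (c + w ^ 2 / 2 + v ^ 2 / 2) t)
        = ∫⁻ w : ℝ, ENNReal.ofReal (√(2 * Real.pi))⁻¹ *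
          ∫⁻ v : ℝ, ENNReal.ofReal (oddProfile (m + 1) (c + w ^ 2 / 2 + v ^ 2 / 2) t) := by
          refine lintegral_congr fun w => ?_
          rw [ENNReal.ofReal_mul (by positivity), hl _ (add_half_sq_pos hc w)]
      _ = ENNReal.ofReal (√(2 * Real.pi))⁻¹ * ∫⁻ p : ℝ × ℝ,
          ENNReal.ofReal (oddProfile (m + 1) (c + p.1 ^ 2 / 2 + p.2 ^ 2 / 2) t) := by
          rw [lintegral_const_mul' _ _ ENNReal.ofReal_ne_top, Measure.volume_eq_prod,
            lintegral_prod _ hf.aemeasurable]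
      -- For even index two half integrals make one planar integral of a radial function; polar
      -- coordinates undo one derivative.
      _ = ENNReal.ofReal (√(2 * Real.pi))⁻¹ * ∫⁻ p : ℝ × ℝ in Ioi 0 ×ˢ Ioo (-Real.pi) Real.pi,
          ENNReal.ofReal (p.1 * oddProfile (m + 1) (c + p.1 ^ 2 / 2) t) := by
          rw [← lintegral_comp_polarCoord_symm, polarCoord_target]
          congr 1
          refine setLIntegral_congr_fun (measurableSet_Ioi.prod measurableSet_Ioo) fun p hp => ?_
          have hp0 : 0 < p.1 := hp.1
          rw [smul_eq_mul, ← ENNReal.ofReal_mul hp0.le, polarCoord_symm_apply]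
          have h1 := Real.sin_sq_add_cos_sq p.2
          have : c + (p.1 * Real.cos p.2) ^ 2 / 2 + (p.1 * Real.sin p.2) ^ 2 / 2 =
              c + p.1 ^ 2 / 2 := by linear_combination p.1 ^ 2 / 2 * h1
          dsimp only
          rw [this]
      _ = ENNReal.ofReal (√(2 * Real.pi))⁻¹ * ∫⁻ r in Ioi (0 : ℝ), ∫⁻ _ in Ioo (-Real.pi) Real.pi,
          ENNReal.ofReal (r * oddProfile (m + 1) (c + r ^ 2 / 2) t) := by
          have hf2 : Measurable fun p : ℝ × ℝ =>
              ENNReal.ofReal (p.1 * oddProfile (m + 1) (c + p.1 ^ 2 / 2) t) := by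
            have := continuous_oddProfile_comp (m + 1) (f := fun p : ℝ × ℝ => c + p.1 ^ 2 / 2)
              (by fun_prop) (fun p => by positivity) ht
            exact (continuous_fst.mul this).measurable.ennreal_ofReal
          rw [Measure.volume_eq_prod, ← Measure.prod_restrict, lintegral_prod _ hf2.aemeasurable]
      _ = ENNReal.ofReal (√(2 * Real.pi))⁻¹ *
          (ENNReal.ofReal (oddProfile m c t) * ENNReal.ofReal (2 * Real.pi)) := by
          simp_rw [setLIntegral_const, Real.volume_Ioo]
          rw [lintegral_mul_const' _ _ ENNReal.ofReal_ne_top, lintegral_oddProfile_radial m hc ht]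
          congr 3
          ring
      _ = ENNReal.ofReal (√(2 * Real.pi) * oddProfile m c t) := by
          rw [← ENNReal.ofReal_mul (oddProfile_pos m hc ht).le, ← ENNReal.ofReal_mul (by positivity)]
          congr 1
          have h1 := Real.mul_self_sqrt (by positivity : 0 ≤ 2 * Real.pi)
          field_simp
          linear_combination -oddProfile m c t * h1
  -- For odd index the claim is the definition of the half integral.
  · rw [show 2 * m + 1 + 1 = 2 * (m + 1) by ring]
    simp only [profile_odd, profile_even]
    rw [← hl _ hc]
    congr 1
    field_simp

lemma profile_zero_cosh (a t : ℝ) :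
    profile 0 (Real.cosh a) t = (√(4 * Real.pi * t))⁻¹ * Real.exp (-a ^ 2 / (4 * t)) := by
  rw [show 0 = 2 * 0 by rfl, profile_even, oddProfile_zero, arcoshSq_cosh]

/-- The derivative is minus the profile of index `j + 2`, which is positive. -/
lemma profile_antitoneOn (j : ℕ) {t : ℝ} (ht : 0 < t) :
    StrictAntiOn (fun u => profile j u t) (Ioi 0) := by
  refine strictAntiOn_of_deriv_neg (convex_Ioi 0) (fun u hu =>
    (hasDerivAt_profile j hu ht).continuousAt.continuousWithinAt) fun u hu => ?_
  rw [interior_Ioi] at hu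
  rw [(hasDerivAt_profile j hu ht).deriv]
  exact neg_neg_of_pos (profile_pos _ hu ht)

lemma lintegral_comp_affine (g : ℝ → ENNReal) (y : ℝ) {a : ℝ} (ha : 0 < a) :
    ∫⁻ s, g s = ENNReal.ofReal a * ∫⁻ w, g (y + a * w) := by
  have h := lintegral_image_eq_lintegral_abs_deriv_mul (s := univ) (f := fun w => y + a * w)
    (f' := fun _ => a) MeasurableSet.univ (fun w _ => HasDerivAt.hasDerivWithinAt
      (by simpa using (((hasDerivAt_id w).const_mul a).const_add y)))
    (fun w _ v _ hwv => by simpa [ha.ne'] using hwv) g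
  have himg : (fun w => y + a * w) '' univ = univ := by
    refine eq_univ_of_forall fun s => ⟨(s - y) / a, mem_univ _, ?_⟩
    field_simp
    ring
  rw [himg, setLIntegral_univ, setLIntegral_univ, abs_of_pos ha,
    lintegral_const_mul' _ _ ENNReal.ofReal_ne_top] at h
  exact h

lemma lintegral_profile_affine (j : ℕ) {c t r : ℝ} (hc : 0 < c) (ht : 0 < t) (hr : 0 < r) (y : ℝ) :
    ∫⁻ w : ℝ, ENNReal.ofReal (profile (j + 1) (c + (w - y) ^ 2 / (2 * r)) t) =
      ENNReal.ofReal (√(2 * Real.pi * r) * profile j c t) := by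
  have hs := Real.sq_sqrt hr.le
  rw [lintegral_comp_affine _ y (Real.sqrt_pos.2 hr)]
  have : ∀ w : ℝ, c + (y + √r * w - y) ^ 2 / (2 * r) = c + w ^ 2 / 2 := fun w => by
    rw [add_sub_cancel_left, mul_pow, hs]
    field_simp
  simp_rw [this]
  rw [lintegral_profile j hc ht, ← ENNReal.ofReal_mul (by positivity),
    Real.sqrt_mul (by have := Real.pi_pos; positivity : 0 ≤ 2 * Real.pi) r]
  congr 1
  ring

lemma aemeasurable_ofReal_profile_comp {X : Type*} [TopologicalSpace X] [MeasurableSpace X]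
    [OpensMeasurableSpace X] {μ : Measure X} {s : Set X} (hs : MeasurableSet s) (j : ℕ) {f : X → ℝ}
    (hf : ContinuousOn f s) (hf0 : ∀ x ∈ s, 0 < f x) {t : ℝ} (ht : 0 < t) :
    AEMeasurable (fun x => ENNReal.ofReal (profile j (f x) t)) (μ.restrict s) := by
  have h : ContinuousOn (fun x => profile j (f x) t) s :=
    (continuousOn_profile j).comp (f := fun x => (f x, t)) (hf.prodMk continuousOn_const)
      fun x hx => ⟨hf0 x hx, ht⟩
  exact (h.aemeasurable hs).ennreal_ofReal

/-- One coordinate at a time: each integration lowers the index by one and contributes $\sqrt{2\pi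
r}$. -/
lemma lintegral_profile_pi (n j : ℕ) {c t r : ℝ} (hc : 0 < c) (ht : 0 < t) (hr : 0 < r)
    (y : Fin n → ℝ) :
    ∫⁻ w : Fin n → ℝ, ENNReal.ofReal (profile (j + n) (c + (∑ i, (w i - y i) ^ 2) / (2 * r)) t) =
      ENNReal.ofReal (√(2 * Real.pi * r) ^ n * profile j c t) := by
  induction n generalizing c j with
  | zero =>
    rw [volume_pi, Measure.pi_of_empty, lintegral_dirac]
    simp
  | succ n ih =>
    have hpos : ∀ {m : ℕ} (c : ℝ) (z w : Fin m → ℝ), 0 < c →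
        0 < c + (∑ i, (w i - z i) ^ 2) / (2 * r) := fun c z w hc =>
      add_pos_of_pos_of_nonneg hc (div_nonneg (Finset.sum_nonneg fun i _ => sq_nonneg _)
        (by positivity))
    have hmp := (volume_preserving_piFinSuccAbove (fun _ : Fin (n + 1) => ℝ) 0).symm
    rw [← hmp.lintegral_comp_emb (MeasurableEquiv.measurableEmbedding _)]
    have he : ∀ p : ℝ × (Fin n → ℝ), c + (∑ i, ((MeasurableEquiv.piFinSuccAbove
        (fun _ : Fin (n + 1) => ℝ) 0).symm p i - y i) ^ 2) / (2 * r) =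
        (c + (p.1 - y 0) ^ 2 / (2 * r)) + (∑ i, (p.2 i - y i.succ) ^ 2) / (2 * r) := by
      intro p
      rw [Fin.sum_univ_succ]
      simp [MeasurableEquiv.piFinSuccAbove, Fin.insertNthEquiv]
      ring
    simp_rw [he]
    have hm : AEMeasurable (fun p : ℝ × (Fin n → ℝ) => ENNReal.ofReal (profile (j + (n + 1))
        ((c + (p.1 - y 0) ^ 2 / (2 * r)) + (∑ i, (p.2 i - y i.succ) ^ 2) / (2 * r)) t))
        (volume.prod volume) := by
      rw [← Measure.restrict_univ (μ := volume.prod volume)]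
      refine aemeasurable_ofReal_profile_comp MeasurableSet.univ _ (by fun_prop) (fun p _ => ?_) ht
      exact hpos _ _ _ (by positivity)
    rw [Measure.volume_eq_prod, lintegral_prod _ hm]
    have hc' : ∀ a : ℝ, 0 < c + (a - y 0) ^ 2 / (2 * r) := fun a => by positivity
    simp_rw [show j + (n + 1) = j + 1 + n by ring]
    have e2 : ∀ a : ℝ, ∫⁻ w : Fin n → ℝ, ENNReal.ofReal (profile (j + 1 + n)
        ((c + (a - y 0) ^ 2 / (2 * r)) + (∑ i, (w i - y i.succ) ^ 2) / (2 * r)) t) =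
        ENNReal.ofReal (√(2 * Real.pi * r) ^ n) *
          ENNReal.ofReal (profile (j + 1) (c + (a - y 0) ^ 2 / (2 * r)) t) := fun a => by
      rw [ih (j + 1) (hc' a) (fun i => y i.succ), ENNReal.ofReal_mul (by positivity)]
    simp_rw [e2]
    rw [lintegral_const_mul' _ _ ENNReal.ofReal_ne_top, lintegral_profile_affine j hc ht hr,
      ← ENNReal.ofReal_mul (by positivity), pow_succ, mul_assoc (_ ^ n)]

/-! ### Integration over the half-space. -/

lemma volumeDensity_hypMetric (n : ℕ) {x : Coord (n + 1)} (hx : 0 < x 0) :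
    volumeDensity (hypMetric (n + 1)) x = (x 0 ^ (n + 1))⁻¹ := by
  rw [volumeDensity, hypMetric, Matrix.det_diagonal, Finset.prod_const, Finset.card_univ,
    Fintype.card_fin, one_div, inv_pow, ← pow_mul, mul_comm 2, pow_mul, sq, mul_inv,
    Real.sqrt_mul_self (by positivity)]

lemma measurable_volumeDensity_hypMetric (n : ℕ) :
    Measurable fun x => volumeDensity (hypMetric (n + 1)) x := by
  unfold volumeDensity hypMetric
  simp only [Matrix.det_diagonal]
  fun_prop

lemma measurableSet_hypSpace (n : ℕ) : MeasurableSet (hypSpace (n + 1)) :=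
  measurableSet_lt measurable_const (by fun_prop)

lemma isOpen_hypSpace (n : ℕ) : IsOpen (hypSpace (n + 1)) :=
  isOpen_lt continuous_const (by fun_prop)

lemma lintegral_hypVolume (n : ℕ) {f : Coord (n + 1) → ENNReal}
    (hf : AEMeasurable f (volume.restrict (hypSpace (n + 1)))) :
    ∫⁻ x, f x ∂(hypVolume (n + 1)) =
      ∫⁻ x in hypSpace (n + 1), ENNReal.ofReal ((x 0 ^ (n + 1))⁻¹) * f x := by
  rw [hypVolume, lintegral_withDensity_eq_lintegral_mul₀
    (measurable_volumeDensity_hypMetric n).ennreal_ofReal.aemeasurable hf]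
  refine setLIntegral_congr_fun (measurableSet_hypSpace n) fun x hx => ?_
  simp only [Pi.mul_apply]
  rw [volumeDensity_hypMetric n hx]

/-- Split off the first coordinate. -/
def consCoord {n : ℕ} (p : ℝ × (Fin n → ℝ)) : Coord (n + 1) := WithLp.toLp 2 (Fin.cons p.1 p.2)

lemma consCoord_zero {n : ℕ} (p : ℝ × (Fin n → ℝ)) : consCoord p 0 = p.1 := rfl

lemma consCoord_succ {n : ℕ} (p : ℝ × (Fin n → ℝ)) (i : Fin n) : consCoord p i.succ = p.2 i := rfl

lemma setLIntegral_hypSpace (n : ℕ) (g : Coord (n + 1) → ENNReal) :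
    ∫⁻ x in hypSpace (n + 1), g x =
      ∫⁻ p in Ioi (0 : ℝ) ×ˢ (univ : Set (Fin n → ℝ)), g (consCoord p) ∂(volume.prod volume) := by
  have h1 := (volume_preserving_piFinSuccAbove (fun _ : Fin (n + 1) => ℝ) 0).symm
  have h2 := (EuclideanSpace.volume_preserving_symm_measurableEquiv_toLp (Fin (n + 1))).symm
  have h3 : MeasurePreserving ((MeasurableEquiv.toLp 2 (Fin (n + 1) → ℝ)) ∘
      (MeasurableEquiv.piFinSuccAbove (fun _ : Fin (n + 1) => ℝ) 0).symm) := h2.comp h1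
  have hemb : MeasurableEmbedding ((MeasurableEquiv.toLp 2 (Fin (n + 1) → ℝ)) ∘
      (MeasurableEquiv.piFinSuccAbove (fun _ : Fin (n + 1) => ℝ) 0).symm) :=
    (MeasurableEquiv.measurableEmbedding _).comp (MeasurableEquiv.measurableEmbedding _)
  have he : ∀ p : ℝ × (Fin n → ℝ), ((MeasurableEquiv.toLp 2 (Fin (n + 1) → ℝ)) ∘
      (MeasurableEquiv.piFinSuccAbove (fun _ : Fin (n + 1) => ℝ) 0).symm) p = consCoord p := by
    intro p
    simp [MeasurableEquiv.piFinSuccAbove, Fin.insertNthEquiv, consCoord]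
  rw [← h3.setLIntegral_comp_preimage_emb hemb]
  have hpre : ((MeasurableEquiv.toLp 2 (Fin (n + 1) → ℝ)) ∘
      (MeasurableEquiv.piFinSuccAbove (fun _ : Fin (n + 1) => ℝ) 0).symm) ⁻¹' hypSpace (n + 1) =
      Ioi (0 : ℝ) ×ˢ (univ : Set (Fin n → ℝ)) := by
    ext p
    rw [mem_preimage, he]
    simp [hypSpace, consCoord_zero]
  rw [hpre, Measure.volume_eq_prod]
  exact lintegral_congr fun p => by rw [he]

/-- Integration of a profile over hyperbolic space, reduced to a one-dimensional integral. -/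
lemma lintegral_hypVolume_profile (n : ℕ) {α : ℝ → ℝ} (hα : ContinuousOn α (Ioi 0))
    (hα0 : ∀ a, 0 < a → 0 < α a) {s t : ℝ} (hs : 0 < s) (ht : 0 < t) {y : Coord (n + 1)}
    (hy : 0 < y 0) :
    ∫⁻ x, ENNReal.ofReal (profile n (α (x 0) +
      (∑ i : Fin n, (x i.succ - y i.succ) ^ 2) / (2 * (s * (x 0 * y 0)))) t) ∂(hypVolume (n + 1)) =
    ∫⁻ b : ℝ, ENNReal.ofReal (√(2 * Real.pi * s) ^ n * Real.exp (-(n * b / 2)) *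
      profile 0 (α (y 0 * Real.exp b)) t) := by
  have hnn : ∀ (a : ℝ) (w z : Fin n → ℝ), 0 < a →
      0 < α a + (∑ i, (w i - z i) ^ 2) / (2 * (s * (a * y 0))) := fun a w z ha =>
    add_pos_of_pos_of_nonneg (hα0 a ha)
      (div_nonneg (Finset.sum_nonneg fun i _ => sq_nonneg _) (by positivity))
  rw [lintegral_hypVolume n, setLIntegral_hypSpace]
  · simp only [consCoord_zero, consCoord_succ]
    rw [← Measure.prod_restrict, lintegral_prod]
    · simp only [Measure.restrict_univ]
      have h1 : ∀ a ∈ Ioi (0 : ℝ), ∫⁻ w : Fin n → ℝ, ENNReal.ofReal ((a ^ (n + 1))⁻¹) *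
          ENNReal.ofReal (profile n (α a +
            (∑ i : Fin n, (w i - y i.succ) ^ 2) / (2 * (s * (a * y 0)))) t) =
          ENNReal.ofReal ((a ^ (n + 1))⁻¹ * (√(2 * Real.pi * (s * (a * y 0))) ^ n *
            profile 0 (α a) t)) := by
        intro a ha
        have ha' : 0 < a := ha
        have h2 := lintegral_profile_pi n 0 (hα0 a ha) ht
          (by positivity : 0 < s * (a * y 0)) (fun i => y i.succ)
        rw [zero_add] at h2
        rw [lintegral_const_mul' _ _ ENNReal.ofReal_ne_top, h2,
          ← ENNReal.ofReal_mul (by positivity)]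
      rw [setLIntegral_congr_fun measurableSet_Ioi h1]
      -- Substitution $a=y_0e^b$. The density $a^{-(n+1)}$, the horospherical factor $(ay_0)^{n/2}$
      -- and the Jacobian $y_0e^b$ multiply to $e^{-nb/2}$.
      have himg : (fun b => y 0 * Real.exp b) '' univ = Ioi 0 := by
        ext a
        simp only [image_univ, mem_range, mem_Ioi]
        constructor
        · rintro ⟨b, rfl⟩; positivity
        · intro ha
          refine ⟨Real.log (a / y 0), ?_⟩
          rw [Real.exp_log (by positivity)]
          field_simp
      rw [← himg, lintegral_image_eq_lintegral_abs_deriv_mul MeasurableSet.univ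
        (f' := fun b => y 0 * Real.exp b)
        (fun b _ => ((Real.hasDerivAt_exp b).const_mul (y 0)).hasDerivWithinAt)
        (fun b _ c _ hbc => by simpa [hy.ne'] using hbc), setLIntegral_univ]
      refine lintegral_congr fun b => ?_
      rw [abs_of_pos (by positivity), ← ENNReal.ofReal_mul (by positivity)]
      congr 1
      have e1 : √(2 * Real.pi * (s * (y 0 * Real.exp b * y 0))) =
          √(2 * Real.pi * s) * (y 0 * Real.exp (b / 2)) := by
        have hpi := Real.pi_pos
        have : 2 * Real.pi * (s * (y 0 * Real.exp b * y 0)) =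
            2 * Real.pi * s * (y 0 * Real.exp (b / 2)) ^ 2 := by
          rw [mul_pow, ← Real.exp_nat_mul]
          push_cast
          rw [mul_div_cancel₀ b (by norm_num)]
          ring
        rw [this, Real.sqrt_mul (by positivity), Real.sqrt_sq (by positivity)]
      have e2 : Real.exp (-(n * b / 2)) = ((Real.exp (b / 2)) ^ n)⁻¹ := by
        rw [Real.exp_neg, ← Real.exp_nat_mul]
        ring_nf
      have e3 : Real.exp b = Real.exp (b / 2) * Real.exp (b / 2) := by
        rw [← Real.exp_add]; ring_nf
      rw [e1, e2, e3]
      generalize profile 0 (α (y 0 * (Real.exp (b / 2) * Real.exp (b / 2)))) t = P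
      have hE : Real.exp (b / 2) ≠ 0 := (Real.exp_pos _).ne'
      have hy' := hy.ne'
      generalize Real.exp (b / 2) = E at hE
      field_simp
      ring
    · rw [Measure.prod_restrict]
      refine AEMeasurable.mul (measurable_fst.pow_const _).inv.ennreal_ofReal.aemeasurable ?_
      refine aemeasurable_ofReal_profile_comp (measurableSet_Ioi.prod MeasurableSet.univ) n ?_
        (fun p hp => hnn p.1 p.2 _ hp.1) ht
      refine ContinuousOn.add (hα.comp continuousOn_fst fun p hp => hp.1)
        (ContinuousOn.div (by fun_prop) (by fun_prop) fun p hp => ?_)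
      have : 0 < p.1 := hp.1
      positivity
  · refine aemeasurable_ofReal_profile_comp (measurableSet_hypSpace n) n ?_
      (fun x hx => hnn (x 0) (fun i => x i.succ) _ hx) ht
    refine ContinuousOn.add (hα.comp (by fun_prop) fun p hp => hp)
        (ContinuousOn.div (by fun_prop) (by fun_prop) fun p hp => ?_)
    have : 0 < p 0 := hp
    positivity

/-! ### The explicit kernel: total mass and tail. -/

/-- The hyperbolic cosine of the hyperbolic distance. -/
def hypCosh {n : ℕ} (x y : Coord (n + 1)) : ℝ := 1 + dist x y ^ 2 / (2 * (x 0 * y 0))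

lemma cosh_hypDist {n : ℕ} {x y : Coord (n + 1)} (hx : 0 < x 0) (hy : 0 < y 0) :
    Real.cosh (hypDist (n + 1) x y) = hypCosh x y := by
  rw [hypDist, Real.cosh_two_mul, Real.cosh_sq, Real.sinh_arsinh, hypCosh, div_pow, mul_pow,
    Real.sq_sqrt (by positivity)]
  field_simp
  ring

lemma one_le_hypCosh {n : ℕ} {x y : Coord (n + 1)} (hx : 0 < x 0) (hy : 0 < y 0) :
    1 ≤ hypCosh x y := by
  rw [hypCosh]
  have : 0 ≤ dist x y ^ 2 / (2 * (x 0 * y 0)) := by positivity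
  linarith

lemma hypCosh_pos {n : ℕ} {x y : Coord (n + 1)} (hx : 0 < x 0) (hy : 0 < y 0) :
    0 < hypCosh x y := zero_lt_one.trans_le (one_le_hypCosh hx hy)

lemma hypCosh_comm {n : ℕ} (x y : Coord (n + 1)) : hypCosh x y = hypCosh y x := by
  rw [hypCosh, hypCosh, dist_comm, mul_comm (x 0)]

lemma dist_sq_coord {n : ℕ} (x y : Coord (n + 1)) :
    dist x y ^ 2 = (x 0 - y 0) ^ 2 + ∑ i : Fin n, (x i.succ - y i.succ) ^ 2 := by
  rw [EuclideanSpace.dist_eq, Real.sq_sqrt (Finset.sum_nonneg fun i _ => sq_nonneg _),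
    Fin.sum_univ_succ]
  simp [Real.dist_eq, sq_abs]

lemma hypCosh_eq {n : ℕ} {x y : Coord (n + 1)} (hx : 0 < x 0) (hy : 0 < y 0) :
    hypCosh x y = (x 0 / y 0 + y 0 / x 0) / 2 +
      (∑ i : Fin n, (x i.succ - y i.succ) ^ 2) / (2 * (1 * (x 0 * y 0))) := by
  rw [hypCosh, dist_sq_coord]
  field_simp
  ring

/-- The factor depending on time in the heat kernel in dimension `n + 1`. -/
def timeFactor (n : ℕ) (t : ℝ) : ℝ := (√(2 * Real.pi) ^ n)⁻¹ * Real.exp (-(n / 2) ^ 2 * t)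

lemma timeFactor_pos (n : ℕ) (t : ℝ) : 0 < timeFactor n t := by
  have := Real.pi_pos
  unfold timeFactor
  positivity

/-- The heat kernel of hyperbolic space of dimension `n + 1`. -/
def hypKernel {n : ℕ} (x y : Coord (n + 1)) (t : ℝ) : ℝ :=
  timeFactor n t * profile n (hypCosh x y) t

lemma hypKernel_pos {n : ℕ} {x y : Coord (n + 1)} {t : ℝ} (hx : 0 < x 0) (hy : 0 < y 0)
    (ht : 0 < t) : 0 < hypKernel x y t :=
  mul_pos (timeFactor_pos n t) (profile_pos n (hypCosh_pos hx hy) ht)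

lemma hypKernel_comm {n : ℕ} (x y : Coord (n + 1)) (t : ℝ) :
    hypKernel x y t = hypKernel y x t := by
  rw [hypKernel, hypCosh_comm, hypKernel]

lemma ae_hypVolume_mem (n : ℕ) : ∀ᵐ x ∂(hypVolume (n + 1)), x ∈ hypSpace (n + 1) :=
  (withDensity_absolutelyContinuous _ _).ae_le (ae_restrict_mem (measurableSet_hypSpace n))

lemma lintegral_exp_quadratic (m : ℝ) {v : ℝ} (hv : 0 < v) :
    ∫⁻ b : ℝ, ENNReal.ofReal (Real.exp (-(b - m) ^ 2 / (2 * v))) =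
      ENNReal.ofReal √(2 * Real.pi * v) := by
  have hpi := Real.pi_pos
  have h := ProbabilityTheory.lintegral_gaussianPDFReal_eq_one m (v := v.toNNReal)
    (by simpa using hv)
  simp only [ProbabilityTheory.gaussianPDFReal, Real.coe_toNNReal v hv.le] at h
  have hs : 0 < √(2 * Real.pi * v) := by positivity
  have h2 : ∀ b : ℝ, ENNReal.ofReal ((√(2 * Real.pi * v))⁻¹ *
      Real.exp (-(b - m) ^ 2 / (2 * v))) = ENNReal.ofReal (√(2 * Real.pi * v))⁻¹ *
      ENNReal.ofReal (Real.exp (-(b - m) ^ 2 / (2 * v))) := fun b =>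
    ENNReal.ofReal_mul (by positivity)
  simp_rw [h2] at h
  rw [lintegral_const_mul' _ _ ENNReal.ofReal_ne_top] at h
  rw [← mul_one (ENNReal.ofReal √(2 * Real.pi * v)), ← h, ← mul_assoc,
    ← ENNReal.ofReal_mul (by positivity), mul_inv_cancel₀ hs.ne', ENNReal.ofReal_one, one_mul]

/-- The heat kernel has total mass one. -/
lemma lintegral_hypKernel {n : ℕ} {y : Coord (n + 1)} (hy : 0 < y 0) {t : ℝ} (ht : 0 < t) :
    ∫⁻ x, ENNReal.ofReal (hypKernel x y t) ∂(hypVolume (n + 1)) = 1 := by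
  have hpi := Real.pi_pos
  have h1 : ∫⁻ x, ENNReal.ofReal (hypKernel x y t) ∂(hypVolume (n + 1)) =
      ENNReal.ofReal (timeFactor n t) * ∫⁻ x, ENNReal.ofReal (profile n
        ((fun a => (a / y 0 + y 0 / a) / 2) (x 0) +
        (∑ i : Fin n, (x i.succ - y i.succ) ^ 2) / (2 * (1 * (x 0 * y 0)))) t)
          ∂(hypVolume (n + 1)) := by
    rw [← lintegral_const_mul' _ _ ENNReal.ofReal_ne_top]
    refine lintegral_congr_ae ?_
    filter_upwards [ae_hypVolume_mem n] with x hx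
    rw [hypKernel, ENNReal.ofReal_mul (timeFactor_pos n t).le, hypCosh_eq hx hy]
  rw [h1, lintegral_hypVolume_profile n (α := fun a => (a / y 0 + y 0 / a) / 2) (ContinuousOn.div_const (ContinuousOn.add (by fun_prop)
    (ContinuousOn.div (by fun_prop) (by fun_prop) fun a ha => ne_of_gt ha)) 2)
    (fun a ha => by positivity) one_pos ht hy, ← lintegral_const_mul' _ _ ENNReal.ofReal_ne_top]
  -- Completing the square: $-n^2t/4-nb/2-b^2/4t=-(b+nt)^2/4t$, a Gaussian of variance $2t$.
  have h2 : ∀ b : ℝ, ENNReal.ofReal (timeFactor n t) * ENNReal.ofReal (√(2 * Real.pi * 1) ^ n *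
      Real.exp (-(n * b / 2)) * profile 0 ((y 0 * Real.exp b / y 0 + y 0 / (y 0 * Real.exp b)) / 2)
        t) = ENNReal.ofReal (√(2 * Real.pi * (2 * t)))⁻¹ *
          ENNReal.ofReal (Real.exp (-(b - -(n * t)) ^ 2 / (2 * (2 * t)))) := by
    intro b
    have e1 : (y 0 * Real.exp b / y 0 + y 0 / (y 0 * Real.exp b)) / 2 = Real.cosh b := by
      rw [Real.cosh_eq, Real.exp_neg]
      field_simp
    rw [e1, profile_zero_cosh, ← ENNReal.ofReal_mul (timeFactor_pos n t).le,
      ← ENNReal.ofReal_mul (by positivity), timeFactor, mul_one]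
    congr 1
    have e2 : Real.exp (-(b - -(n * t)) ^ 2 / (2 * (2 * t))) = Real.exp (-(n / 2) ^ 2 * t) *
        Real.exp (-(n * b / 2)) * Real.exp (-b ^ 2 / (4 * t)) := by
      rw [← Real.exp_add, ← Real.exp_add]
      congr 1
      field_simp
      ring
    rw [e2, show 2 * Real.pi * (2 * t) = 4 * Real.pi * t by ring]
    have : √(2 * Real.pi) ^ n ≠ 0 := by positivity
    field_simp
  rw [lintegral_congr h2, lintegral_const_mul' _ _ ENNReal.ofReal_ne_top,
    lintegral_exp_quadratic _ (by positivity), ← ENNReal.ofReal_mul (by positivity),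
    inv_mul_cancel₀ (by positivity), ENNReal.ofReal_one]

/-- A bound, uniform in the pole, for the mass of the heat kernel off a ball around the pole. -/
lemma lintegral_hypKernel_far_le {n : ℕ} {δ : ℝ} (hδ : 0 < δ) {y : Coord (n + 1)} (hy : 0 < y 0)
    {t : ℝ} (ht : 0 < t) :
    ∫⁻ x in {x | 1 + δ ≤ hypCosh x y}, ENNReal.ofReal (hypKernel x y t) ∂(hypVolume (n + 1)) ≤
      ENNReal.ofReal (√2 ^ n * √8 * Real.exp (2 * n ^ 2 * t) *
        Real.exp (-Real.arcosh (1 + δ / 2) ^ 2 / 8 * t⁻¹)) := by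
  have hpi := Real.pi_pos
  set β := Real.arcosh (1 + δ / 2) with hβ
  have hβc : Real.cosh β = 1 + δ / 2 := Real.cosh_arcosh (by linarith)
  have hβ0 : 0 < β := Real.arcosh_pos (by linarith)
  -- Off the ball, $u\ge\frac12u+\frac12(1+\delta)$. Since the profile decreases, $u$ may be
  -- replaced by the right side, whose horospherical part is halved (`s = 2`) and whose remainder is
  -- `α`.
  let α : ℝ → ℝ := fun a => (a / y 0 + y 0 / a) / 4 + (1 + δ) / 2
  have h1 : ∫⁻ x in {x | 1 + δ ≤ hypCosh x y}, ENNReal.ofReal (hypKernel x y t)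
        ∂(hypVolume (n + 1)) ≤
      ENNReal.ofReal (timeFactor n t) * ∫⁻ x, ENNReal.ofReal (profile n (α (x 0) +
        (∑ i : Fin n, (x i.succ - y i.succ) ^ 2) / (2 * (2 * (x 0 * y 0)))) t)
          ∂(hypVolume (n + 1)) := by
    rw [← lintegral_const_mul' _ _ ENNReal.ofReal_ne_top]
    refine le_trans (lintegral_mono_ae ?_) (setLIntegral_le_lintegral {x | 1 + δ ≤ hypCosh x y} _)
    have hms : NullMeasurableSet {x | 1 + δ ≤ hypCosh x y} (hypVolume (n + 1)) := by
      refine (measurableSet_le measurable_const ?_).nullMeasurableSet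
      unfold hypCosh
      fun_prop
    filter_upwards [ae_restrict_of_ae (ae_hypVolume_mem n), ae_restrict_mem₀ hms] with x hx hxδ
    rw [hypKernel, ENNReal.ofReal_mul (timeFactor_pos n t).le]
    gcongr
    have hx' : 0 < x 0 := hx
    have hD : 0 ≤ (∑ i : Fin n, (x i.succ - y i.succ) ^ 2) / (2 * (2 * (x 0 * y 0))) :=
      div_nonneg (Finset.sum_nonneg fun i _ => sq_nonneg _) (by positivity)
    have hα0 : 0 < α (x 0) := by
      simp only [α]; positivity
    refine (profile_antitoneOn n ht).antitoneOn (add_pos_of_pos_of_nonneg hα0 hD)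
      (hypCosh_pos hx hy) ?_
    have hxδ' : 1 + δ ≤ hypCosh x y := hxδ
    have e : hypCosh x y = (x 0 / y 0 + y 0 / x 0) / 2 +
      2 * ((∑ i : Fin n, (x i.succ - y i.succ) ^ 2) / (2 * (2 * (x 0 * y 0)))) := by
      rw [hypCosh_eq hx hy]
      field_simp
    simp only [α]
    linarith
  refine h1.trans ?_
  rw [lintegral_hypVolume_profile n (α := α) (ContinuousOn.add (ContinuousOn.div_const
    (ContinuousOn.add (by fun_prop)
    (ContinuousOn.div (by fun_prop) (by fun_prop) fun a ha => ne_of_gt ha)) 4) (by fun_prop))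
    (fun a ha => by simp only [α]; positivity) two_pos ht hy,
    ← lintegral_const_mul' _ _ ENNReal.ofReal_ne_top]
  have h2 : ∀ b : ℝ, ENNReal.ofReal (timeFactor n t) * ENNReal.ofReal (√(2 * Real.pi * 2) ^ n *
      Real.exp (-(n * b / 2)) * profile 0 (α (y 0 * Real.exp b)) t) ≤
        ENNReal.ofReal (√2 ^ n * (√(4 * Real.pi * t))⁻¹ * Real.exp (2 * n ^ 2 * t) *
        Real.exp (-β ^ 2 / 8 * t⁻¹)) *
          ENNReal.ofReal (Real.exp (-(b - -(8 * n * t)) ^ 2 / (2 * (16 * t)))) := by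
    intro b
    have e1 : α (y 0 * Real.exp b) = 1 + (Real.cosh b - 1) / 2 + δ / 2 := by
      simp only [α]
      rw [Real.cosh_eq, Real.exp_neg]
      field_simp
      ring
    have hcb := Real.one_le_cosh b
    have hα1 : 1 ≤ α (y 0 * Real.exp b) := by rw [e1]; linarith
    -- Both $\gamma\ge\beta$ and $\gamma\ge|b|/2$ hold. Averaging the squares, the $\beta$ half
    -- gives the small factor $e^{-\beta^2/8t}$ and the $b$ half keeps a Gaussian of variance $16t$.
    obtain ⟨γ, hγ0, hγ⟩ : ∃ γ, 0 ≤ γ ∧ Real.cosh γ = α (y 0 * Real.exp b) :=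
      ⟨_, Real.arcosh_nonneg hα1, Real.cosh_arcosh hα1⟩
    have hγβ : β ≤ γ := by
      have : Real.cosh β ≤ Real.cosh γ := by rw [hγ, e1, hβc]; linarith
      rwa [Real.cosh_le_cosh, abs_of_pos hβ0, abs_of_nonneg hγ0] at this
    have hγb : |b / 2| ≤ γ := by
      have h5 := Real.cosh_two_mul (b / 2)
      have h6 := Real.cosh_sq (b / 2)
      rw [mul_div_cancel₀ b (by norm_num)] at h5
      have h7 := Real.one_le_cosh (b / 2)
      have : Real.cosh (b / 2) ≤ Real.cosh γ := by rw [hγ, e1]; nlinarith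
      rwa [Real.cosh_le_cosh, abs_of_nonneg hγ0] at this
    have hγsq : β ^ 2 / 2 + b ^ 2 / 8 ≤ γ ^ 2 := by
      have h8 := pow_le_pow_left₀ hβ0.le hγβ 2
      have h9 := pow_le_pow_left₀ (abs_nonneg _) hγb 2
      rw [sq_abs] at h9
      nlinarith
    rw [← hγ, profile_zero_cosh, ← ENNReal.ofReal_mul (timeFactor_pos n t).le,
      ← ENNReal.ofReal_mul (by positivity)]
    refine ENNReal.ofReal_le_ofReal ?_
    have e3 : timeFactor n t * (√(2 * Real.pi * 2) ^ n * Real.exp (-(n * b / 2)) *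
        ((√(4 * Real.pi * t))⁻¹ * Real.exp (-γ ^ 2 / (4 * t)))) = √2 ^ n * (√(4 * Real.pi * t))⁻¹ *
        Real.exp (-(n / 2) ^ 2 * t + -(n * b / 2) + -γ ^ 2 / (4 * t)) := by
      rw [timeFactor, Real.sqrt_mul (by positivity : 0 ≤ 2 * Real.pi) 2, mul_pow, Real.exp_add, Real.exp_add]
      have : √(2 * Real.pi) ^ n ≠ 0 := by positivity
      field_simp
    rw [e3, mul_assoc (_ * _) (Real.exp _) (Real.exp _), ← Real.exp_add,
      mul_assoc (_ * _) (Real.exp _) (Real.exp _), ← Real.exp_add, ← add_assoc]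
    refine mul_le_mul_of_nonneg_left (Real.exp_le_exp.2 ?_) (by positivity)
    have e4 : -γ ^ 2 / (4 * t) ≤ -(β ^ 2 / 2 + b ^ 2 / 8) / (4 * t) := by gcongr
    have e5 : 2 * (n : ℝ) ^ 2 * t + -β ^ 2 / 8 * t⁻¹ + -(b - -(8 * n * t)) ^ 2 / (2 * (16 * t)) =
        -(n * b / 2) + -(β ^ 2 / 2 + b ^ 2 / 8) / (4 * t) := by
      field_simp
      ring
    rw [e5]
    have : 0 ≤ ((n : ℝ) / 2) ^ 2 * t := by positivity
    linarith
  refine (lintegral_mono h2).trans_eq ?_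
  rw [lintegral_const_mul' _ _ ENNReal.ofReal_ne_top,
    lintegral_exp_quadratic _ (by positivity), ← ENNReal.ofReal_mul (by positivity)]
  congr 1
  have : √(2 * Real.pi * (16 * t)) = √8 * √(4 * Real.pi * t) := by
    rw [← Real.sqrt_mul (by norm_num)]
    ring_nf
  rw [this]
  have : √(4 * Real.pi * t) ≠ 0 := by positivity
  field_simp

/-! ### The Laplacian along coordinate lines. -/

/-- The `i`-th coordinate vector. -/
abbrev coordVec {n : ℕ} (i : Fin (n + 1)) : Coord (n + 1) := EuclideanSpace.single i 1

lemma partialDeriv_eq_of_hasFDerivAt {n : ℕ} {f : Coord (n + 1) → ℝ}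
    {f' : Coord (n + 1) →L[ℝ] ℝ} {x : Coord (n + 1)} (h : HasFDerivAt f f' x) (i : Fin (n + 1)) :
    partialDeriv i f x = f' (coordVec i) := by
  rw [partialDeriv, h.fderiv]

lemma hasDerivAt_line {n : ℕ} {f : Coord (n + 1) → ℝ} {x : Coord (n + 1)} {i : Fin (n + 1)} {s : ℝ}
    (h : DifferentiableAt ℝ f (x + s • coordVec i)) :
    HasDerivAt (fun s : ℝ => f (x + s • coordVec i)) (partialDeriv i f (x + s • coordVec i)) s := by
  have h1 : HasDerivAt (fun s : ℝ => x + s • coordVec i) (coordVec i) s := by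
    simpa using ((hasDerivAt_id s).smul_const (coordVec i)).const_add x
  exact h.hasFDerivAt.comp_hasDerivAt s h1

lemma eventually_line_mem {n : ℕ} {V : Set (Coord (n + 1))} (hV : IsOpen V) {x : Coord (n + 1)}
    (hx : x ∈ V) (i : Fin (n + 1)) : ∀ᶠ s : ℝ in 𝓝 0, x + s • coordVec i ∈ V := by
  have : ContinuousAt (fun s : ℝ => x + s • coordVec i) 0 := by fun_prop
  exact this.eventually (hV.mem_nhds (by simpa using hx))

/-- The function `f` has Laplacian `L` at `x`, in terms of derivatives along coordinate lines. -/
def HasLaplacianAt {n : ℕ} (f : Coord (n + 1) → ℝ) (L : ℝ) (x : Coord (n + 1)) : Prop :=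
  ∃ (D : Fin (n + 1) → ℝ → ℝ) (D₂ : Fin (n + 1) → ℝ),
    (∀ i, ∀ᶠ s in 𝓝 (0 : ℝ), HasDerivAt (fun s => f (x + s • coordVec i)) (D i s) s) ∧
    (∀ i, HasDerivAt (D i) (D₂ i) 0) ∧ L = x 0 ^ 2 * ∑ i, D₂ i + (1 - n) * x 0 * D 0 0

lemma HasLaplacianAt.sub {n : ℕ} {f g : Coord (n + 1) → ℝ} {L M : ℝ} {x : Coord (n + 1)}
    (hf : HasLaplacianAt f L x) (hg : HasLaplacianAt g M x) :
    HasLaplacianAt (fun x => f x - g x) (L - M) x := by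
  obtain ⟨D, D₂, h1, h2, h3⟩ := hf
  obtain ⟨E, E₂, g1, g2, g3⟩ := hg
  refine ⟨fun i s => D i s - E i s, fun i => D₂ i - E₂ i, fun i => ?_,
    fun i => (h2 i).sub (g2 i), ?_⟩
  · filter_upwards [h1 i, g1 i] with s hs gs using hs.sub gs
  · rw [h3, g3, Finset.sum_sub_distrib]; ring

/-- Allows the Laplacian found by the chain rule to be identified with the Laplace–Beltrami formula.
-/
lemma HasLaplacianAt.unique {n : ℕ} {f : Coord (n + 1) → ℝ} {L M : ℝ} {x : Coord (n + 1)}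
    (hf : HasLaplacianAt f L x) (hg : HasLaplacianAt f M x) : L = M := by
  obtain ⟨D, D₂, h1, h2, h3⟩ := hf
  obtain ⟨E, E₂, g1, g2, g3⟩ := hg
  have he : ∀ i, D i =ᶠ[𝓝 0] E i := fun i => by
    filter_upwards [h1 i, g1 i] with s hs gs using hs.unique gs
  have h4 : ∀ i, D₂ i = E₂ i := fun i => (h2 i).unique ((g2 i).congr_of_eventuallyEq (he i))
  rw [h3, g3, (he 0).eq_of_nhds, Finset.sum_congr rfl fun i _ => h4 i]

/-- A negative second derivative would make $0$ a local maximum too, hence $f$ locally constant with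
zero second derivative. -/
lemma second_deriv_nonneg_of_isLocalMin {f f' : ℝ → ℝ} {c : ℝ} (hf : ∀ᶠ s in 𝓝 (0 : ℝ),
    HasDerivAt f (f' s) s) (hf' : HasDerivAt f' c 0) (hmin : IsLocalMin f 0) :
    f' 0 = 0 ∧ 0 ≤ c := by
  have h0 : f' 0 = 0 := hmin.hasDerivAt_eq_zero hf.self_of_nhds
  refine ⟨h0, ?_⟩
  by_contra! hc
  have hderiv : deriv f =ᶠ[𝓝 0] f' := hf.mono fun s hs => hs.deriv
  have h1 : deriv (deriv f) 0 < 0 := by rw [hderiv.deriv_eq, hf'.deriv]; exact hc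
  have h2 : IsLocalMax f 0 := isLocalMax_of_deriv_deriv_neg h1 (by rw [hderiv.eq_of_nhds, h0])
    hf.self_of_nhds.continuousAt
  have h3 : f =ᶠ[𝓝 0] fun _ => f 0 := by
    filter_upwards [hmin, h2] with s hs hs' using le_antisymm hs' hs
  have h4 : deriv f =ᶠ[𝓝 0] fun _ => 0 := by
    filter_upwards [h3.eventuallyEq_nhds] with s hs
    rw [hs.deriv_eq]; simp
  rw [h4.deriv_eq] at h1
  simp at h1

lemma HasLaplacianAt.nonneg_of_isLocalMin {n : ℕ} {f : Coord (n + 1) → ℝ} {L : ℝ}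
    {x : Coord (n + 1)} (hf : HasLaplacianAt f L x) (hmin : IsLocalMin f x) : 0 ≤ L := by
  obtain ⟨D, D₂, h1, h2, rfl⟩ := hf
  have hline : ∀ i, IsLocalMin (fun s : ℝ => f (x + s • coordVec i)) 0 := by
    intro i
    have hc : ContinuousAt (fun s : ℝ => x + s • coordVec i) 0 := by fun_prop
    have h3 : Tendsto (fun s : ℝ => x + s • coordVec i) (𝓝 0) (𝓝 x) := by
      simpa [ContinuousAt] using hc
    have := h3.eventually hmin
    simpa [IsLocalMin, IsMinFilter] using this
  have h4 := fun i => second_deriv_nonneg_of_isLocalMin (h1 i) (h2 i) (hline i)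
  rw [(h4 0).1, mul_zero, add_zero]
  exact mul_nonneg (sq_nonneg _) (Finset.sum_nonneg fun i _ => (h4 i).2)

lemma contDiffOn_partialDeriv {n : ℕ} {f : Coord (n + 1) → ℝ}
    (hf : ContDiffOn ℝ 2 f (hypSpace (n + 1))) (i : Fin (n + 1)) :
    ContDiffOn ℝ 1 (partialDeriv i f) (hypSpace (n + 1)) :=
  (hf.fderiv_of_isOpen (isOpen_hypSpace n) (by norm_num)).clm_apply contDiffOn_const

lemma hasLaplacianAt_of_contDiffOn {n : ℕ} {f : Coord (n + 1) → ℝ}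
    (hf : ContDiffOn ℝ 2 f (hypSpace (n + 1))) {x : Coord (n + 1)} (hx : x ∈ hypSpace (n + 1)) :
    HasLaplacianAt f (x 0 ^ 2 * ∑ i, partialDeriv i (partialDeriv i f) x +
      (1 - n) * x 0 * partialDeriv 0 f x) x := by
  refine ⟨fun i s => partialDeriv i f (x + s • coordVec i),
    fun i => partialDeriv i (partialDeriv i f) x, fun i => ?_, fun i => ?_, by simp⟩
  · filter_upwards [eventually_line_mem (isOpen_hypSpace n) hx i] with s hs
    exact hasDerivAt_line ((hf.contDiffAt ((isOpen_hypSpace n).mem_nhds hs)).differentiableAt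
      (by norm_num))
  · have h := hasDerivAt_line (f := partialDeriv i f) (x := x) (i := i) (s := 0)
      (((contDiffOn_partialDeriv hf i).contDiffAt
        ((isOpen_hypSpace n).mem_nhds (by simpa using hx))).differentiableAt (by norm_num))
    simpa using h

/-- Here $\sqrt{\det g}\,g^{ii}=x_1^{2-d}$ with $d=n+1$. Differentiating this weight produces the
first-order term, with coefficient $2-d=1-n$. -/
lemma laplaceBeltrami_hypMetric {n : ℕ} {f : Coord (n + 1) → ℝ}
    (hf : ContDiffOn ℝ 2 f (hypSpace (n + 1))) {x : Coord (n + 1)} (hx : x ∈ hypSpace (n + 1)) :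
    laplaceBeltrami (hypMetric (n + 1)) f x =
      x 0 ^ 2 * ∑ i, partialDeriv i (partialDeriv i f) x + (1 - n) * x 0 * partialDeriv 0 f x := by
  have hx0 : 0 < x 0 := hx
  have h1 : ∀ i, (fun z => ∑ j, volumeDensity (hypMetric (n + 1)) z *
      (hypMetric (n + 1) z)⁻¹ i j * partialDeriv j f z) =ᶠ[𝓝 x]
      fun z => z 0 ^ 2 / z 0 ^ (n + 1) * partialDeriv i f z := by
    intro i
    filter_upwards [(isOpen_hypSpace n).mem_nhds hx] with z hz
    have hz0 : 0 < z 0 := hz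
    rw [volumeDensity_hypMetric n hz0]
    have hinv : (hypMetric (n + 1) z)⁻¹ = Matrix.diagonal fun _ => z 0 ^ 2 := by
      refine Matrix.inv_eq_left_inv ?_
      rw [hypMetric, Matrix.diagonal_mul_diagonal, ← Matrix.diagonal_one]
      congr 1
      ext j
      field_simp
    rw [hinv, Finset.sum_eq_single i]
    · rw [Matrix.diagonal_apply_eq]; ring
    · intro j _ hj
      rw [Matrix.diagonal_apply_ne _ hj.symm]; ring
    · simp
  have h2 : ∀ i, partialDeriv i (fun z => z 0 ^ 2 / z 0 ^ (n + 1) * partialDeriv i f z) x =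
      x 0 ^ 2 / x 0 ^ (n + 1) * partialDeriv i (partialDeriv i f) x +
        partialDeriv i f x * ((1 - n) * x 0 / x 0 ^ (n + 1) * (coordVec i : Coord (n + 1)) 0) := by
    intro i
    have hd : HasDerivAt (fun s : ℝ => s ^ 2 / s ^ (n + 1)) ((1 - n) * x 0 / x 0 ^ (n + 1)) (x 0) := by
      refine ((hasDerivAt_pow 2 (x 0)).div (hasDerivAt_pow (n + 1) (x 0))
        (by positivity)).congr_deriv ?_
      simp only [Nat.add_sub_cancel]
      push_cast
      field_simp
      ring
    have hp : HasFDerivAt (fun z : Coord (n + 1) => z 0)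
        (EuclideanSpace.proj (0 : Fin (n + 1)) : Coord (n + 1) →L[ℝ] ℝ) x :=
      (EuclideanSpace.proj (0 : Fin (n + 1)) : Coord (n + 1) →L[ℝ] ℝ).hasFDerivAt
    have hD := (((contDiffOn_partialDeriv hf i).contDiffAt
        ((isOpen_hypSpace n).mem_nhds hx)).differentiableAt (by norm_num)).hasFDerivAt
    refine (partialDeriv_eq_of_hasFDerivAt ((hd.comp_hasFDerivAt x hp).mul hD) i).trans ?_
    simp [partialDeriv]
  have h3 : ∀ i, partialDeriv i (fun z => ∑ j, volumeDensity (hypMetric (n + 1)) z *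
      (hypMetric (n + 1) z)⁻¹ i j * partialDeriv j f z) x =
      partialDeriv i (fun z => z 0 ^ 2 / z 0 ^ (n + 1) * partialDeriv i f z) x := fun i => by
    rw [partialDeriv, (h1 i).fderiv_eq, partialDeriv]
  rw [laplaceBeltrami, volumeDensity_hypMetric n hx0]
  simp only [h3, h2]
  rw [Finset.sum_add_distrib, ← Finset.mul_sum, Finset.sum_eq_single (0 : Fin (n + 1))
    (f := fun i => partialDeriv i f x *
      ((1 - n) * x 0 / x 0 ^ (n + 1) * (coordVec i : Coord (n + 1)) 0))]
  · simp
    field_simp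
  · intro i _ hi
    simp [hi.symm]
  · simp

lemma hasLaplacianAt_laplaceBeltrami {n : ℕ} {f : Coord (n + 1) → ℝ}
    (hf : ContDiffOn ℝ 2 f (hypSpace (n + 1))) {x : Coord (n + 1)} (hx : x ∈ hypSpace (n + 1)) :
    HasLaplacianAt f (laplaceBeltrami (hypMetric (n + 1)) f x) x := by
  rw [laplaceBeltrami_hypMetric hf hx]
  exact hasLaplacianAt_of_contDiffOn hf hx

/-! ### Derivatives of the kernel and its heat equation. -/

/-- `1` for the first coordinate, `0` for the others. -/
def firstInd {n : ℕ} (i : Fin (n + 1)) : ℝ := if i = 0 then 1 else 0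

/-- The derivative of `hypCosh x y` in the `i`-th coordinate of `x`. -/
def hypCoshD {n : ℕ} (i : Fin (n + 1)) (x y : Coord (n + 1)) : ℝ :=
  (x i - y i) / (x 0 * y 0) - firstInd i * dist x y ^ 2 / (2 * (x 0 ^ 2 * y 0))

/-- The second derivative of `hypCosh x y` in the `i`-th coordinate of `x`. -/
def hypCoshD2 {n : ℕ} (i : Fin (n + 1)) (x y : Coord (n + 1)) : ℝ :=
  1 / (x 0 * y 0) - firstInd i * (2 * (x i - y i) / (x 0 ^ 2 * y 0)) +
    firstInd i * dist x y ^ 2 / (x 0 ^ 3 * y 0)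

lemma hasDerivAt_line_of_zero {n : ℕ} {i : Fin (n + 1)} {f f' : Coord (n + 1) → ℝ}
    (h : ∀ x ∈ hypSpace (n + 1), HasDerivAt (fun s : ℝ => f (x + s • coordVec i)) (f' x) 0)
    {x : Coord (n + 1)} {s : ℝ} (hx : x + s • coordVec i ∈ hypSpace (n + 1)) :
    HasDerivAt (fun s : ℝ => f (x + s • coordVec i)) (f' (x + s • coordVec i)) s := by
  have h1 := h _ hx
  rw [← sub_self s] at h1
  refine (HasDerivAt.comp_sub_const s s h1).congr_of_eventuallyEq
    (Eventually.of_forall fun r => ?_)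
  dsimp only
  rw [add_assoc, ← add_smul]
  congr 3
  ring

lemma line_zero {n : ℕ} (i : Fin (n + 1)) (x : Coord (n + 1)) (s : ℝ) :
    (x + s • coordVec i) 0 = x 0 + s * firstInd i := by
  simp only [PiLp.add_apply, PiLp.smul_apply, smul_eq_mul, firstInd, PiLp.single_apply]
  congr 2
  simp [eq_comm]

lemma line_self {n : ℕ} (i : Fin (n + 1)) (x : Coord (n + 1)) (s : ℝ) :
    (x + s • coordVec i) i = x i + s := by
  simp

lemma firstInd_sq {n : ℕ} (i : Fin (n + 1)) : firstInd i * firstInd i = firstInd i := by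
  unfold firstInd; split_ifs <;> simp

lemma dist_line_sq {n : ℕ} (i : Fin (n + 1)) (x y : Coord (n + 1)) (s : ℝ) :
    dist (x + s • coordVec i) y ^ 2 = dist x y ^ 2 + 2 * s * (x i - y i) + s ^ 2 := by
  rw [dist_eq_norm, dist_eq_norm, add_sub_right_comm, norm_add_sq_real, norm_smul,
    inner_smul_right, EuclideanSpace.inner_single_right]
  simp
  ring

lemma hasDerivAt_hypCosh_zero {n : ℕ} (i : Fin (n + 1)) {x y : Coord (n + 1)} (hx : 0 < x 0)
    (hy : 0 < y 0) :
    HasDerivAt (fun s : ℝ => hypCosh (x + s • coordVec i) y) (hypCoshD i x y) 0 := by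
  simp only [hypCosh, line_zero, dist_line_sq]
  have hid := hasDerivAt_id (0 : ℝ)
  have hnum := (((hid.const_mul 2).mul_const (x i - y i)).const_add (dist x y ^ 2)).add
    (hasDerivAt_pow 2 (0 : ℝ))
  have hden := (((hid.mul_const (firstInd i)).const_add (x 0)).mul_const (y 0)).const_mul 2
  refine ((hnum.div hden (by simp; constructor <;> positivity)).const_add 1).congr_deriv ?_
  simp only [hypCoshD, Pi.add_apply, id, zero_mul, add_zero, mul_zero]
  norm_num
  field_simp

lemma hasDerivAt_hypCoshD_zero {n : ℕ} (i : Fin (n + 1)) {x y : Coord (n + 1)} (hx : 0 < x 0)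
    (hy : 0 < y 0) :
    HasDerivAt (fun s : ℝ => hypCoshD i (x + s • coordVec i) y) (hypCoshD2 i x y) 0 := by
  simp only [hypCoshD, line_zero, line_self, dist_line_sq]
  have hid := hasDerivAt_id (0 : ℝ)
  have hnum1 := (hid.const_add (x i)).sub_const (y i)
  have hnum := ((((hid.const_mul 2).mul_const (x i - y i)).const_add (dist x y ^ 2)).add
    (hasDerivAt_pow 2 (0 : ℝ))).const_mul (firstInd i)
  have hden1 := ((hid.mul_const (firstInd i)).const_add (x 0)).mul_const (y 0)
  have hden := ((((hid.mul_const (firstInd i)).const_add (x 0)).pow 2).mul_const (y 0)).const_mul 2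
  refine ((hnum1.div hden1 (by simp; constructor <;> positivity)).sub
    (hnum.div hden (by simp; constructor <;> positivity))).congr_deriv ?_
  have h1 := firstInd_sq i
  simp only [hypCoshD2, Pi.add_apply, Pi.pow_apply, id]
  generalize firstInd i = δ at h1
  simp only [zero_mul, add_zero, mul_zero]
  norm_num
  field_simp
  linear_combination (dist x y ^ 2) * h1

/-- Reflects $|\nabla\rho|=1$ for $u=\cosh\rho$; together with $\Delta u=(n+1)u$ it determines the
Laplacian of every function of $u$. -/
lemma hypCosh_gradient {n : ℕ} {x y : Coord (n + 1)} (hx : 0 < x 0) (hy : 0 < y 0) :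
    x 0 ^ 2 * ∑ i, hypCoshD i x y ^ 2 = hypCosh x y ^ 2 - 1 := by
  have h1 : ∀ i : Fin n, hypCoshD i.succ x y ^ 2 =
      (x i.succ - y i.succ) ^ 2 * ((x 0 * y 0) ^ 2)⁻¹ := fun i => by
    simp [hypCoshD, firstInd, Fin.succ_ne_zero, div_eq_mul_inv, mul_pow]
  rw [Fin.sum_univ_succ, Finset.sum_congr rfl fun i _ => h1 i, ← Finset.sum_mul, hypCosh, hypCoshD,
    dist_sq_coord]
  simp only [firstInd, if_true]
  field_simp
  ring

lemma hypCosh_laplacian {n : ℕ} {x y : Coord (n + 1)} (hx : 0 < x 0) (hy : 0 < y 0) :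
    x 0 ^ 2 * ∑ i, hypCoshD2 i x y + (1 - n) * x 0 * hypCoshD 0 x y = (n + 1) * hypCosh x y := by
  have h1 : ∀ i : Fin n, hypCoshD2 i.succ x y = 1 / (x 0 * y 0) := fun i => by
    simp [hypCoshD2, firstInd, Fin.succ_ne_zero]
  rw [Fin.sum_univ_succ, Finset.sum_congr rfl fun i _ => h1 i, Finset.sum_const, Finset.card_univ,
    Fintype.card_fin, nsmul_eq_mul, hypCosh, hypCoshD, hypCoshD2]
  simp only [firstInd, if_true]
  have := dist_sq_coord x y
  generalize dist x y ^ 2 = D at *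
  field_simp
  ring

/-- The derivative of the heat kernel in the `i`-th coordinate of `x`. -/
def hypKernelD {n : ℕ} (i : Fin (n + 1)) (x y : Coord (n + 1)) (t : ℝ) : ℝ :=
  timeFactor n t * (-profile (n + 2) (hypCosh x y) t * hypCoshD i x y)

/-- The second derivative of the heat kernel in the `i`-th coordinate of `x`. -/
def hypKernelD2 {n : ℕ} (i : Fin (n + 1)) (x y : Coord (n + 1)) (t : ℝ) : ℝ :=
  timeFactor n t * (profile (n + 4) (hypCosh x y) t * hypCoshD i x y ^ 2 -
    profile (n + 2) (hypCosh x y) t * hypCoshD2 i x y)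

/-- The time derivative of the heat kernel. -/
def hypKernelDt {n : ℕ} (x y : Coord (n + 1)) (t : ℝ) : ℝ :=
  timeFactor n t * ((hypCosh x y ^ 2 - 1) * profile (n + 4) (hypCosh x y) t -
    (n + 1) * hypCosh x y * profile (n + 2) (hypCosh x y) t)

lemma hasDerivAt_hypKernel_line {n : ℕ} (i : Fin (n + 1)) {x y : Coord (n + 1)} {s t : ℝ}
    (hx : x + s • coordVec i ∈ hypSpace (n + 1)) (hy : 0 < y 0) (ht : 0 < t) :
    HasDerivAt (fun s : ℝ => hypKernel (x + s • coordVec i) y t)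
      (hypKernelD i (x + s • coordVec i) y t) s := by
  refine hasDerivAt_line_of_zero (f := fun x => hypKernel x y t)
    (f' := fun x => hypKernelD i x y t) (fun x hx => ?_) hx
  have h := hasDerivAt_profile n (hypCosh_pos hx hy) ht
  rw [show hypCosh x y = hypCosh (x + (0 : ℝ) • coordVec i) y by simp] at h
  have := (h.comp (0 : ℝ) (hasDerivAt_hypCosh_zero i hx hy)).const_mul (timeFactor n t)
  exact this.congr_deriv (by simp [hypKernelD])

lemma hasDerivAt_hypKernelD_line {n : ℕ} (i : Fin (n + 1)) {x y : Coord (n + 1)} {s t : ℝ}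
    (hx : x + s • coordVec i ∈ hypSpace (n + 1)) (hy : 0 < y 0) (ht : 0 < t) :
    HasDerivAt (fun s : ℝ => hypKernelD i (x + s • coordVec i) y t)
      (hypKernelD2 i (x + s • coordVec i) y t) s := by
  refine hasDerivAt_line_of_zero (f := fun x => hypKernelD i x y t)
    (f' := fun x => hypKernelD2 i x y t) (fun x hx => ?_) hx
  have h := hasDerivAt_profile (n + 2) (hypCosh_pos hx hy) ht
  rw [show hypCosh x y = hypCosh (x + (0 : ℝ) • coordVec i) y by simp] at h
  have := ((h.comp (0 : ℝ) (hasDerivAt_hypCosh_zero i hx hy)).neg.mul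
    (hasDerivAt_hypCoshD_zero i hx hy)).const_mul (timeFactor n t)
  refine this.congr_deriv ?_
  simp only [hypKernelD2, Function.comp_apply, Pi.neg_apply, zero_smul, add_zero]
  ring

lemma hypKernelD2_sum {n : ℕ} {x y : Coord (n + 1)} (hx : 0 < x 0) (hy : 0 < y 0) (t : ℝ) :
    x 0 ^ 2 * ∑ i, hypKernelD2 i x y t + (1 - n) * x 0 * hypKernelD 0 x y t =
      hypKernelDt x y t := by
  have h1 := hypCosh_gradient hx hy
  have h2 := hypCosh_laplacian hx hy
  simp only [hypKernelD2, hypKernelD, hypKernelDt]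
  rw [← Finset.mul_sum, Finset.sum_sub_distrib, ← Finset.mul_sum, ← Finset.mul_sum]
  linear_combination timeFactor n t * profile (n + 4) (hypCosh x y) t * h1 -
    timeFactor n t * profile (n + 2) (hypCosh x y) t * h2

lemma hasDerivAt_hypKernel_time {n : ℕ} {x y : Coord (n + 1)} {t : ℝ} (hx : 0 < x 0) (hy : 0 < y 0)
    (ht : 0 < t) : HasDerivAt (fun t => hypKernel x y t) (hypKernelDt x y t) t := by
  have h1 : HasDerivAt (fun t => timeFactor n t) (-(n / 2) ^ 2 * timeFactor n t) t := by
    unfold timeFactor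
    refine ((((hasDerivAt_id t).const_mul (-((n : ℝ) / 2) ^ 2)).exp).const_mul _).congr_deriv ?_
    simp only [id]
    ring
  refine (h1.mul (profile_heat_eq n (hypCosh_pos hx hy) ht)).congr_deriv ?_
  rw [hypKernelDt]
  ring

lemma hasLaplacianAt_hypKernel {n : ℕ} {x y : Coord (n + 1)} {t : ℝ} (hx : 0 < x 0) (hy : 0 < y 0)
    (ht : 0 < t) : HasLaplacianAt (fun x => hypKernel x y t) (hypKernelDt x y t) x := by
  refine ⟨fun i s => hypKernelD i (x + s • coordVec i) y t, fun i => hypKernelD2 i x y t,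
    fun i => ?_, fun i => ?_, ?_⟩
  · filter_upwards [eventually_line_mem (isOpen_hypSpace n) hx i] with s hs
    exact hasDerivAt_hypKernel_line i hs hy ht
  · have := hasDerivAt_hypKernelD_line i (x := x) (s := 0)
      (by rw [zero_smul, add_zero]; exact hx) hy ht
    simpa using this
  · simpa using (hypKernelD2_sum hx hy t).symm

lemma continuousOn_hypCosh (n : ℕ) : ContinuousOn
    (fun q : Coord (n + 1) × Coord (n + 1) => hypCosh q.1 q.2)
      (hypSpace (n + 1) ×ˢ hypSpace (n + 1)) := by
  unfold hypCosh
  refine continuousOn_const.add (ContinuousOn.div (by fun_prop) (by fun_prop) fun q hq => ?_)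
  have h1 : 0 < q.1 0 := hq.1
  have h2 : 0 < q.2 0 := hq.2
  positivity

lemma continuousOn_hypCoshD {n : ℕ} (i : Fin (n + 1)) : ContinuousOn
    (fun q : Coord (n + 1) × Coord (n + 1) => hypCoshD i q.1 q.2)
      (hypSpace (n + 1) ×ˢ hypSpace (n + 1)) := by
  unfold hypCoshD
  refine ContinuousOn.sub (ContinuousOn.div (by fun_prop) (by fun_prop) fun q hq => ?_)
    (ContinuousOn.div (by fun_prop) (by fun_prop) fun q hq => ?_) <;>
  · have h1 : 0 < q.1 0 := hq.1
    have h2 : 0 < q.2 0 := hq.2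
    positivity

lemma continuousOn_hypCoshD2 {n : ℕ} (i : Fin (n + 1)) : ContinuousOn
    (fun q : Coord (n + 1) × Coord (n + 1) => hypCoshD2 i q.1 q.2)
      (hypSpace (n + 1) ×ˢ hypSpace (n + 1)) := by
  unfold hypCoshD2
  refine ContinuousOn.add (ContinuousOn.sub (ContinuousOn.div (by fun_prop) (by fun_prop)
    fun q hq => ?_) (continuousOn_const.mul (ContinuousOn.div (by fun_prop) (by fun_prop)
    fun q hq => ?_))) (ContinuousOn.div (by fun_prop) (by fun_prop) fun q hq => ?_) <;>
  · have h1 : 0 < q.1 0 := hq.1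
    have h2 : 0 < q.2 0 := hq.2
    positivity

/-- The domain of the heat kernel. -/
abbrev kernelDomain (n : ℕ) : Set (Coord (n + 1) × Coord (n + 1) × ℝ) :=
  hypSpace (n + 1) ×ˢ hypSpace (n + 1) ×ˢ Ioi (0 : ℝ)

lemma continuousOn_lift_kernelDomain {n : ℕ} {f : Coord (n + 1) → Coord (n + 1) → ℝ}
    (hf : ContinuousOn (fun q : Coord (n + 1) × Coord (n + 1) => f q.1 q.2)
      (hypSpace (n + 1) ×ˢ hypSpace (n + 1))) :
    ContinuousOn (fun q : Coord (n + 1) × Coord (n + 1) × ℝ => f q.1 q.2.1) (kernelDomain n) :=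
  hf.comp (f := fun q : Coord (n + 1) × Coord (n + 1) × ℝ => (q.1, q.2.1)) (by fun_prop)
    fun _ hq => ⟨hq.1, hq.2.1⟩

lemma continuousOn_profile_hypCosh (n j : ℕ) : ContinuousOn
    (fun q : Coord (n + 1) × Coord (n + 1) × ℝ => profile j (hypCosh q.1 q.2.1) q.2.2)
      (kernelDomain n) :=
  (continuousOn_profile j).comp
    (f := fun q : Coord (n + 1) × Coord (n + 1) × ℝ => (hypCosh q.1 q.2.1, q.2.2))
    ((continuousOn_lift_kernelDomain (continuousOn_hypCosh n)).prodMk (by fun_prop))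
    fun _ hq => ⟨hypCosh_pos hq.1 hq.2.1, hq.2.2⟩

lemma continuous_timeFactor (n : ℕ) : Continuous (timeFactor n) := by
  unfold timeFactor
  fun_prop

lemma continuousOn_timeFactor (n : ℕ) : ContinuousOn
    (fun q : Coord (n + 1) × Coord (n + 1) × ℝ => timeFactor n q.2.2) (kernelDomain n) :=
  ((continuous_timeFactor n).comp (by fun_prop)).continuousOn

lemma continuousOn_hypKernel (n : ℕ) : ContinuousOn
    (fun q : Coord (n + 1) × Coord (n + 1) × ℝ => hypKernel q.1 q.2.1 q.2.2) (kernelDomain n) :=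
  (continuousOn_timeFactor n).mul (continuousOn_profile_hypCosh n n)

lemma continuousOn_hypKernelD {n : ℕ} (i : Fin (n + 1)) : ContinuousOn
    (fun q : Coord (n + 1) × Coord (n + 1) × ℝ => hypKernelD i q.1 q.2.1 q.2.2)
      (kernelDomain n) :=
  (continuousOn_timeFactor n).mul ((continuousOn_profile_hypCosh n (n + 2)).neg.mul
    (continuousOn_lift_kernelDomain (continuousOn_hypCoshD i)))

lemma continuousOn_hypKernelD2 {n : ℕ} (i : Fin (n + 1)) : ContinuousOn
    (fun q : Coord (n + 1) × Coord (n + 1) × ℝ => hypKernelD2 i q.1 q.2.1 q.2.2)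
      (kernelDomain n) :=
  (continuousOn_timeFactor n).mul (((continuousOn_profile_hypCosh n (n + 4)).mul
    ((continuousOn_lift_kernelDomain (continuousOn_hypCoshD i)).pow 2)).sub
    ((continuousOn_profile_hypCosh n (n + 2)).mul
    (continuousOn_lift_kernelDomain (continuousOn_hypCoshD2 i))))

lemma continuousOn_hypKernelDt (n : ℕ) : ContinuousOn
    (fun q : Coord (n + 1) × Coord (n + 1) × ℝ => hypKernelDt q.1 q.2.1 q.2.2)
      (kernelDomain n) := by
  have hU := continuousOn_lift_kernelDomain (continuousOn_hypCosh n)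
  exact (continuousOn_timeFactor n).mul ((((hU.pow 2).sub continuousOn_const).mul
    (continuousOn_profile_hypCosh n (n + 4))).sub ((continuousOn_const.mul hU).mul
    (continuousOn_profile_hypCosh n (n + 2))))

lemma contDiffOn_profile (N j : ℕ) {t : ℝ} (ht : 0 < t) :
    ContDiffOn ℝ N (fun u => profile j u t) (Ioi 0) := by
  induction N generalizing j with
  | zero =>
    exact contDiffOn_zero.2 fun u hu =>
      (hasDerivAt_profile j hu ht).continuousAt.continuousWithinAt
  | succ N ih =>
    push_cast
    refine (contDiffOn_succ_iff_deriv_of_isOpen isOpen_Ioi).2 ⟨fun u hu =>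
      (hasDerivAt_profile j hu ht).differentiableAt.differentiableWithinAt, by simp, ?_⟩
    exact (ih (j + 2)).neg.congr fun u hu => (hasDerivAt_profile j hu ht).deriv

lemma contDiffOn_hypKernel {n : ℕ} {y : Coord (n + 1)} (hy : 0 < y 0) {t : ℝ} (ht : 0 < t) :
    ContDiffOn ℝ 2 (fun x => hypKernel x y t) (hypSpace (n + 1)) := by
  have h1 : ContDiffOn ℝ 2 (fun x => hypCosh x y) (hypSpace (n + 1)) := by
    simp only [hypCosh, dist_eq_norm]
    refine contDiffOn_const.add (ContDiffOn.div ?_ ?_ fun x hx => ?_)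
    · exact ((contDiff_id.sub contDiff_const).norm_sq ℝ).contDiffOn
    · fun_prop
    · have : 0 < x 0 := hx
      positivity
  exact contDiffOn_const.mul ((contDiffOn_profile 2 n ht).comp h1 fun x hx => hypCosh_pos hx hy)

lemma contDiffOn_hypKernel_time {n : ℕ} {x y : Coord (n + 1)} (hx : 0 < x 0) (hy : 0 < y 0) :
    ContDiffOn ℝ 1 (fun t => hypKernel x y t) (Ioi 0) := by
  rw [← zero_add (1 : WithTop ℕ∞)]
  refine (contDiffOn_succ_iff_deriv_of_isOpen isOpen_Ioi).2 ⟨fun t ht =>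
    (hasDerivAt_hypKernel_time hx hy ht).differentiableAt.differentiableWithinAt, by simp, ?_⟩
  rw [contDiffOn_zero]
  have h := (continuousOn_hypKernelDt n).comp (s := Ioi 0) (f := fun t : ℝ => (x, y, t))
    (by fun_prop) fun t ht => ⟨hx, hy, ht⟩
  exact h.congr fun t ht => (hasDerivAt_hypKernel_time hx hy ht).deriv

/-! ### The kernel as an approximate identity and fundamental solution. -/

lemma aestronglyMeasurable_hypVolume {n : ℕ} {f : Coord (n + 1) → ℝ}
    (hf : ContinuousOn f (hypSpace (n + 1))) : AEStronglyMeasurable f (hypVolume (n + 1)) :=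
  (hf.aestronglyMeasurable (measurableSet_hypSpace n)).mono_ac (withDensity_absolutelyContinuous _ _)

lemma hypVolume_ne_top {n : ℕ} {K : Set (Coord (n + 1))} (hK : IsCompact K)
    (hKH : K ⊆ hypSpace (n + 1)) : hypVolume (n + 1) K ≠ ⊤ := by
  rw [hypVolume, withDensity_apply _ hK.measurableSet, Measure.restrict_restrict hK.measurableSet,
    inter_eq_self_of_subset_left hKH]
  have hc : ContinuousOn (fun x => volumeDensity (hypMetric (n + 1)) x) K := by
    refine ContinuousOn.congr (f := fun x : Coord (n + 1) => (x 0 ^ (n + 1))⁻¹)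
      (ContinuousOn.inv₀ (by fun_prop) fun x hx => ?_)
      fun x hx => volumeDensity_hypMetric n (hKH hx)
    have : 0 < x 0 := hKH hx
    positivity
  exact (hc.integrableOn_compact hK).lintegral_lt_top.ne

lemma continuousOn_hypKernel_left {n : ℕ} {y : Coord (n + 1)} (hy : y ∈ hypSpace (n + 1)) {t : ℝ}
    (ht : 0 < t) : ContinuousOn (fun x => hypKernel x y t) (hypSpace (n + 1)) :=
  (continuousOn_hypKernel n).comp (f := fun x => (x, y, t)) (by fun_prop)
    fun _ hx => ⟨hx, hy, ht⟩

lemma ae_hypKernel_nonneg {n : ℕ} {y : Coord (n + 1)} (hy : y ∈ hypSpace (n + 1)) {t : ℝ}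
    (ht : 0 < t) : 0 ≤ᵐ[hypVolume (n + 1)] fun x => hypKernel x y t := by
  filter_upwards [ae_hypVolume_mem n] with x hx using (hypKernel_pos hx hy ht).le

lemma integrable_hypKernel {n : ℕ} {y : Coord (n + 1)} (hy : y ∈ hypSpace (n + 1)) {t : ℝ}
    (ht : 0 < t) : Integrable (fun x => hypKernel x y t) (hypVolume (n + 1)) := by
  refine ⟨aestronglyMeasurable_hypVolume (continuousOn_hypKernel_left hy ht), ?_⟩
  rw [hasFiniteIntegral_iff_ofReal (ae_hypKernel_nonneg hy ht), lintegral_hypKernel hy ht]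
  exact ENNReal.one_lt_top

lemma integral_hypKernel {n : ℕ} {y : Coord (n + 1)} (hy : y ∈ hypSpace (n + 1)) {t : ℝ}
    (ht : 0 < t) : ∫ x, hypKernel x y t ∂(hypVolume (n + 1)) = 1 := by
  rw [integral_eq_lintegral_of_nonneg_ae (ae_hypKernel_nonneg hy ht)
    (integrable_hypKernel hy ht).aestronglyMeasurable, lintegral_hypKernel hy ht]
  simp

lemma measurableSet_far {n : ℕ} (δ : ℝ) (y : Coord (n + 1)) :
    MeasurableSet {x | 1 + δ ≤ hypCosh x y} := by
  refine measurableSet_le measurable_const ?_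
  unfold hypCosh
  fun_prop

/-- The mass of the heat kernel off a ball tends to zero, uniformly in the pole. -/
lemma eventually_integral_hypKernel_far_le (n : ℕ) {δ η : ℝ} (hδ : 0 < δ) (hη : 0 < η) :
    ∀ᶠ t in 𝓝[>] (0 : ℝ), ∀ y ∈ hypSpace (n + 1),
      ∫ x in {x | 1 + δ ≤ hypCosh x y}, hypKernel x y t ∂(hypVolume (n + 1)) ≤ η := by
  have hβ : 0 < Real.arcosh (1 + δ / 2) := Real.arcosh_pos (by linarith)
  have hlim : Tendsto (fun t : ℝ => √2 ^ n * √8 * Real.exp (2 * n ^ 2 * t) *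
        Real.exp (-Real.arcosh (1 + δ / 2) ^ 2 / 8 * t⁻¹)) (𝓝[>] 0) (𝓝 0) := by
    have h1 : Tendsto (fun t : ℝ => √2 ^ n * √8 * Real.exp (2 * n ^ 2 * t)) (𝓝[>] 0)
        (𝓝 (√2 ^ n * √8 * Real.exp (2 * n ^ 2 * 0))) :=
      ((by fun_prop : Continuous fun t : ℝ => √2 ^ n * √8 * Real.exp (2 * n ^ 2 * t)).tendsto
        0).mono_left nhdsWithin_le_nhds
    have h2 : Tendsto (fun t : ℝ => Real.exp (-Real.arcosh (1 + δ / 2) ^ 2 / 8 * t⁻¹)) (𝓝[>] 0)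
        (𝓝 0) := by
      refine Real.tendsto_exp_atBot.comp ?_
      refine Tendsto.const_mul_atTop_of_neg ?_ tendsto_inv_nhdsGT_zero
      have := pow_pos hβ 2
      linarith
    simpa using h1.mul h2
  filter_upwards [hlim.eventually (gt_mem_nhds hη), self_mem_nhdsWithin] with t ht ht0 y hy
  have ht0' : 0 < t := ht0
  have h1 := lintegral_hypKernel_far_le hδ hy ht0'
  rw [integral_eq_lintegral_of_nonneg_ae (ae_restrict_of_ae (ae_hypKernel_nonneg hy ht0'))
    (integrable_hypKernel hy ht0').aestronglyMeasurable.restrict]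
  exact (ENNReal.toReal_le_of_le_ofReal (by positivity) h1).trans ht.le

/-- Euclidean uniform continuity carries over because hyperbolically close points have comparable
heights, and heights are bounded on the support. -/
lemma uniformContinuous_hypCosh {n : ℕ} {g : Coord (n + 1) → ℝ} (hg : Continuous g)
    (hgc : HasCompactSupport g) (hgs : tsupport g ⊆ hypSpace (n + 1)) {η : ℝ} (hη : 0 < η) :
    ∃ δ : ℝ, 0 < δ ∧ ∀ x ∈ hypSpace (n + 1), ∀ y ∈ hypSpace (n + 1), hypCosh x y < 1 + δ →
      |g x - g y| ≤ η := by
  obtain ⟨r, hr, hgr⟩ := Metric.uniformContinuous_iff.1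
    (hgc.uniformContinuous_of_continuous hg) η hη
  obtain ⟨b, hb⟩ := hgc.isCompact.exists_bound_of_continuousOn
    (f := fun x : Coord (n + 1) => x 0) (by fun_prop)
  set B := max b 1 with hB
  have hB1 : 1 ≤ B := le_max_right _ _
  -- The bound $1$ forces $y_0\le4B$ when $x_0\le B$; then $|x-y|^2=2x_0y_0(u-1)<8B^2\cdot
  -- r^2/8B^2$.
  refine ⟨min 1 (r ^ 2 / (8 * B ^ 2)), by positivity, ?_⟩
  have key : ∀ x ∈ tsupport g, ∀ y ∈ hypSpace (n + 1),
      hypCosh x y < 1 + min 1 (r ^ 2 / (8 * B ^ 2)) → dist x y < r := by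
    intro x hx y hy hxy
    have hx0 : 0 < x 0 := hgs hx
    have hy0 : 0 < y 0 := hy
    have hxB : x 0 ≤ B := (le_abs_self _).trans ((hb x hx).trans (le_max_left _ _))
    have h1 : hypCosh x y < 2 := hxy.trans_le (by linarith [min_le_left 1 (r ^ 2 / (8 * B ^ 2))])
    have h2 : hypCosh x y < 1 + r ^ 2 / (8 * B ^ 2) := hxy.trans_le (by gcongr; exact min_le_right _ _)
    have h3 : y 0 / x 0 / 2 ≤ hypCosh x y := by
      rw [hypCosh_eq hx0 hy0]
      have : 0 ≤ (∑ i : Fin n, (x i.succ - y i.succ) ^ 2) / (2 * (1 * (x 0 * y 0))) :=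
        div_nonneg (Finset.sum_nonneg fun i _ => sq_nonneg _) (by positivity)
      have : 0 < x 0 / y 0 := by positivity
      linarith
    have h4 : y 0 ≤ 4 * B := by
      have h5 : y 0 / x 0 ≤ 4 := by linarith
      rw [div_le_iff₀ hx0] at h5
      linarith
    have h6 : dist x y ^ 2 < r ^ 2 := by
      have h7 : dist x y ^ 2 / (2 * (x 0 * y 0)) < r ^ 2 / (8 * B ^ 2) := by
        rw [hypCosh] at h2; linarith
      rw [div_lt_div_iff₀ (by positivity) (by positivity)] at h7
      have h8 : 2 * (x 0 * y 0) ≤ 8 * B ^ 2 := by nlinarith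
      have h9 : r ^ 2 * (2 * (x 0 * y 0)) ≤ r ^ 2 * (8 * B ^ 2) := by gcongr
      exact lt_of_mul_lt_mul_right (h7.trans_le h9) (by positivity)
    exact lt_of_pow_lt_pow_left₀ 2 hr.le h6
  intro x hx y hy hxy
  by_cases h1 : x ∈ tsupport g
  · have := hgr (key x h1 y hy hxy)
    rw [Real.dist_eq] at this
    exact this.le
  · by_cases h2 : y ∈ tsupport g
    · rw [hypCosh_comm] at hxy
      have := hgr (key y h2 x hx hxy)
      rw [Real.dist_eq, abs_sub_comm] at this
      exact this.le
    · rw [image_eq_zero_of_notMem_tsupport h1, image_eq_zero_of_notMem_tsupport h2]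
      simpa using hη.le

lemma integrable_hypKernel_mul {n : ℕ} {g : Coord (n + 1) → ℝ} (hg : Continuous g)
    (hgc : HasCompactSupport g) {y : Coord (n + 1)} (hy : y ∈ hypSpace (n + 1)) {t : ℝ}
    (ht : 0 < t) : Integrable (fun x => hypKernel x y t * g x) (hypVolume (n + 1)) := by
  obtain ⟨M, hM⟩ := hgc.exists_bound_of_continuous hg
  exact (integrable_hypKernel hy ht).mul_bdd hg.aestronglyMeasurable (ae_of_all _ hM)

/-- The heat kernel is an approximate identity, uniformly in the pole. -/
lemma eventually_abs_integral_hypKernel_sub_le {n : ℕ} {g : Coord (n + 1) → ℝ} (hg : Continuous g)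
    (hgc : HasCompactSupport g) (hgs : tsupport g ⊆ hypSpace (n + 1)) {η : ℝ} (hη : 0 < η) :
    ∀ᶠ t in 𝓝[>] (0 : ℝ), ∀ y ∈ hypSpace (n + 1),
      |∫ x, hypKernel x y t * g x ∂(hypVolume (n + 1)) - g y| ≤ η := by
  obtain ⟨M, hM⟩ := hgc.exists_bound_of_continuous hg
  have hM0 : 0 ≤ M := (norm_nonneg _).trans (hM 0)
  obtain ⟨δ, hδ, hδg⟩ := uniformContinuous_hypCosh hg hgc hgs (half_pos hη)
  -- The far part contributes at most $2M$ times this tolerance, hence at most $\eta/2$; the `+ 1`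
  -- covers $M=0$.
  have hη' : 0 < η / 2 / (2 * M + 1) := by positivity
  filter_upwards [eventually_integral_hypKernel_far_le n hδ hη', self_mem_nhdsWithin]
    with t ht ht0 y hy
  have ht0' : 0 < t := ht0
  have hk := integrable_hypKernel hy ht0'
  have h1 : ∫ x, hypKernel x y t * g x ∂(hypVolume (n + 1)) - g y =
      ∫ x, hypKernel x y t * (g x - g y) ∂(hypVolume (n + 1)) := by
    simp_rw [mul_sub]
    rw [integral_sub (integrable_hypKernel_mul hg hgc hy ht0') (hk.mul_const _), integral_mul_const,
      integral_hypKernel hy ht0', one_mul]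
  have hfar := measurableSet_far δ y
  have h2 : ∀ᵐ x ∂(hypVolume (n + 1)), ‖hypKernel x y t * (g x - g y)‖ ≤
      η / 2 * hypKernel x y t +
        (2 * M) * ({x | 1 + δ ≤ hypCosh x y}.indicator (fun x => hypKernel x y t) x) := by
    filter_upwards [ae_hypVolume_mem n] with x hx
    have hp := hypKernel_pos hx hy ht0'
    rw [norm_mul, Real.norm_eq_abs, abs_of_pos hp, Real.norm_eq_abs]
    by_cases hxy : 1 + δ ≤ hypCosh x y
    · rw [indicator_of_mem (by exact hxy)]
      have h3 : |g x - g y| ≤ 2 * M := by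
        have h4 := hM x
        have h5 := hM y
        rw [Real.norm_eq_abs] at h4 h5
        exact (abs_sub _ _).trans (by linarith)
      nlinarith
    · rw [indicator_of_notMem (by exact hxy)]
      have := hδg x hx y hy (not_le.1 hxy)
      nlinarith
  rw [h1, ← Real.norm_eq_abs]
  have hind := hk.indicator hfar
  refine (norm_integral_le_of_norm_le ((hk.const_mul (η / 2)).add (hind.const_mul (2 * M)))
    h2).trans ?_
  rw [integral_add' (hk.const_mul (η / 2)) (hind.const_mul (2 * M)), integral_const_mul,
    integral_const_mul, integral_hypKernel hy ht0', integral_indicator hfar]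
  have h6 := mul_le_mul_of_nonneg_left (ht y hy) (by positivity : 0 ≤ 2 * M)
  have h7 : 2 * M * (η / 2 / (2 * M + 1)) ≤ η / 2 := by
    rw [mul_div_assoc', div_le_iff₀ (by positivity)]
    nlinarith
  linarith

lemma isFundamentalSolution_hypKernel (n : ℕ) : IsFundamentalSolution (n + 1) hypKernel where
  continuousOn := continuousOn_hypKernel n
  contDiffOn_space := fun _ hy _ ht => contDiffOn_hypKernel hy ht
  contDiffOn_time := fun _ hx _ hy => contDiffOn_hypKernel_time hx hy
  nonneg := fun _ hx _ hy _ ht => (hypKernel_pos hx hy ht).le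
  heat_eq := fun x hx y hy t ht => by
    rw [(hasDerivAt_hypKernel_time hx hy ht).deriv]
    exact (hasLaplacianAt_hypKernel hx hy ht).unique
      (hasLaplacianAt_laplaceBeltrami (contDiffOn_hypKernel hy ht) hx)
  tendsto_dirac := fun y hy f hf hfc hfs => by
    rw [Metric.tendsto_nhds]
    intro η hη
    filter_upwards [eventually_abs_integral_hypKernel_sub_le hf hfc hfs (half_pos hη)] with t ht
    rw [Real.dist_eq]
    linarith [ht y hy]

lemma IsFundamentalSolution.congr {n : ℕ} {K K' : Coord (n + 1) → Coord (n + 1) → ℝ → ℝ}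
    (hK : IsFundamentalSolution (n + 1) K)
    (h : ∀ x ∈ hypSpace (n + 1), ∀ y ∈ hypSpace (n + 1), ∀ t : ℝ, 0 < t → K' x y t = K x y t) :
    IsFundamentalSolution (n + 1) K' where
  continuousOn := hK.continuousOn.congr fun q hq => h _ hq.1 _ hq.2.1 _ hq.2.2
  contDiffOn_space := fun y hy t ht =>
    (hK.contDiffOn_space y hy t ht).congr fun x hx => h x hx y hy t ht
  contDiffOn_time := fun x hx y hy =>
    (hK.contDiffOn_time x hx y hy).congr fun t ht => h x hx y hy t ht
  nonneg := fun x hx y hy t ht => by rw [h x hx y hy t ht]; exact hK.nonneg x hx y hy t ht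
  heat_eq := fun x hx y hy t ht => by
    have h1 : (fun s => K' x y s) =ᶠ[𝓝 t] fun s => K x y s := by
      filter_upwards [Ioi_mem_nhds ht] with s hs using h x hx y hy s hs
    rw [h1.deriv_eq, hK.heat_eq x hx y hy t ht]
    -- The two kernels agree only on the half-space, which suffices: it is open and the Laplacian is
    -- local.
    refine (hasLaplacianAt_laplaceBeltrami (hK.contDiffOn_space y hy t ht) hx).unique ?_
    have h2 := hasLaplacianAt_laplaceBeltrami
      ((hK.contDiffOn_space y hy t ht).congr fun x hx => h x hx y hy t ht) hx
    obtain ⟨D, D₂, g1, g2, g3⟩ := h2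
    refine ⟨D, D₂, fun i => ?_, g2, g3⟩
    filter_upwards [(eventually_line_mem (isOpen_hypSpace n) hx i).eventually_nhds, g1 i]
      with s hs gs
    exact gs.congr_of_eventuallyEq (hs.mono fun r hr => (h _ hr y hy t ht).symm)
  tendsto_dirac := fun y hy f hf hfc hfs => by
    refine (hK.tendsto_dirac y hy f hf hfc hfs).congr' ?_
    filter_upwards [self_mem_nhdsWithin] with t ht
    refine integral_congr_ae ?_
    filter_upwards [ae_hypVolume_mem n] with x hx
    rw [h x hx y hy t ht]

/-! ### The heat flow of compactly supported data. -/

lemma continuousOn_setIntegral {X Z : Type*} [TopologicalSpace X] [LocallyCompactSpace X]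
    [FirstCountableTopology X]
    [TopologicalSpace Z] [T2Space Z] [SecondCountableTopology Z] [MeasurableSpace Z] [BorelSpace Z]
    {μ : Measure Z} {V : Set X} {K : Set Z} {f : X → Z → ℝ} (hV : IsOpen V) (hK : IsCompact K)
    (hμ : μ K ≠ ⊤) (hf : ContinuousOn (fun q : X × Z => f q.1 q.2) (V ×ˢ K)) :
    ContinuousOn (fun x => ∫ z in K, f x z ∂μ) V := by
  intro x hx
  obtain ⟨N, hN, hNV, hNc⟩ := local_compact_nhds (hV.mem_nhds hx)
  obtain ⟨C, hC⟩ := (hNc.prod hK).exists_bound_of_continuousOn (hf.mono (prod_mono hNV le_rfl))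
  refine ContinuousAt.continuousWithinAt
    (continuousAt_of_dominated (bound := fun _ => C) ?_ ?_ (integrableOn_const hμ) ?_)
  · filter_upwards [hV.mem_nhds hx] with v hv
    exact (hf.comp (f := fun z => (v, z)) (by fun_prop)
      (fun z hz => ⟨hv, hz⟩)).aestronglyMeasurable_of_isCompact hK hK.measurableSet
  · filter_upwards [hN] with v hv
    exact (ae_restrict_iff' hK.measurableSet).2 (ae_of_all _ fun z hz => hC (v, z) ⟨hv, hz⟩)
  · refine (ae_restrict_iff' hK.measurableSet).2 (ae_of_all _ fun z hz => ?_)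
    exact (hf.comp (f := fun v => (v, z)) (s := V) (by fun_prop)
      (fun v hv => ⟨hv, hz⟩)).continuousAt (hV.mem_nhds hx)

/-- The solution of the heat equation with compactly supported initial value `g`. -/
def heatFlow {n : ℕ} (g : Coord (n + 1) → ℝ) (x : Coord (n + 1)) (t : ℝ) : ℝ :=
  ∫ z in tsupport g, hypKernel x z t * g z ∂(hypVolume (n + 1))

lemma heatFlow_eq {n : ℕ} (g : Coord (n + 1) → ℝ) (x : Coord (n + 1)) (t : ℝ) :
    heatFlow g x t = ∫ z, hypKernel z x t * g z ∂(hypVolume (n + 1)) := by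
  rw [heatFlow, setIntegral_eq_integral_of_forall_compl_eq_zero]
  · simp_rw [hypKernel_comm x]
  · intro z hz
    rw [image_eq_zero_of_notMem_tsupport hz, mul_zero]

lemma continuousOn_kernel_mul {n : ℕ} {g : Coord (n + 1) → ℝ} (hg : Continuous g)
    (hgs : tsupport g ⊆ hypSpace (n + 1))
    {f : Coord (n + 1) → Coord (n + 1) → ℝ → ℝ}
    (hf : ContinuousOn (fun q : Coord (n + 1) × Coord (n + 1) × ℝ => f q.1 q.2.1 q.2.2)
      (kernelDomain n)) {X : Type*} [TopologicalSpace X] {V : Set X} {a : X → Coord (n + 1)}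
    {b : X → ℝ} (ha : Continuous a) (hb : Continuous b) (haV : ∀ v ∈ V, a v ∈ hypSpace (n + 1))
    (hbV : ∀ v ∈ V, 0 < b v) :
    ContinuousOn (fun q : X × Coord (n + 1) => f (a q.1) q.2 (b q.1) * g q.2)
      (V ×ˢ tsupport g) :=
  (hf.comp (f := fun q : X × Coord (n + 1) => (a q.1, q.2, b q.1)) (by fun_prop)
    fun q hq => ⟨haV _ hq.1, hgs hq.2, hbV _ hq.1⟩).mul (by fun_prop)

lemma hasDerivAt_heatFlow_time {n : ℕ} {g : Coord (n + 1) → ℝ} (hg : Continuous g)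
    (hgc : HasCompactSupport g) (hgs : tsupport g ⊆ hypSpace (n + 1))
    {x : Coord (n + 1)} (hx : x ∈ hypSpace (n + 1)) {t : ℝ}
    (ht : 0 < t) : HasDerivAt (fun t => heatFlow g x t)
      (∫ z in tsupport g, hypKernelDt x z t * g z ∂(hypVolume (n + 1))) t :=
  hasDerivAt_setIntegral_of_continuousOn (V := Ioi 0) isOpen_Ioi ht hgc.isCompact
    (hypVolume_ne_top hgc.isCompact hgs)
    (continuousOn_kernel_mul hg hgs (continuousOn_hypKernel n) (a := fun _ => x) continuous_const
      continuous_id (fun _ _ => hx) fun _ h => h)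
    (continuousOn_kernel_mul hg hgs (continuousOn_hypKernelDt n) (a := fun _ => x)
      continuous_const continuous_id (fun _ _ => hx) fun _ h => h)
    fun _ hs z hz => (hasDerivAt_hypKernel_time hx (hgs hz) hs).mul_const (g z)

lemma hasLaplacianAt_heatFlow {n : ℕ} {g : Coord (n + 1) → ℝ} (hg : Continuous g)
    (hgc : HasCompactSupport g) (hgs : tsupport g ⊆ hypSpace (n + 1))
    {x : Coord (n + 1)} (hx : x ∈ hypSpace (n + 1)) {t : ℝ}
    (ht : 0 < t) : HasLaplacianAt (fun x => heatFlow g x t)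
      (∫ z in tsupport g, hypKernelDt x z t * g z ∂(hypVolume (n + 1))) x := by
  have hμ := hypVolume_ne_top hgc.isCompact hgs
  have hVo : ∀ i : Fin (n + 1), IsOpen {s : ℝ | x + s • coordVec i ∈ hypSpace (n + 1)} := fun i =>
    (isOpen_hypSpace n).preimage (by fun_prop)
  have h0 : ∀ i : Fin (n + 1), (0 : ℝ) ∈ {s : ℝ | x + s • coordVec i ∈ hypSpace (n + 1)} :=
    fun i => by simpa using hx
  refine ⟨fun i s => ∫ z in tsupport g, hypKernelD i (x + s • coordVec i) z t * g z
    ∂(hypVolume (n + 1)), fun i => ∫ z in tsupport g, hypKernelD2 i x z t * g z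
    ∂(hypVolume (n + 1)), fun i => ?_, fun i => ?_, ?_⟩
  · filter_upwards [(hVo i).mem_nhds (h0 i)] with s hs
    exact hasDerivAt_setIntegral_of_continuousOn (hVo i) hs hgc.isCompact hμ
      (continuousOn_kernel_mul hg hgs (continuousOn_hypKernel n)
        (a := fun s : ℝ => x + s • coordVec i) (b := fun _ => t) (by fun_prop) continuous_const
        (fun _ h => h) fun _ _ => ht)
      (continuousOn_kernel_mul hg hgs (continuousOn_hypKernelD i)
        (a := fun s : ℝ => x + s • coordVec i) (b := fun _ => t) (by fun_prop) continuous_const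
        (fun _ h => h) fun _ _ => ht)
      fun s hs z hz => (hasDerivAt_hypKernel_line i hs (hgs hz) ht).mul_const (g z)
  · have := hasDerivAt_setIntegral_of_continuousOn (hVo i) (h0 i) hgc.isCompact hμ
      (continuousOn_kernel_mul hg hgs (continuousOn_hypKernelD i)
        (a := fun s : ℝ => x + s • coordVec i) (b := fun _ => t) (by fun_prop) continuous_const
        (fun _ h => h) fun _ _ => ht)
      (continuousOn_kernel_mul hg hgs (continuousOn_hypKernelD2 i)
        (a := fun s : ℝ => x + s • coordVec i) (b := fun _ => t) (by fun_prop) continuous_const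
        (fun _ h => h) fun _ _ => ht)
      fun s hs z hz => (hasDerivAt_hypKernelD_line i hs (hgs hz) ht).mul_const (g z)
    simpa using this
  · have hint : ∀ {f : Coord (n + 1) → Coord (n + 1) → ℝ → ℝ}, ContinuousOn
        (fun q : Coord (n + 1) × Coord (n + 1) × ℝ => f q.1 q.2.1 q.2.2) (kernelDomain n) →
        Integrable (fun z => f x z t * g z) ((hypVolume (n + 1)).restrict (tsupport g)) := by
      intro f hf
      have hc : ContinuousOn (fun z => f x z t * g z) (tsupport g) :=
        (continuousOn_kernel_mul hg hgs hf (X := ℝ) (V := univ) (a := fun _ => x) (b := fun _ => t)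
          continuous_const continuous_const (fun _ _ => hx) fun _ _ => ht).comp
          (f := fun z => ((0 : ℝ), z)) (by fun_prop) fun z hz => ⟨mem_univ _, hz⟩
      obtain ⟨C, hC⟩ := hgc.isCompact.exists_bound_of_continuousOn hc
      exact Integrable.mono' (integrableOn_const (C := C) hμ)
        (hc.aestronglyMeasurable_of_isCompact hgc.isCompact hgc.isCompact.measurableSet)
        ((ae_restrict_iff' hgc.isCompact.measurableSet).2 (ae_of_all _ hC))
    simp only [zero_smul, add_zero]
    rw [← integral_finsetSum _ fun i _ => hint (continuousOn_hypKernelD2 i),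
      ← integral_const_mul, ← integral_const_mul, ← integral_add
        ((integrable_finsetSum _ fun i _ => hint (continuousOn_hypKernelD2 i)).const_mul _)
        ((hint (continuousOn_hypKernelD 0)).const_mul _)]
    refine setIntegral_congr_fun hgc.isCompact.measurableSet fun z hz => ?_
    rw [← hypKernelD2_sum hx (hgs hz) t, ← Finset.sum_mul]
    ring

lemma continuousOn_heatFlow {n : ℕ} {g : Coord (n + 1) → ℝ} (hg : Continuous g)
    (hgc : HasCompactSupport g) (hgs : tsupport g ⊆ hypSpace (n + 1)) :
    ContinuousOn (fun q : Coord (n + 1) × ℝ => heatFlow g q.1 q.2)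
    (hypSpace (n + 1) ×ˢ Ioi 0) :=
  continuousOn_setIntegral ((isOpen_hypSpace n).prod isOpen_Ioi) hgc.isCompact
    (hypVolume_ne_top hgc.isCompact hgs)
    (continuousOn_kernel_mul hg hgs (continuousOn_hypKernel n) (a := Prod.fst) (b := Prod.snd)
      continuous_fst continuous_snd (fun _ h => h.1) fun _ h => h.2)

/-- Properness of the distance: $u\le m$ forces $z_0/x_0\le2m$ and $x_0/z_0\le2m$, which keeps $x$
away from the boundary, and then bounds $|x-z|$. -/
lemma exists_compact_hypCosh_gt {n : ℕ} {K : Set (Coord (n + 1))} (hK : IsCompact K)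
    (hKH : K ⊆ hypSpace (n + 1)) {m : ℝ} (hm : 0 < m) :
    ∃ C ⊆ hypSpace (n + 1), IsCompact C ∧ ∀ x ∈ hypSpace (n + 1), x ∉ C → ∀ z ∈ K,
      m < hypCosh x z := by
  rcases K.eq_empty_or_nonempty with rfl | hne
  · exact ⟨∅, by simp, isCompact_empty, by simp⟩
  obtain ⟨z₁, hz₁, hmin⟩ := hK.exists_isMinOn hne (f := fun z : Coord (n + 1) => z 0) (by fun_prop)
  obtain ⟨z₂, hz₂, hmax⟩ := hK.exists_isMaxOn hne (f := fun z : Coord (n + 1) => z 0) (by fun_prop)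
  obtain ⟨R, hR⟩ := hK.isBounded.exists_norm_le
  have ha : 0 < z₁ 0 := hKH hz₁
  have hb : 0 < z₂ 0 := hKH hz₂
  refine ⟨{x | z₁ 0 / (2 * m) ≤ x 0} ∩ Metric.closedBall 0 (R + 2 * m * z₂ 0), fun x hx => ?_,
    (isCompact_closedBall _ _).inter_left (isClosed_le continuous_const (by fun_prop)),
    fun x hx hxC z hz => ?_⟩
  · have h1 : z₁ 0 / (2 * m) ≤ x 0 := hx.1
    exact lt_of_lt_of_le (by positivity : 0 < z₁ 0 / (2 * m)) h1
  · by_contra! hU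
    have hx0 : 0 < x 0 := hx
    have hz0 : 0 < z 0 := hKH hz
    have hza : z₁ 0 ≤ z 0 := hmin hz
    have hzb : z 0 ≤ z₂ 0 := hmax hz
    have hD : 0 ≤ (∑ i : Fin n, (x i.succ - z i.succ) ^ 2) / (2 * (1 * (x 0 * z 0))) :=
      div_nonneg (Finset.sum_nonneg fun i _ => sq_nonneg _) (by positivity)
    have hU' := hU
    rw [hypCosh_eq hx0 hz0] at hU'
    have h1 : 0 < x 0 / z 0 := by positivity
    have h2 : 0 < z 0 / x 0 := by positivity
    have h3 : z 0 / x 0 ≤ 2 * m := by linarith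
    have h4 : x 0 / z 0 ≤ 2 * m := by linarith
    rw [div_le_iff₀ hx0] at h3
    rw [div_le_iff₀ hz0] at h4
    refine hxC ⟨?_, ?_⟩
    · rw [mem_ofPred_eq, div_le_iff₀ (by positivity)]
      linarith
    · rw [mem_closedBall_zero_iff]
      have h5 : dist x z ^ 2 ≤ (2 * m * z₂ 0) ^ 2 := by
        have h6 : dist x z ^ 2 / (2 * (x 0 * z 0)) ≤ m := by
          rw [hypCosh] at hU; linarith
        rw [div_le_iff₀ (by positivity)] at h6
        have h7 : x 0 ≤ 2 * m * z₂ 0 := h4.trans (by gcongr)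
        have h8 : x 0 * z 0 ≤ 2 * m * z₂ 0 * z₂ 0 := by gcongr
        have h9 := mul_le_mul_of_nonneg_left h8 (by positivity : 0 ≤ m * 2)
        nlinarith
      have h6 : dist x z ≤ 2 * m * z₂ 0 := le_of_sq_le_sq h5 (by positivity)
      calc ‖x‖ = ‖z + (x - z)‖ := by simp
        _ ≤ ‖z‖ + ‖x - z‖ := norm_add_le _ _
        _ ≤ R + 2 * m * z₂ 0 := add_le_add (hR z hz) (by rwa [← dist_eq_norm])

/-- The heat flow vanishes at infinity, locally uniformly in time. -/
lemma exists_compact_heatFlow_le {n : ℕ} {g : Coord (n + 1) → ℝ} (hg : Continuous g)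
    (hgc : HasCompactSupport g) (hgs : tsupport g ⊆ hypSpace (n + 1)) {t₁ t₂ η : ℝ} (h₁ : 0 < t₁)
    (hη : 0 < η) : ∃ C ⊆ hypSpace (n + 1), IsCompact C ∧ ∀ x ∈ hypSpace (n + 1), x ∉ C →
      ∀ t, t₁ ≤ t → t ≤ t₂ → heatFlow g x t ≤ η := by
  obtain ⟨A, hA0, hA⟩ := profile_decay n h₁ (t₂ := t₂)
  obtain ⟨M, hM⟩ := hgc.exists_bound_of_continuous hg
  have hM0 : 0 ≤ M := (norm_nonneg _).trans (hM 0)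
  have hpi := Real.pi_pos
  have hμ := hypVolume_ne_top hgc.isCompact hgs
  set v := (hypVolume (n + 1)).real (tsupport g) with hv
  set B := (√(2 * Real.pi) ^ n)⁻¹ * A * M with hB
  have hB0 : 0 ≤ B := by positivity
  have hv0 : 0 ≤ v := measureReal_nonneg
  -- Chosen so that $(B/m)\,v\le\eta$, where $v$ is the volume of the support.
  set m := B * v / η + 1 with hm
  have hm0 : 0 < m := by positivity
  obtain ⟨C, hC1, hC2, hC3⟩ := exists_compact_hypCosh_gt hgc.isCompact hgs hm0
  refine ⟨C, hC1, hC2, fun x hx hxC t ht₁ ht₂ => ?_⟩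
  have ht0 : 0 < t := h₁.trans_le ht₁
  have h2 : ∀ z ∈ tsupport g, ‖hypKernel x z t * g z‖ ≤ B / m := by
    intro z hz
    have hU := hC3 x hx hxC z hz
    have hU0 := hypCosh_pos hx (hgs hz)
    have h3 : hypKernel x z t ≤ (√(2 * Real.pi) ^ n)⁻¹ * (A / m) := by
      refine mul_le_mul ?_ ((hA _ t hU0 ht₁ ht₂).trans ?_) (profile_pos n hU0 ht0).le
        (by positivity)
      · rw [timeFactor]
        refine mul_le_of_le_one_right (by positivity) (Real.exp_le_one_iff.2 ?_)
        have : 0 ≤ ((n : ℝ) / 2) ^ 2 * t := by positivity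
        linarith
      · gcongr
        linarith
    rw [norm_mul, Real.norm_eq_abs, abs_of_pos (hypKernel_pos hx (hgs hz) ht0)]
    refine (mul_le_mul h3 (hM z) (norm_nonneg _) (by positivity)).trans_eq ?_
    rw [hB]
    ring
  have h4 := norm_setIntegral_le_of_norm_le_const (μ := hypVolume (n + 1)) (lt_top_iff_ne_top.2 hμ)
    h2
  refine (le_abs_self _).trans (h4.trans ?_)
  rw [← hv, div_mul_eq_mul_div, div_le_iff₀ hm0, hm, mul_add, mul_div_cancel₀ _ hη.ne']
  linarith

/-! ### The minimum principle and minimality of the kernel. -/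

lemma deriv_nonpos_of_left_min {f : ℝ → ℝ} {f' a b : ℝ} (hab : a < b) (hf : HasDerivAt f f' b)
    (hmin : ∀ s, a < s → s < b → f b ≤ f s) : f' ≤ 0 := by
  refine le_of_tendsto (hasDerivAt_iff_tendsto_slope_left_right.1 hf).1 ?_
  filter_upwards [Ioo_mem_nhdsLT hab] with s hs
  rw [slope_def_field]
  exact div_nonpos_of_nonneg_of_nonpos (sub_nonneg.2 (hmin s hs.1 hs.2)) (by linarith [hs.2])

/-- The weak minimum principle for the heat equation on hyperbolic space, for functions that are
asymptotically nonnegative at infinity. -/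
lemma heat_minimum_principle {n : ℕ} {E : Coord (n + 1) → ℝ → ℝ} {T c : ℝ} (hc : 0 ≤ c)
    (hcont : ContinuousOn (fun q : Coord (n + 1) × ℝ => E q.1 q.2)
      (hypSpace (n + 1) ×ˢ Icc 0 T))
    (hheat : ∀ x ∈ hypSpace (n + 1), ∀ t, 0 < t → t ≤ T →
      ∃ L, HasLaplacianAt (fun x => E x t) L x ∧ HasDerivAt (fun t => E x t) L t)
    (hinf : ∀ η, 0 < η → ∃ C ⊆ hypSpace (n + 1), IsCompact C ∧ ∀ x ∈ hypSpace (n + 1), x ∉ C →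
      ∀ t, 0 ≤ t → t ≤ T → -η ≤ E x t)
    (hinit : ∀ x ∈ hypSpace (n + 1), -c ≤ E x 0) :
    ∀ x ∈ hypSpace (n + 1), ∀ t, 0 ≤ t → t ≤ T → -c ≤ E x t := by
  intro x₁ hx₁ t₁ ht₁ ht₁T
  by_contra! hlt
  -- The tilt by $\sigma t$ makes the inequality strict: a minimum at positive time gives $L\ge0$
  -- and $L+\sigma\le0$.
  obtain ⟨σ, hσ, hσE⟩ : ∃ σ, 0 < σ ∧ E x₁ t₁ + σ * t₁ < -c := by
    refine ⟨(-c - E x₁ t₁) / (2 * (t₁ + 1)), div_pos (by linarith) (by linarith), ?_⟩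
    have h1 : (-c - E x₁ t₁) / (2 * (t₁ + 1)) * t₁ ≤ (-c - E x₁ t₁) / 2 := by
      rw [div_mul_eq_mul_div, div_le_iff₀ (by linarith)]
      nlinarith
    linarith
  set v := E x₁ t₁ + σ * t₁ with hv
  have hv0 : v < 0 := by linarith
  -- Outside `C` the function is at least $v/2>v$, so a minimum over `C` is global.
  obtain ⟨C, hCH, hC, hCout⟩ := hinf (-v / 2) (by linarith)
  have hout : ∀ x ∈ hypSpace (n + 1), x ∉ C → ∀ t, 0 ≤ t → t ≤ T → v < E x t + σ * t := by
    intro x hx hxC t ht htT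
    have := hCout x hx hxC t ht htT
    have : 0 ≤ σ * t := by positivity
    linarith
  have hx₁C : x₁ ∈ C := by
    by_contra h
    exact lt_irrefl _ (hout x₁ hx₁ h t₁ ht₁ ht₁T)
  have hcont' : ContinuousOn (fun q : Coord (n + 1) × ℝ => E q.1 q.2 + σ * q.2) (C ×ˢ Icc 0 T) :=
    (hcont.mono (prod_mono hCH le_rfl)).add (by fun_prop)
  obtain ⟨⟨x, t⟩, ⟨hxC, ht⟩, hmin⟩ := (hC.prod isCompact_Icc).exists_isMinOn
    ⟨(x₁, t₁), hx₁C, ht₁, ht₁T⟩ hcont'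
  have hle : E x t + σ * t ≤ v := hmin
    (show ((x₁, t₁) : Coord (n + 1) × ℝ) ∈ C ×ˢ Icc 0 T from ⟨hx₁C, ht₁, ht₁T⟩)
  have hglob : ∀ z ∈ hypSpace (n + 1), ∀ s, 0 ≤ s → s ≤ T → E x t + σ * t ≤ E z s + σ * s := by
    intro z hz s hs hsT
    by_cases hzC : z ∈ C
    · exact hmin (show ((z, s) : Coord (n + 1) × ℝ) ∈ C ×ˢ Icc 0 T from ⟨hzC, hs, hsT⟩)
    · exact hle.trans (hout z hz hzC s hs hsT).le
  have hx : x ∈ hypSpace (n + 1) := hCH hxC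
  have htpos : 0 < t := by
    rcases ht.1.eq_or_lt with h | h
    · exfalso
      have h' : t = 0 := h.symm
      subst h'
      have := hinit x hx
      simp only [mul_zero, add_zero] at hle
      linarith
    · exact h
  obtain ⟨L, hL, hLt⟩ := hheat x hx t htpos ht.2
  have hL0 : 0 ≤ L := by
    refine hL.nonneg_of_isLocalMin ?_
    filter_upwards [(isOpen_hypSpace n).mem_nhds hx] with z hz
    have := hglob z hz t ht.1 ht.2
    linarith
  -- The minimum may occur at $t=T$, so only earlier times are compared.
  have hLσ : L + σ ≤ 0 := by
    have h1 : HasDerivAt ((fun t => E x t) + fun y => σ * y) (L + σ) t := by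
      simpa using hLt.add ((hasDerivAt_id t).const_mul σ)
    exact deriv_nonpos_of_left_min htpos h1 fun s hs hst =>
      hglob x hx s hs.le (hst.le.trans ht.2)
  linarith

lemma IsFundamentalSolution.hasDerivAt_time {n : ℕ}
    {K : Coord (n + 1) → Coord (n + 1) → ℝ → ℝ} (hK : IsFundamentalSolution (n + 1) K)
    {x y : Coord (n + 1)} (hx : x ∈ hypSpace (n + 1)) (hy : y ∈ hypSpace (n + 1)) {t : ℝ}
    (ht : 0 < t) : HasDerivAt (fun t => K x y t)
      (laplaceBeltrami (hypMetric (n + 1)) (fun z => K z y t) x) t := by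
  rw [← hK.heat_eq x hx y hy t ht]
  exact (((hK.contDiffOn_time x hx y hy).contDiffAt (Ioi_mem_nhds ht)).differentiableAt
    (by norm_num)).hasDerivAt

/-- A nonnegative solution dominates the heat flow of any smaller initial value. -/
lemma heatFlow_le_of_le {n : ℕ} {K : Coord (n + 1) → Coord (n + 1) → ℝ → ℝ}
    (hK : IsFundamentalSolution (n + 1) K) {y : Coord (n + 1)} (hy : y ∈ hypSpace (n + 1))
    {s : ℝ} (hs : 0 < s) {g : Coord (n + 1) → ℝ} (hg : Continuous g) (hgc : HasCompactSupport g)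
    (hgs : tsupport g ⊆ hypSpace (n + 1)) (hgK : ∀ x ∈ hypSpace (n + 1), g x ≤ K x y s)
    {x : Coord (n + 1)} (hx : x ∈ hypSpace (n + 1)) {t : ℝ} (ht : 0 < t) :
    heatFlow g x t ≤ K x y (t + s) := by
  refine le_of_forall_pos_le_add fun η hη => ?_
  have hev := eventually_abs_integral_hypKernel_sub_le hg hgc hgs hη
  have hlim : Tendsto (fun ε => heatFlow g x (t + ε)) (𝓝[>] 0) (𝓝 (heatFlow g x t)) := by
    have h1 : ContinuousAt (fun τ => heatFlow g x τ) t :=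
      (hasDerivAt_heatFlow_time hg hgc hgs hx ht).continuousAt
    have h2 : Tendsto (fun ε : ℝ => t + ε) (𝓝[>] 0) (𝓝 t) := by
      have : Tendsto (fun ε : ℝ => t + ε) (𝓝 0) (𝓝 (t + 0)) :=
        (by fun_prop : Continuous fun ε : ℝ => t + ε).tendsto 0
      rw [add_zero] at this
      exact this.mono_left nhdsWithin_le_nhds
    exact h1.tendsto.comp h2
  refine le_of_tendsto hlim ?_
  filter_upwards [hev, self_mem_nhdsWithin] with ε hε hε0
  have hε0' : 0 < ε := hε0
  -- The integral defining the flow is used only at positive times, so it is started at time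
  -- $\varepsilon$, where it exceeds $g$ by at most $\eta$ uniformly. Nonnegativity of $K$ and decay
  -- of the flow give the condition at infinity.
  have key := heat_minimum_principle (E := fun x τ => K x y (τ + s) - heatFlow g x (τ + ε))
    (T := t) hη.le ?_ ?_ ?_ ?_ x hx t ht.le le_rfl
  · linarith
  · refine ContinuousOn.sub
      (hK.continuousOn.comp (f := fun q : Coord (n + 1) × ℝ => (q.1, y, q.2 + s)) (by fun_prop)
        fun q hq => ⟨hq.1, hy, ?_⟩)
      ((continuousOn_heatFlow hg hgc hgs).comp
        (f := fun q : Coord (n + 1) × ℝ => (q.1, q.2 + ε)) (by fun_prop) fun q hq => ⟨hq.1, ?_⟩)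
    · have := hq.2.1
      exact (by linarith : 0 < q.2 + s)
    · have := hq.2.1
      exact (by linarith : 0 < q.2 + ε)
  · intro z hz τ hτ _
    refine ⟨_, (hasLaplacianAt_laplaceBeltrami (hK.contDiffOn_space y hy (τ + s)
      (by linarith)) hz).sub (hasLaplacianAt_heatFlow hg hgc hgs hz (by linarith : 0 < τ + ε)), ?_⟩
    exact ((hK.hasDerivAt_time hz hy (by linarith : 0 < τ + s)).comp_add_const τ s).sub
      ((hasDerivAt_heatFlow_time hg hgc hgs hz (by linarith : 0 < τ + ε)).comp_add_const τ ε)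
  · intro η' hη'
    obtain ⟨C, hCH, hC, hCout⟩ := exists_compact_heatFlow_le hg hgc hgs (t₂ := t + ε) hε0' hη'
    refine ⟨C, hCH, hC, fun z hz hzC τ hτ hτT => ?_⟩
    have h1 := hCout z hz hzC (τ + ε) (by linarith) (by linarith)
    have h2 := hK.nonneg z hz y hy (τ + s) (by linarith)
    linarith
  · intro z hz
    have h1 := hε z hz
    rw [← heatFlow_eq] at h1
    have h2 := hgK z hz
    have h3 := (abs_le.1 h1).2
    simp only [zero_add]
    linarith

lemma continuous_mul_of_tsupport_subset {X : Type*} [TopologicalSpace X] {V : Set X}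
    (hV : IsOpen V) {φ f : X → ℝ} (hφ : Continuous φ) (hφV : tsupport φ ⊆ V)
    (hf : ContinuousOn f V) : Continuous fun x => φ x * f x :=
  (hφ.continuousOn.mul hf).continuous_of_tsupport_subset hV
    ((tsupport_mul_subset_left (f := φ) (g := f)).trans hφV)

/-- The explicit heat kernel is minimal among nonnegative fundamental solutions. -/
lemma hypKernel_le {n : ℕ} {K : Coord (n + 1) → Coord (n + 1) → ℝ → ℝ}
    (hK : IsFundamentalSolution (n + 1) K) {x y : Coord (n + 1)} (hx : x ∈ hypSpace (n + 1))
    (hy : y ∈ hypSpace (n + 1)) {t : ℝ} (ht : 0 < t) : hypKernel x y t ≤ K x y t := by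
  -- The cut-off serves twice: it makes $K(\cdot,y,s)$ admissible initial data, and afterwards turns
  -- the explicit kernel into a test function for the Dirac property of $K$.
  obtain ⟨φ, hφ1, hφc, hφs, hφ01⟩ := exists_continuousMap_one_of_isCompact_subset_isOpen
    (isCompact_singleton (x := y)) (isOpen_hypSpace n) (by simpa using hy)
  have hφy : φ y = 1 := hφ1 rfl
  have hmul : ∀ {f : Coord (n + 1) → ℝ}, ContinuousOn f (hypSpace (n + 1)) →
      Continuous (fun z => φ z * f z) ∧ HasCompactSupport (fun z => φ z * f z) ∧
        tsupport (fun z => φ z * f z) ⊆ hypSpace (n + 1) := fun {f} hf =>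
    ⟨continuous_mul_of_tsupport_subset (isOpen_hypSpace n) φ.continuous hφs hf,
      HasCompactSupport.mul_right (f := φ) (f' := f) hφc,
      (tsupport_mul_subset_left (f := φ) (g := f)).trans hφs⟩
  have hstep : ∀ s, 0 < s → ∫ z, K z y s * (φ z * hypKernel z x t) ∂(hypVolume (n + 1)) ≤
      K x y (t + s) := by
    intro s hs
    obtain ⟨h1, h2, h3⟩ := hmul (hK.contDiffOn_space y hy s hs).continuousOn
    have h4 := heatFlow_le_of_le hK hy hs h1 h2 h3 (fun z hz =>
      mul_le_of_le_one_left (hK.nonneg z hz y hy s hs) (hφ01 z).2) hx ht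
    rw [heatFlow_eq] at h4
    refine le_of_eq_of_le (integral_congr_ae (Eventually.of_forall fun z => ?_)) h4
    dsimp only
    ring
  -- As $s\downarrow0$, $K(\cdot,y,s)$ tends to the Dirac mass at $y$; since $\varphi(y)=1$ and the
  -- explicit kernel is symmetric, the left side tends to its value at $(x,y,t)$.
  obtain ⟨h1, h2, h3⟩ := hmul (continuousOn_hypKernel_left hx ht)
  have hl := hK.tendsto_dirac y hy _ h1 h2 h3
  have hr : Tendsto (fun s => K x y (t + s)) (𝓝[>] 0) (𝓝 (K x y t)) := by
    have h5 : ContinuousAt (fun t => K x y t) t := (hK.hasDerivAt_time hx hy ht).continuousAt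
    have h6 : Tendsto (fun s : ℝ => t + s) (𝓝 0) (𝓝 (t + 0)) :=
      (by fun_prop : Continuous fun s : ℝ => t + s).tendsto 0
    rw [add_zero] at h6
    exact h5.tendsto.comp (h6.mono_left nhdsWithin_le_nhds)
  have := le_of_tendsto_of_tendsto hl hr
    (by filter_upwards [self_mem_nhdsWithin] with s hs using hstep s hs)
  rwa [hφy, one_mul, hypKernel_comm] at this

/-- Two smallest elements bound each other. Conversely, agreement on the domain carries over both
the defining properties and minimality. -/
lemma isHeatKernel_iff {n : ℕ} (K : Coord (n + 1) → Coord (n + 1) → ℝ → ℝ) :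
    IsHeatKernel (n + 1) K ↔ ∀ x ∈ hypSpace (n + 1), ∀ y ∈ hypSpace (n + 1), ∀ t : ℝ, 0 < t →
      K x y t = hypKernel x y t := by
  refine ⟨fun h x hx y hy t ht => le_antisymm
    (h.minimal _ (isFundamentalSolution_hypKernel n) x hx y hy t ht)
    (hypKernel_le h.isFundamentalSolution hx hy ht),
    fun h => ⟨(isFundamentalSolution_hypKernel n).congr h, fun K' hK' x hx y hy t ht => ?_⟩⟩
  rw [h x hx y hy t ht]
  exact hypKernel_le hK' hx hy ht

end HypHeat

end

theorem mainTheorem5 (d : ℕ) [NeZero d] :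
    ∃ p : ℝ → ℝ → ℝ,
      (∀ K : HypHeat.Coord d → HypHeat.Coord d → ℝ → ℝ,
        HypHeat.IsHeatKernel d K ↔
          ∀ x ∈ HypHeat.hypSpace d, ∀ y ∈ HypHeat.hypSpace d, ∀ t : ℝ, 0 < t →
            K x y t = p (HypHeat.hypDist d x y) t) ∧
      ∀ t : ℝ, 0 < t → StrictAntiOn (fun ρ => p ρ t) (Set.Ici 0) := by
  obtain ⟨n, rfl⟩ := Nat.exists_eq_succ_of_ne_zero (NeZero.ne d)
  refine ⟨fun ρ t => HypHeat.timeFactor n t * HypHeat.profile n (Real.cosh ρ) t, fun K => ?_,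
    fun t ht ρ hρ r hr hρr => ?_⟩
  · refine (HypHeat.isHeatKernel_iff K).trans ?_
    refine forall₂_congr fun x hx => forall₂_congr fun y hy => forall₂_congr fun t _ => ?_
    rw [HypHeat.hypKernel, ← HypHeat.cosh_hypDist hx hy]
  -- The profile decreases in $u$, and $\cosh$ increases on $[0,\infty)$.
  · refine mul_lt_mul_of_pos_left (HypHeat.profile_antitoneOn n ht (Real.cosh_pos _)
      (Real.cosh_pos _) ?_) (HypHeat.timeFactor_pos n t)
    rw [Real.cosh_lt_cosh, abs_of_nonneg hρ, abs_of_nonneg hr]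
    exact hρr
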